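/- Let $n,p\ge 1$ and let $\kappa$ be a positive integer. **The algebra.** Let $\dot W=\mathfrak S_n\ltimes P$ with $P=\bigoplus_{i=1}^n\mathbb Z\epsilon_i$ be the extended affine Weyl group of $\mathfrak{gl}_n$ (so $w\,t_\eta\,w^{-1}=t_{w(\eta)}$ for $w\in\mathfrak S_n$, $\eta\in P$). It acts on $\dot{\mathfrak h}=\bigoplus_{i=1}^n\mathbb C\epsilon_i^\vee\oplus\mathbb C c$ by $w(\epsilon_i^\vee)=\epsilon_{w(i)}^\vee$, $w(c)=c$ for $w\in \mathfrak S_n$, and $t_\eta(h)=h-\langle\eta\,|\,h\rangle c$ for $\eta\in P$, where $\langle\epsilon_i|\epsilon^\vee_j\rangle=\delta_{ij}$ and $\langle\epsilon_i|c\rangle=0$. Let $s_i=(i\ i{+}1)$ and $\alpha_i=\epsilon_i-\epsilon_{i+1}$ for $1\le i\le n-1$; if $n\ge2$ let $s_0=t_{\epsilon_1-\epsilon_n}\cdot(1\ n)$ and let $\alpha_0$ be the functional $\epsilon_n-\epsilon_1$ on $\dot{\mathfrak h}$; let $\pi=t_{\epsilon_1}s_1\cdots s_{n-1}$. The degenerate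 double affine Hecke algebra $\ddot H_n$ of $\mathfrak{gl}_n$ is the unital associative $\mathbb C$-algebra generated by the group algebra $\mathbb C[\dot W]$ and the symmetric algebra $S(\dot{\mathfrak h})$ subject to the relations $$s_i\,h-s_i(h)\,s_i=-\langle\alpha_i|h\rangle,\qquad \pi\,h=\pi(h)\,\pi\qquad(h\in\dot{\mathfrak h}),$$ where $i$ runs over $\{0,\dots,n-1\}$ if $n\ge 2$, and there is no relation of the first kind if $n=1$. (As a vector space it is $\mathbb C[\dot W]\otimes S(\dot{\mathfrak h})$.) **The induced modules.** Let $\mathcal I_p$ be the set of pairs $(\lambda,\mu)\in\mathbb Z^p\times\mathbb Z^p$ with $\lambda_i-\mu_i\ge 0$ for all $i$ and $\sum_{i=1}^p(\lambda_i-\mu_i)=n$. For $(\lambda,\mu)\in\mathcal I_p$ put $n_i=\sum_{j=1}^i(\lambda_j-\mu_j)$ ($0\le i\le p$), let $W_{\lambda-\mu}\subseteq\mathfrak S_n$ be the subgroup generated by the $s_i$ with $i\in\{1,\dots,n-1\}\setminus\{n_1,\dots,n_{p-1}\}$, and let $\zeta$ be the linear functional on $\dot{\mathfrak h}$ with $\zeta(c)=\kappa$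 and $$\zeta(\epsilon_j^\vee)=\mu_i-i+j-n_{i-1}\qquad\text{for } n_{i-1}+1\le j\le n_i .$$ Let $\mathbb C\mathbf 1_{\lambda,\mu}$ be the one-dimensional module, over the subalgebra $B\subseteq\ddot H_n$ generated by $W_{\lambda-\mu}$ and $\dot{\mathfrak h}$, on which $w\mathbf 1_{\lambda,\mu}=\mathbf 1_{\lambda,\mu}$ for $w\in W_{\lambda-\mu}$ and $h\mathbf 1_{\lambda,\mu}=\zeta(h)\mathbf 1_{\lambda,\mu}$ for $h\in\dot{\mathfrak h}$, and let $$\ddot M(\lambda,\mu)=\ddot H_n\otimes_B\mathbb C\mathbf 1_{\lambda,\mu}.$$ **Statement.** Let $(\lambda,\mu)\in\mathcal I_p$ and suppose that $\mu$ is affine dominant, that is, $\mu_i-\mu_{i+1}+1\ge0$ for all $1\le i\le p-1$ and $\kappa-p+1-\mu_1+\mu_p\ge0$. Then the $\ddot H_n$-module $\ddot M(\lambda,\mu)$ has a unique simple quotient module: there is exactly one submodule $N\subseteq\ddot M(\lambda,\mu)$ such that $\ddot M(\lambda,\mu)/N$ is simple. -/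

import Mathlib

/-! Indices are shifted by one against the usual convention: the basis `ε₁, …, εₙ` is indexed by
`0, …, n - 1 : Fin n`, and the parts `1, …, p` of a parameter are indexed by `Fin p`. -/

noncomputable section

namespace DegDAHA

/-! ### The extended affine Weyl group of `gl_n` -/

/-- The extended affine Weyl group `P ⋊ 𝔖ₙ` with `P = ℤⁿ` (written multiplicatively):
`w · t_η · w⁻¹ = t_{w(η)}`, where `(w η) i = η (w⁻¹ i)`, i.e. `w(ε_i) = ε_{w(i)}`. -/
abbrev ExtAffineWeyl (n : ℕ) : Type :=
  (Fin n → Multiplicative ℤ) ⋊[mulAutArrow (G := Equiv.Perm (Fin n))] Equiv.Perm (Fin n)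

/-- The translation `t_η`, `η ∈ P = ⨁ ℤ ε_i`. -/
def trans {n : ℕ} (η : Fin n → ℤ) : ExtAffineWeyl n :=
  SemidirectProduct.inl (fun i => Multiplicative.ofAdd (η i))

/-- The element of the finite Weyl group given by a permutation. -/
def perm {n : ℕ} (w : Equiv.Perm (Fin n)) : ExtAffineWeyl n :=
  SemidirectProduct.inr w

/-- The reflection `s_β = t_{-kα} · s_α` in the affine root `β = α + kδ`, `α = ε_i - ε_j`. -/
def refl {n : ℕ} (i j : Fin n) (k : ℤ) : ExtAffineWeyl n :=
  trans (-(k • (Pi.single i 1 - Pi.single j 1))) * perm (Equiv.swap i j)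

/-- `ε_i - ε_j + kδ` is one of the simple affine roots
`α_i = ε_i - ε_{i+1}` (`1 ≤ i ≤ n - 1`), `α_0 = -(ε_1 - ε_n) + δ`; there are none if `n = 1`. -/
def IsSimpleAffineRoot {n : ℕ} (i j : Fin n) (k : ℤ) : Prop :=
  ((j : ℕ) = i + 1 ∧ k = 0) ∨ ((i : ℕ) + 1 = n ∧ (j : ℕ) = 0 ∧ i ≠ j ∧ k = 1)

/-- `π = t_{ε_1} · s_1 ⋯ s_{n-1}`; the product `s_1 ⋯ s_{n-1}` is the cyclic permutation
`1 ↦ 2 ↦ ⋯ ↦ n ↦ 1`. -/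
def piElt (n : ℕ) : ExtAffineWeyl n :=
  trans (fun i => if (i : ℕ) = 0 then 1 else 0) * perm (finRotate n)

/-- The space `⨁ ℂ ε_i^∨ ⊕ ℂ c`, in coordinates: `(x, a)` stands for `∑ x_i ε_i^∨ + a c`. -/
abbrev HDot (n : ℕ) : Type := (Fin n → ℂ) × ℂ

/-- The pairing of the affine root `ε_i - ε_j + kδ` with `h`; `δ` vanishes on `HDot n`. -/
def rootPair {n : ℕ} (i j : Fin n) (h : HDot n) : ℂ := h.1 i - h.1 j

/-- The action of the extended affine Weyl group on `HDot n`: `c` is fixed,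
`w(ε_i^∨) = ε_{w(i)}^∨` for a permutation `w`, and `t_η(h) = h - ⟨η | h⟩ c`.
The element `g = t_η · w` has `η = g.left` and `w = g.right`. -/
def act {n : ℕ} (g : ExtAffineWeyl n) (h : HDot n) : HDot n :=
  (fun i => h.1 (g.right⁻¹ i),
    h.2 - ∑ i, ((Multiplicative.toAdd (g.left i) : ℤ) : ℂ) * h.1 (g.right⁻¹ i))

/-! ### The degenerate double affine Hecke algebra -/

/-- The generators: group elements and vectors of `HDot n`. -/
abbrev PreAlg (n : ℕ) : Type := FreeAlgebra ℂ (ExtAffineWeyl n ⊕ HDot n)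

/-- The generator of the free algebra attached to a group element. -/
def preW {n : ℕ} (w : ExtAffineWeyl n) : PreAlg n := FreeAlgebra.ι ℂ (Sum.inl w)

/-- The generator of the free algebra attached to a vector of `HDot n`. -/
def preH {n : ℕ} (h : HDot n) : PreAlg n := FreeAlgebra.ι ℂ (Sum.inr h)

/-- The defining relations: those of the group algebra of the extended affine Weyl group, those of
the symmetric algebra of `HDot n`, and the cross relations
`s_α h - s_α(h) s_α = -⟨α | h⟩` for the simple affine roots `α`, and `π h = π(h) π`. -/
inductive Rel (n : ℕ) : PreAlg n → PreAlg n → Prop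
  | w_one : Rel n (preW 1) 1
  | w_mul (v w : ExtAffineWeyl n) : Rel n (preW (v * w)) (preW v * preW w)
  | h_add (h h' : HDot n) : Rel n (preH (h + h')) (preH h + preH h')
  | h_smul (a : ℂ) (h : HDot n) : Rel n (preH (a • h)) (a • preH h)
  | h_comm (h h' : HDot n) : Rel n (preH h * preH h') (preH h' * preH h)
  | cross (i j : Fin n) (k : ℤ) (hs : IsSimpleAffineRoot i j k) (h : HDot n) :
      Rel n (preW (refl i j k) * preH h - preH (act (refl i j k) h) * preW (refl i j k))
        (algebraMap ℂ (PreAlg n) (-rootPair i j h))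
  | cross_pi (h : HDot n) :
      Rel n (preW (piElt n) * preH h) (preH (act (piElt n) h) * preW (piElt n))

/-- The degenerate double affine Hecke algebra of `gl_n`, by generators and relations: the algebra
generated by the group algebra of the extended affine Weyl group and the symmetric algebra of
`HDot n` subject to the cross relations. -/
def DDAHA (n : ℕ) : Type := RingQuot (Rel n)

instance (n : ℕ) : Ring (DDAHA n) := inferInstanceAs (Ring (RingQuot (Rel n)))

instance (n : ℕ) : Algebra ℂ (DDAHA n) := inferInstanceAs (Algebra ℂ (RingQuot (Rel n)))

/-- The image of a group element in the degenerate double affine Hecke algebra. -/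
def ofW {n : ℕ} (w : ExtAffineWeyl n) : DDAHA n := RingQuot.mkAlgHom ℂ (Rel n) (preW w)

/-- The image of a vector of `HDot n` in the degenerate double affine Hecke algebra. -/
def ofH {n : ℕ} (h : HDot n) : DDAHA n := RingQuot.mkAlgHom ℂ (Rel n) (preH h)

/-! ### Parameters -/

/-- The set `𝓘_p` of pairs `(l, m)` in `ℤ^p × ℤ^p` such that `l - m` is a `p`-tuple of nonnegative
integers with sum `n`. -/
def Params (n p : ℕ) : Set ((Fin p → ℤ) × (Fin p → ℤ)) :=
  {x | (∀ i, 0 ≤ x.1 i - x.2 i) ∧ ∑ i, (x.1 i - x.2 i) = n}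

/-- The numbers `[m]_0 = κ - p + 1 - m_1 + m_p` and `[m]_i = m_i - m_{i+1} + 1`, `1 ≤ i ≤ p - 1`;
here `i : Fin p` is not shifted, but the entries of `m` are. -/
def bracket (κ : ℤ) {p : ℕ} (m : Fin p → ℤ) (i : Fin p) : ℤ :=
  if (i : ℕ) = 0 then
    κ - p + 1 - m ⟨0, by have := i.2; omega⟩ + m ⟨p - 1, by have := i.2; omega⟩
  else
    m ⟨i - 1, by have := i.2; omega⟩ - m i + 1

/-- Affine dominance: `[m]_i ≥ 0` for all `i` in `[0, p - 1]`. -/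
def IsAffineDominant (κ : ℤ) {p : ℕ} (m : Fin p → ℤ) : Prop :=
  ∀ i : Fin p, 0 ≤ bracket κ m i

/-- The partial sums `n_k = ∑_{j ≤ k} (l_j - m_j)`, `n_0 = 0`. -/
def partialSum {p : ℕ} (l m : Fin p → ℤ) (k : ℕ) : ℤ :=
  ∑ j : Fin p, if (j : ℕ) < k then l j - m j else 0

/-- The parabolic subgroup `W_{l-m}` of `𝔖ₙ`, generated by the `s_i` (`i` in `[1, n - 1]`) with
`i` different from `n_1, …, n_{p-1}`; with shifted indices `s_i` exchanges `i - 1` and `i`. -/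
def parabolic (n : ℕ) {p : ℕ} (l m : Fin p → ℤ) : Subgroup (Equiv.Perm (Fin n)) :=
  Subgroup.closure {s | ∃ a b : Fin n, (b : ℕ) = a + 1 ∧
    (∀ k : ℕ, 1 ≤ k → k < p → ((b : ℕ) : ℤ) ≠ partialSum l m k) ∧ s = Equiv.swap a b}

/-- The value of `ζ_{l,m}` on `ε_j^∨`: it is `m_i - i + j - n_{i-1}` for `j` in the `i`-th block
`[n_{i-1} + 1, n_i]`. The two index shifts cancel in `j - i`. -/
def zetaCoord {n p : ℕ} (l m : Fin p → ℤ) (j : Fin n) : ℤ :=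
  ∑ i : Fin p,
    if partialSum l m i ≤ (j : ℕ) ∧ ((j : ℕ) : ℤ) < partialSum l m (i + 1) then
      m i - (i : ℕ) + (j : ℕ) - partialSum l m i
    else 0

/-- The weight `ζ_{l,m} + κ c^*` on `HDot n`. -/
def zeta (κ : ℤ) {n p : ℕ} (l m : Fin p → ℤ) (h : HDot n) : ℂ :=
  ∑ j, (zetaCoord l m j : ℂ) * h.1 j + (κ : ℂ) * h.2

/-! ### Induced modules -/

/-- The left ideal generated by `w - 1` for `w` in `W_{l-m}` and `h - ζ(h)` for `h` in `HDot n`. -/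
def indIdeal (n : ℕ) (κ : ℤ) {p : ℕ} (l m : Fin p → ℤ) : Submodule (DDAHA n) (DDAHA n) :=
  Submodule.span (DDAHA n)
    ({x | ∃ w ∈ parabolic n l m, x = ofW (perm w) - 1} ∪
      {x | ∃ h : HDot n, x = ofH h - algebraMap ℂ (DDAHA n) (zeta κ l m h)})

/-- The module induced from the one-dimensional module `ℂ𝟏` of the subalgebra `B` generated by
`W_{l-m}` and `HDot n` on which `w 𝟏 = 𝟏` and `h 𝟏 = ζ(h) 𝟏`. Over the algebra `H`, the induced
module `H ⊗_B ℂ𝟏` is the quotient of `H` by the left ideal generated by the elements `w - 1`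
and `h - ζ(h)`; its universal property is `indModule_existsUnique_hom`. -/
abbrev IndModule (n : ℕ) (κ : ℤ) {p : ℕ} (l m : Fin p → ℤ) : Type :=
  DDAHA n ⧸ indIdeal n κ l m

/-- Homomorphisms from the induced module to `N` are the vectors `v` of `N` on which `B` acts
through its one-dimensional module (Frobenius reciprocity). -/
theorem indModule_existsUnique_hom (n : ℕ) (κ : ℤ) {p : ℕ} (l m : Fin p → ℤ)
    {N : Type*} [AddCommGroup N] [Module (DDAHA n) N] (v : N)
    (hw : ∀ w ∈ parabolic n l m, ofW (perm w) • v = v)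
    (hh : ∀ h : HDot n, ofH h • v = algebraMap ℂ (DDAHA n) (zeta κ l m h) • v) :
    ∃! f : IndModule n κ l m →ₗ[DDAHA n] N, f (Submodule.Quotient.mk 1) = v := by
  have hle : indIdeal n κ l m ≤ LinearMap.ker (LinearMap.toSpanSingleton (DDAHA n) N v) := by
    refine Submodule.span_le.2 ?_
    rintro x (⟨w, hmem, rfl⟩ | ⟨h, rfl⟩)
    · simp [sub_smul, hw w hmem]
    · simp [sub_smul, hh h]
  refine ⟨Submodule.liftQ _ _ hle, ?_, ?_⟩
  · change Submodule.liftQ _ _ hle (Submodule.Quotient.mk 1) = v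
    rw [Submodule.liftQ_apply]
    simp
  · intro g hg
    refine Submodule.linearMap_qext _ (LinearMap.ext_ring ?_)
    simpa using hg

end DegDAHA

end

/-! The module is cyclic and nonzero (`one_notMem_indIdeal`), so it has maximal submodules. There is
only one as soon as two proper submodules never span the module (`sup_ne_top`), and this follows
from a multiplicity count. There are a weight `a` and a number `d` such that the generalized weight
space of weight `a` has dimension at least `d` in every nonzero quotient of the induced module, and
at most `d` in every module generated by a vector of the same kind. If `N + N'` were everything, the
product of the quotients by `N` and `N'` would again be a cyclic quotient, and its weight space
would have dimension both at least `2d` and at most `d`.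

The weight of the generator is a concatenation of segments. Affine dominance says that their
starting values `b` weakly decrease and vary by at most `κ`. Applying an element of length zero
makes them vary by less than `κ` (`exists_isSegmented`). Positions with the same value of `b` form a
group. The weight `a` rearranges the values increasingly inside each group, and `d` is the product
of the factorials of the sizes of the level sets of `(b, a)`.

Upper bound (`IsGenBy.rank_le`): the vectors `w v`, with `w` increasing along the segments, span the
module, and the polynomial part acts on them triangularly with diagonal weights `wζ`. So the
dimension is at most the number of such `w` with `wζ = a`. The inequalities on `b` force these `w`
to be finite permutations preserving the groups, and they lie in one coset of the stabilizer of `(b,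
a)`.

Lower bound (`IsGenBy.le_finrank`): on a run of `k` positions where `a` is constant, a degenerate
affine Hecke algebra acts with a single generalized weight. As in Kato's theorem, the nilpotent
parts of its commuting operators then force a factor `k!`.

Nonvanishing (`IsSegmented.exists_sorted`): dimensions of weight spaces, as a function of the word
of values in one group, satisfy the Serre relations of type A, and vanish unless the first value of
the group is the minimal one. Such functions are functionals on `U(𝔫)/∑_{i≠0} U(𝔫) f_i`, a
polynomial ring with weight spaces of dimension at most one. Hence they are proportional to an
explicit function (`serreRigid`) that is nonzero on the sorted word of any content that occurs. As
`ζ` is a weight, so is `a`. -/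

noncomputable section

namespace DegDAHA

/-! ### The extended affine Weyl group: roots, inversions, generators. -/

section

variable {n : ℕ}

/-! ### Coordinates on the extended affine Weyl group -/

/-- The translation part `η` of `g = t_η · w`, written additively. -/
def shift (g : ExtAffineWeyl n) (i : Fin n) : ℤ := Multiplicative.toAdd (g.left i)

@[simp] theorem perm_inv_apply_self (w : Equiv.Perm (Fin n)) (i : Fin n) : w⁻¹ (w i) = i :=
  w.symm_apply_apply i

theorem weyl_ext {g h : ExtAffineWeyl n} (hs : ∀ i, shift g i = shift h i)
    (hr : ∀ i, g.right i = h.right i) : g = h := by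
  refine SemidirectProduct.ext ?_ (Equiv.ext hr)
  funext i
  exact Multiplicative.toAdd.injective (hs i)

@[simp] theorem shift_one (i : Fin n) : shift (1 : ExtAffineWeyl n) i = 0 := rfl

@[simp] theorem shift_mul (g h : ExtAffineWeyl n) (i : Fin n) :
    shift (g * h) i = shift g i + shift h (g.right⁻¹ i) := rfl

@[simp] theorem shift_inv (g : ExtAffineWeyl n) (i : Fin n) :
    shift g⁻¹ i = -shift g (g.right i) := by
  have h := shift_mul g⁻¹ g i
  simp at h
  linarith

@[simp] theorem shift_perm (w : Equiv.Perm (Fin n)) (i : Fin n) : shift (perm w) i = 0 := rfl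

@[simp] theorem shift_trans (η : Fin n → ℤ) (i : Fin n) : shift (trans η) i = η i := rfl

@[simp] theorem right_perm (w : Equiv.Perm (Fin n)) : (perm w).right = w := rfl

@[simp] theorem right_trans (η : Fin n → ℤ) : (trans η).right = 1 := rfl

theorem act_def (g : ExtAffineWeyl n) (h : HDot n) :
    act g h = (fun i => h.1 (g.right⁻¹ i), h.2 - ∑ i, (shift g i : ℂ) * h.1 (g.right⁻¹ i)) := rfl

theorem act_one (h : HDot n) : act 1 h = h := by
  simp [act_def]

theorem act_mul (g g' : ExtAffineWeyl n) (h : HDot n) : act (g * g') h = act g (act g' h) := by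
  simp only [act_def, shift_mul, SemidirectProduct.mul_right, mul_inv_rev, Equiv.Perm.mul_apply,
    Prod.mk.injEq, true_and]
  push_cast
  simp only [add_mul, Finset.sum_add_distrib]
  have : ∑ i, (shift g' (g.right⁻¹ i) : ℂ) * h.1 (g'.right⁻¹ (g.right⁻¹ i))
      = ∑ i, (shift g' i : ℂ) * h.1 (g'.right⁻¹ i) :=
    Equiv.sum_comp (g.right⁻¹) fun i => (shift g' i : ℂ) * h.1 (g'.right⁻¹ i)
  rw [this]
  ring

theorem act_add (g : ExtAffineWeyl n) (h h' : HDot n) : act g (h + h') = act g h + act g h' := by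
  ext i
  · simp [act_def]
  · simp [act_def, mul_add, Finset.sum_add_distrib]; ring

theorem act_smul (g : ExtAffineWeyl n) (a : ℂ) (h : HDot n) : act g (a • h) = a • act g h := by
  ext i
  · simp [act_def]
  · simp [act_def, mul_sub, Finset.mul_sum]
    exact Finset.sum_congr rfl fun _ _ => by ring

/-! ### Affine roots -/

/-- The affine root `ε_i - ε_j + kδ`, encoded as `(i, j, k)`. -/
abbrev Root (n : ℕ) : Type := Fin n × Fin n × ℤ

/-- The reflection in an affine root. -/
def reflR (β : Root n) : ExtAffineWeyl n := refl β.1 β.2.1 β.2.2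

@[simp] theorem right_reflR (β : Root n) : (reflR β).right = Equiv.swap β.1 β.2.1 := by
  simp [reflR, refl]

theorem shift_reflR (β : Root n) (i : Fin n) :
    shift (reflR β) i =
      -(β.2.2 * ((if i = β.1 then 1 else 0) - (if i = β.2.1 then 1 else 0))) := by
  simp [reflR, refl, Pi.single_apply]

/-- The action of the extended affine Weyl group on affine roots. -/
def rootAct (g : ExtAffineWeyl n) (β : Root n) : Root n :=
  (g.right β.1, g.right β.2.1, β.2.2 - shift g (g.right β.1) + shift g (g.right β.2.1))

theorem rootAct_one (β : Root n) : rootAct 1 β = β := by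
  simp [rootAct]

theorem rootAct_mul (g h : ExtAffineWeyl n) (β : Root n) :
    rootAct (g * h) β = rootAct g (rootAct h β) := by
  simp [rootAct]; ring

/-- The action of affine roots as affine functions on `ℤⁿ` in which `δ` takes the value `n`. -/
def rootVal (β : Root n) (x : Fin n → ℤ) : ℤ := x β.1 - x β.2.1 + n * β.2.2

/-- The action of the extended affine Weyl group on `ℤⁿ`; `t_η` is the translation by `nη`. -/
def ptAct (g : ExtAffineWeyl n) (x : Fin n → ℤ) (i : Fin n) : ℤ := x (g.right⁻¹ i) + n * shift g i

theorem ptAct_one (x : Fin n → ℤ) : ptAct 1 x = x := by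
  funext i; simp [ptAct]

theorem ptAct_mul (g h : ExtAffineWeyl n) (x : Fin n → ℤ) :
    ptAct (g * h) x = ptAct g (ptAct h x) := by
  funext i; simp [ptAct]; ring

theorem rootVal_rootAct (g : ExtAffineWeyl n) (β : Root n) (x : Fin n → ℤ) :
    rootVal (rootAct g β) (ptAct g x) = rootVal β x := by
  simp [rootVal, rootAct, ptAct]; ring

theorem rootPair_act (g : ExtAffineWeyl n) (β : Root n) (h : HDot n) :
    rootPair (rootAct g β).1 (rootAct g β).2.1 (act g h) = rootPair β.1 β.2.1 h := by
  simp [rootPair, rootAct, act_def]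

theorem reflR_rootAct (g : ExtAffineWeyl n) (β : Root n) :
    reflR (rootAct g β) = g * reflR β * g⁻¹ := by
  obtain ⟨i, j, k⟩ := β
  have hr : (reflR (rootAct g (i, j, k))).right = g.right * Equiv.swap i j * g.right⁻¹ := by
    simp [rootAct, Equiv.mul_swap_eq_swap_mul]
  refine weyl_ext (fun a => ?_) (fun a => ?_)
  · obtain ⟨a, rfl⟩ := g.right.surjective a
    simp only [shift_reflR, rootAct, shift_mul, shift_inv, SemidirectProduct.mul_right, right_reflR,
      mul_inv_rev, Equiv.Perm.mul_apply, perm_inv_apply_self, Equiv.swap_inv,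
      EmbeddingLike.apply_eq_iff_eq]
    by_cases h1 : a = i
    · subst h1
      by_cases h2 : a = j
      · subst h2; simp
      · simp [h2]; ring
    · by_cases h2 : a = j
      · subst h2; simp [h1]; ring
      · simp [h1, h2, Equiv.swap_apply_of_ne_of_ne]
  · rw [hr]; simp

theorem reflR_mul_self (β : Root n) : reflR β * reflR β = 1 := by
  obtain ⟨i, j, k⟩ := β
  refine weyl_ext (fun a => ?_) (fun a => ?_)
  · simp only [shift_mul, shift_reflR, right_reflR, Equiv.swap_inv, shift_one]
    by_cases h1 : a = i
    · subst h1
      by_cases h2 : a = j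
      · subst h2; simp
      · simp [h2, Ne.symm h2]
    · by_cases h2 : a = j
      · subst h2; simp [h1, Ne.symm h1]
      · simp [h1, h2, Equiv.swap_apply_of_ne_of_ne]
  · simp

theorem ptAct_reflR (β : Root n) (x : Fin n → ℤ) (a : Fin n) :
    ptAct (reflR β) x a =
      x a - rootVal β x * ((if a = β.1 then 1 else 0) - (if a = β.2.1 then 1 else 0)) := by
  obtain ⟨i, j, k⟩ := β
  simp only [ptAct, shift_reflR, right_reflR, Equiv.swap_inv, rootVal]
  by_cases h1 : a = i
  · subst h1
    by_cases h2 : a = j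
    · subst h2; simp
    · simp [h2]
      ring
  · by_cases h2 : a = j
    · subst h2; simp [h1]; ring
    · simp [h1, h2, Equiv.swap_apply_of_ne_of_ne]

/-- The base point `ρ`; an affine root is positive if its value at `ρ` is. -/
def rho (n : ℕ) (i : Fin n) : ℤ := -(i : ℤ)

/-- The squared distance of `wρ` from `ρ`. -/
def dist2 (w : ExtAffineWeyl n) : ℤ := ∑ i, (ptAct w (rho n) i - rho n i) ^ 2

theorem dist2_nonneg (w : ExtAffineWeyl n) : 0 ≤ dist2 w :=
  Finset.sum_nonneg fun _ _ => sq_nonneg _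

theorem rootVal_eq_add (β : Root n) (x y : Fin n → ℤ) :
    rootVal β x = rootVal β y + ((x β.1 - y β.1) - (x β.2.1 - y β.2.1)) := by
  simp [rootVal]; ring

/-- Expand the square of `x - β(x)β^∨ - ρ`, using that `β^∨` has square length 2. This distance
plays the role of the length function in all later triangularity arguments. -/
theorem dist2_reflR_mul {β : Root n} (hβ : β.1 ≠ β.2.1) (w : ExtAffineWeyl n) :
    dist2 (reflR β * w) =
      dist2 w + 2 * rootVal β (ptAct w (rho n)) * rootVal β (rho n) := by
  simp only [dist2, ptAct_mul, ptAct_reflR]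
  set x := ptAct w (rho n)
  have hb := rootVal_eq_add β x (rho n)
  set c := rootVal β x
  set d := rootVal β (rho n)
  have key : ∀ a, (x a - c * ((if a = β.1 then 1 else 0) - (if a = β.2.1 then 1 else 0)) -
      rho n a) ^ 2 = (x a - rho n a) ^ 2 + ((if a = β.1 then c ^ 2 - 2 * c * (x a - rho n a) else 0)
      + (if a = β.2.1 then c ^ 2 + 2 * c * (x a - rho n a) else 0)) := by
    intro a
    by_cases h1 : a = β.1
    · subst h1; simp [hβ]; ring
    · by_cases h2 : a = β.2.1
      · subst h2; simp [h1]; ring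
      · simp [h1, h2]
  simp only [key, Finset.sum_add_distrib, Finset.sum_ite_eq', Finset.mem_univ, if_true]
  have : x β.1 - rho n β.1 = c - d + (x β.2.1 - rho n β.2.1) := by rw [hb]; ring
  rw [this]; ring

/-- Regularity of `ρ`: its coordinates are distinct modulo `n`, so no root vanishes at `ρ`; apply
`w` to get the same at `wρ`. -/
theorem rootVal_rho_ne_zero {β : Root n} (hβ : β.1 ≠ β.2.1) (w : ExtAffineWeyl n) :
    rootVal β (ptAct w (rho n)) ≠ 0 := by
  obtain ⟨β', rfl⟩ : ∃ β', β = rootAct w β' := ⟨rootAct w⁻¹ β, by simp [← rootAct_mul, rootAct_one]⟩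
  rw [rootVal_rootAct]
  have h : β'.1 ≠ β'.2.1 := fun h => hβ (by simp [rootAct, h])
  obtain ⟨i, j, k⟩ := β'
  intro h0
  simp only [rootVal, rho] at h0
  apply h
  have hi := i.2
  have hj := j.2
  have hk : k = 0 := by
    have h1 : (n : ℤ) * k < n * 1 := by omega
    have h2 : (n : ℤ) * (-1) < n * k := by omega
    have hn : (0 : ℤ) < n := by omega
    have := lt_of_mul_lt_mul_left h1 hn.le
    have := lt_of_mul_lt_mul_left h2 hn.le
    omega
  subst hk
  ext
  simp only
  omega

/-- The positive roots that `w⁻¹` makes negative. -/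
def invSet (w : ExtAffineWeyl n) : Set (Root n) :=
  {β | 0 < rootVal β (rho n) ∧ rootVal β (ptAct w (rho n)) < 0}

theorem invSet_ne {w : ExtAffineWeyl n} {β : Root n} (h : β ∈ invSet w) : β.1 ≠ β.2.1 := by
  rintro h0
  obtain ⟨h1, h2⟩ := h
  simp [rootVal, h0] at h1 h2
  omega

theorem invSet_finite (w : ExtAffineWeyl n) : (invSet w).Finite := by
  set x := ptAct w (rho n)
  -- A generous bound for the coefficient of `δ`: positivity at `ρ` bounds it below, negativity at
  -- `wρ` bounds it above.
  set K : ℤ := (n : ℤ) + ∑ i, |x i| + ∑ i, |x i| with hK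
  have hx : ∀ i, |x i| ≤ ∑ i, |x i| := fun i =>
    Finset.single_le_sum (f := fun i => |x i|) (fun i _ => abs_nonneg (x i)) (Finset.mem_univ i)
  refine ((Set.finite_univ (α := Fin n)).prod ((Set.finite_univ (α := Fin n)).prod
    (Set.finite_Icc (-K) K))).subset ?_
  rintro ⟨i, j, k⟩ ⟨h1, h2⟩
  simp only [rootVal, rho] at h1 h2
  simp only [Set.mem_prod, Set.mem_univ, true_and, Set.mem_Icc]
  have hi := i.2
  have hj := j.2
  have e1 := hx i
  have e2 := hx j
  have e3 := abs_le.1 (le_refl |x i|)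
  have e4 := abs_le.1 (le_refl |x j|)
  have hn : (1 : ℤ) ≤ n := by omega
  constructor
  · by_contra hc
    have : (n : ℤ) * k ≤ 1 * k := by
      apply mul_le_mul_of_nonpos_right hn
      have := abs_nonneg (x i)
      omega
    have := abs_nonneg (x i)
    omega
  · by_contra hc
    have : 1 * k ≤ (n : ℤ) * k := by
      apply mul_le_mul_of_nonneg_right hn
      have := abs_nonneg (x i)
      omega
    change x i - x j + n * k < 0 at h2
    omega

/-- The positive roots that `w⁻¹` makes negative, as a finset. -/
def invFin (w : ExtAffineWeyl n) : Finset (Root n) := (invSet_finite w).toFinset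

theorem mem_invFin {w : ExtAffineWeyl n} {β : Root n} :
    β ∈ invFin w ↔ 0 < rootVal β (rho n) ∧ rootVal β (ptAct w (rho n)) < 0 := by
  simp [invFin, invSet]

/-- The two root values in `dist2_reflR_mul` have opposite signs. This makes the action of `HDot n`
on the basis `w` triangular. -/
theorem dist2_reflR_mul_lt {w : ExtAffineWeyl n} {β : Root n} (h : β ∈ invFin w) :
    dist2 (reflR β * w) < dist2 w := by
  have hne : β.1 ≠ β.2.1 := invSet_ne (w := w) (by simpa [invFin] using h)
  rw [mem_invFin] at h
  rw [dist2_reflR_mul hne]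
  nlinarith [mul_pos h.1 (neg_pos.2 h.2)]

theorem invFin_one : invFin (1 : ExtAffineWeyl n) = ∅ := by
  ext β
  simp only [mem_invFin, ptAct_one, Finset.notMem_empty, iff_false]
  omega

/-- An element fixing the values of all roots at `ρ` permutes the positive roots. -/
theorem invFin_mul_of_rootVal {g : ExtAffineWeyl n}
    (hg : ∀ β, rootVal β (ptAct g (rho n)) = rootVal β (rho n)) (w : ExtAffineWeyl n) (β : Root n) :
    rootAct g β ∈ invFin (g * w) ↔ β ∈ invFin w := by
  rw [mem_invFin, mem_invFin, ptAct_mul, rootVal_rootAct, ← hg (rootAct g β), rootVal_rootAct]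

/-- `π` moves `ρ` to `ρ + (1, …, 1)`, and roots only see differences of coordinates: `π` has length
zero. -/
theorem piElt_rootVal (β : Root n) :
    rootVal β (ptAct (piElt n) (rho n)) = rootVal β (rho n) := by
  have h : ∀ i, ptAct (piElt n) (rho n) i = rho n i + 1 := by
    intro i
    obtain _ | n := n
    · exact i.elim0
    obtain ⟨i, rfl⟩ := (finRotate (n + 1)).surjective i
    simp only [ptAct, piElt, SemidirectProduct.mul_right, right_trans, right_perm, one_mul,
      perm_inv_apply_self, shift_mul, shift_trans, shift_perm, rho]
    rcases Fin.eq_castSucc_or_eq_last i with ⟨i, rfl⟩ | rfl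
    · rw [finRotate_apply, Fin.coeSucc_eq_succ]
      simp
    · rw [finRotate_last]; simp
  simp [rootVal, h]

/-- A root is simple if its value at `ρ` is `1`. -/
theorem IsSimpleAffineRoot.rootVal_eq {i j : Fin n} {k : ℤ} (h : IsSimpleAffineRoot i j k) :
    rootVal (i, j, k) (rho n) = 1 ∧ i ≠ j := by
  rcases h with ⟨h1, h2⟩ | ⟨h1, h2, h3, h4⟩
  · subst h2
    refine ⟨by simp [rootVal, rho, h1], fun h => by subst h; omega⟩
  · subst h4
    refine ⟨?_, h3⟩
    simp only [rootVal, rho]; omega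

/-- A simple reflection permutes the positive roots other than its own. The value at `ρ` drops by
`⟨β, α^∨⟩`, which is at most 1 unless `α` and `β` have the same finite part; since the new value is
not 0, it stays positive. -/
theorem rootVal_rootAct_pos {α β : Root n} (hα : rootVal α (rho n) = 1) (hαne : α.1 ≠ α.2.1)
    (hne : β ≠ α) (hβne : β.1 ≠ β.2.1)
    (hβ : 0 < rootVal β (rho n)) : 0 < rootVal (rootAct (reflR α) β) (rho n) := by
  have h1 : rootVal (rootAct (reflR α) β) (rho n) = rootVal β (ptAct (reflR α) (rho n)) := by
    rw [← rootVal_rootAct (reflR α) β, ← ptAct_mul, reflR_mul_self, ptAct_one]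
  have h0 := rootVal_rho_ne_zero hβne (reflR α)
  rw [h1]
  obtain ⟨i, j, k⟩ := α
  obtain ⟨a, b, c⟩ := β
  have e : rootVal (a, b, c) (ptAct (reflR (i, j, k)) (rho n)) = rootVal (a, b, c) (rho n) -
      (((if a = i then 1 else 0) - (if a = j then 1 else 0)) -
       ((if b = i then 1 else 0) - (if b = j then 1 else 0))) := by
    simp only [rootVal, ptAct_reflR] at hα ⊢
    rw [hα]; ring
  simp only [] at hαne hβne
  -- Here `β` is `α` plus a nonzero multiple of `δ`; being positive, it has value at least `1 + n`
  -- at `ρ`, and the drop is 2.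
  by_cases h2 : a = i ∧ b = j
  · obtain ⟨rfl, rfl⟩ := h2
    have hk : c ≠ k := fun h => hne (by rw [h])
    have h3 : rootVal (a, b, c) (rho n) = 1 + n * (c - k) := by
      simp only [rootVal] at hα ⊢; linear_combination hα
    simp [hαne, hαne.symm] at e
    have hn : (2 : ℤ) ≤ n := by
      have := a.2
      have := b.2
      have : (a : ℕ) ≠ b := fun h => hαne (Fin.ext h)
      omega
    rcases lt_or_gt_of_ne hk with hlt | hgt
    · nlinarith
    · have : (n : ℤ) * 1 ≤ n * (c - k) := by
        apply mul_le_mul_of_nonneg_left <;> omega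
      omega
  · have : (((if a = i then 1 else 0) - (if a = j then 1 else 0)) -
       ((if b = i then 1 else 0) - (if b = j then 1 else 0)) : ℤ) ≤ 1 := by
      by_cases ha : a = i
      · have hb : b ≠ j := fun hb => h2 ⟨ha, hb⟩
        subst ha
        simp only [hαne, hβne.symm, hb, if_true, if_false]
        norm_num
      · simp only [ha, if_false]
        split_ifs <;> norm_num
    omega

/-- Together with `simple_mem_invFin_iff` this computes the inversion set of `s_α w`: apply `s_α` to
the inversions of `w` other than `α`, and add or remove `α`. -/
theorem rootAct_mem_invFin {α β : Root n} (hα : rootVal α (rho n) = 1) (hαne : α.1 ≠ α.2.1)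
    (hne : β ≠ α) {w : ExtAffineWeyl n} (hβ : β ∈ invFin w) :
    rootAct (reflR α) β ∈ invFin (reflR α * w) ∧ rootAct (reflR α) β ≠ α := by
  have hβne : β.1 ≠ β.2.1 := invSet_ne (w := w) (by simpa [invFin] using hβ)
  rw [mem_invFin] at hβ
  have hpos := rootVal_rootAct_pos hα hαne hne hβne hβ.1
  refine ⟨mem_invFin.2 ⟨hpos, by rw [ptAct_mul, rootVal_rootAct]; exact hβ.2⟩, fun h => ?_⟩
  have hval : rootVal β (rho n) = rootVal α (ptAct (reflR α) (rho n)) := by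
    rw [← rootVal_rootAct (reflR α) β, h]
  have : rootVal α (ptAct (reflR α) (rho n)) = -1 := by
    have h := ptAct_reflR α (rho n)
    rw [rootVal_eq_add α _ (rho n), h, h, hα]
    simp [hαne, hαne.symm]
  have := hβ.1
  omega

theorem simple_mem_invFin_iff {α : Root n} (hα : rootVal α (rho n) = 1) (hαne : α.1 ≠ α.2.1)
    (w : ExtAffineWeyl n) : α ∈ invFin (reflR α * w) ↔ α ∉ invFin w := by
  have h1 : rootVal α (ptAct (reflR α * w) (rho n)) = -rootVal α (ptAct w (rho n)) := by
    have h := ptAct_reflR α (ptAct w (rho n))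
    rw [ptAct_mul, rootVal_eq_add α _ (ptAct w (rho n)), h, h]
    simp [hαne, hαne.symm]
  have h0 := rootVal_rho_ne_zero hαne w
  simp only [mem_invFin, hα, h1]
  omega

/-! ### Generators -/

theorem perm_mul (v w : Equiv.Perm (Fin n)) : perm (v * w) = perm v * perm w :=
  map_mul SemidirectProduct.inr v w

theorem trans_add (η θ : Fin n → ℤ) : trans (η + θ) = trans η * trans θ :=
  weyl_ext (fun i => by simp) (fun i => by simp)

theorem eq_trans_mul_perm (g : ExtAffineWeyl n) : g = trans (shift g) * perm g.right :=
  weyl_ext (fun i => by simp) (fun i => by simp)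

theorem perm_mul_trans (w : Equiv.Perm (Fin n)) (η : Fin n → ℤ) :
    perm w * trans η * perm w⁻¹ = trans (fun i => η (w⁻¹ i)) :=
  weyl_ext (fun i => by simp) (fun i => by simp)

/-- The extended affine Weyl group is generated by the finite simple reflections and `π`. -/
theorem weyl_closure (S : Subgroup (ExtAffineWeyl n))
    (hs : ∀ i j : Fin n, (j : ℕ) = i + 1 → perm (Equiv.swap i j) ∈ S) (hpi : piElt n ∈ S) :
    S = ⊤ := by
  obtain _ | n := n
  · refine (Subgroup.eq_top_iff' S).2 fun x => ?_
    have : x = 1 := weyl_ext (fun i => i.elim0) (fun i => i.elim0)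
    rw [this]; exact S.one_mem
  have hperm : ∀ w, perm w ∈ S := by
    intro w
    have hw : w ∈ Submonoid.closure
        (Set.range fun i : Fin n => Equiv.swap i.castSucc i.succ) := by
      rw [Equiv.Perm.mclosure_swap_castSucc_succ]; trivial
    induction hw using Submonoid.closure_induction with
    | mem x hx =>
      obtain ⟨i, rfl⟩ := hx
      exact hs _ _ (by simp)
    | one => exact S.one_mem
    | mul x y _ _ hx hy => rw [perm_mul]; exact S.mul_mem hx hy
  have h0 : trans (Pi.single (0 : Fin (n + 1)) (1 : ℤ)) ∈ S := by
    have h : trans (Pi.single (0 : Fin (n + 1)) (1 : ℤ)) =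
        piElt (n + 1) * (perm (finRotate (n + 1)))⁻¹ := by
      rw [eq_mul_inv_iff_mul_eq, piElt]
      congr 2
      funext i
      simp only [Pi.single_apply, Fin.ext_iff, Fin.val_zero]
    rw [h]
    exact S.mul_mem hpi (S.inv_mem (hperm _))
  have h1 : ∀ i, trans (Pi.single (i : Fin (n + 1)) (1 : ℤ)) ∈ S := by
    intro i
    have := perm_mul_trans (Equiv.swap 0 i) (Pi.single (0 : Fin (n + 1)) (1 : ℤ))
    have e : (fun j => (Pi.single (0 : Fin (n + 1)) (1 : ℤ) : Fin (n + 1) → ℤ)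
        ((Equiv.swap 0 i)⁻¹ j)) = Pi.single i 1 := by
      funext j
      simp only [Equiv.swap_inv, Pi.single_apply]
      congr 1
      rw [Equiv.swap_apply_eq_iff, Equiv.swap_apply_left]
    rw [e] at this
    rw [← this]
    exact S.mul_mem (S.mul_mem (hperm _) h0) (hperm _)
  have htr : ∀ η, trans η ∈ S := by
    let T : AddSubgroup (Fin (n + 1) → ℤ) :=
      { carrier := {η | trans η ∈ S}
        add_mem' := fun {η θ} hη hθ => by
          change trans (η + θ) ∈ S
          rw [trans_add]; exact S.mul_mem hη hθ
        zero_mem' := S.one_mem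
        neg_mem' := fun {η} hη => by
          have : trans (-η) = (trans η)⁻¹ := eq_inv_of_mul_eq_one_left (by
            rw [← trans_add, neg_add_cancel]; rfl)
          change trans (-η) ∈ S
          rw [this]; exact S.inv_mem hη }
    intro η
    have hη : ∑ i, η i • (Pi.single i (1 : ℤ) : Fin (n + 1) → ℤ) = η := by
      funext j
      simp [Finset.sum_apply, Pi.single_apply]
    change η ∈ T
    rw [← hη]
    exact T.sum_mem fun i _ => T.zsmul_mem (h1 i) _
  refine (Subgroup.eq_top_iff' S).2 fun g => ?_
  rw [eq_trans_mul_perm g]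
  exact S.mul_mem (htr _) (hperm _)

end

/-! ### An explicit representation on the group algebra, and its maps to modules with a weight
vector. -/

section

variable {n : ℕ}

/-! ### The module induced from a character of `HDot n` -/

/-- The functional on `HDot n` with values `ζ_i` at `ε_i^∨` and `κ` at `c`. -/
def weightFun (ζ : Fin n → ℂ) (κ : ℂ) (h : HDot n) : ℂ := ∑ j, ζ j * h.1 j + κ * h.2

theorem weightFun_add (ζ : Fin n → ℂ) (κ : ℂ) (h h' : HDot n) :
    weightFun ζ κ (h + h') = weightFun ζ κ h + weightFun ζ κ h' := by
  simp [weightFun, mul_add, Finset.sum_add_distrib]; ring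

theorem weightFun_smul (ζ : Fin n → ℂ) (κ : ℂ) (a : ℂ) (h : HDot n) :
    weightFun ζ κ (a • h) = a * weightFun ζ κ h := by
  simp only [weightFun, Prod.smul_fst, Prod.smul_snd, Pi.smul_apply, smul_eq_mul, mul_add,
    Finset.mul_sum]
  congr 1
  · exact Finset.sum_congr rfl fun _ _ => by ring
  · ring

/-- The pairing of a root with `h`. -/
def pair (β : Root n) (h : HDot n) : ℂ := rootPair β.1 β.2.1 h

theorem pair_add (β : Root n) (h h' : HDot n) : pair β (h + h') = pair β h + pair β h' := by
  simp [pair, rootPair]; ring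

theorem pair_smul (β : Root n) (a : ℂ) (h : HDot n) : pair β (a • h) = a * pair β h := by
  simp [pair, rootPair]; ring

theorem pair_rootAct (g : ExtAffineWeyl n) (β : Root n) (h : HDot n) :
    pair (rootAct g β) (act g h) = pair β h := rootPair_act g β h

/-- The space with basis the extended affine Weyl group. -/
abbrev WSpace (n : ℕ) : Type := ExtAffineWeyl n →₀ ℂ

/-- Left multiplication by a group element. -/
def leftOp (g : ExtAffineWeyl n) : WSpace n →ₗ[ℂ] WSpace n := Finsupp.lmapDomain ℂ ℂ (g * ·)

@[simp] theorem leftOp_single (g w : ExtAffineWeyl n) (a : ℂ) :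
    leftOp g (Finsupp.single w a) = Finsupp.single (g * w) a := by
  simp [leftOp]

/-- The action of `h` on the module induced from the character `(ζ, κ)`, on a basis element. -/
def dVec (ζ : Fin n → ℂ) (κ : ℂ) (h : HDot n) (w : ExtAffineWeyl n) : WSpace n :=
  weightFun ζ κ (act w⁻¹ h) • Finsupp.single w 1 -
    ∑ β ∈ invFin w, pair β h • Finsupp.single (reflR β * w) 1

/-- The action of `h` on the module induced from the character `(ζ, κ)`. -/
def dOp (ζ : Fin n → ℂ) (κ : ℂ) (h : HDot n) : WSpace n →ₗ[ℂ] WSpace n :=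
  Finsupp.linearCombination ℂ (dVec ζ κ h)

@[simp] theorem dOp_single (ζ : Fin n → ℂ) (κ : ℂ) (h : HDot n) (w : ExtAffineWeyl n) :
    dOp ζ κ h (Finsupp.single w 1) = dVec ζ κ h w := by
  simp [dOp]

theorem wSpace_ext {M : Type*} [AddCommGroup M] [Module ℂ M] {f g : WSpace n →ₗ[ℂ] M}
    (h : ∀ w, f (Finsupp.single w 1) = g (Finsupp.single w 1)) : f = g :=
  Finsupp.lhom_ext' fun w => LinearMap.ext_ring (h w)

theorem dOp_add (ζ : Fin n → ℂ) (κ : ℂ) (h h' : HDot n) :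
    dOp ζ κ (h + h') = dOp ζ κ h + dOp ζ κ h' := by
  refine wSpace_ext fun w => ?_
  simp only [LinearMap.add_apply, dOp_single, dVec, act_add, weightFun_add, pair_add, add_smul,
    Finset.sum_add_distrib]
  abel

theorem dOp_smul (ζ : Fin n → ℂ) (κ : ℂ) (a : ℂ) (h : HDot n) :
    dOp ζ κ (a • h) = a • dOp ζ κ h := by
  refine wSpace_ext fun w => ?_
  simp only [LinearMap.smul_apply, dOp_single, dVec, act_smul, weightFun_smul, pair_smul, smul_sub,
    Finset.smul_sum, mul_smul]

theorem act_inv_act (g w : ExtAffineWeyl n) (h : HDot n) :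
    act (g * w)⁻¹ (act g h) = act w⁻¹ h := by
  rw [← act_mul]; congr 1; group

theorem leftOp_dOp_of_rootVal (ζ : Fin n → ℂ) (κ : ℂ) {g : ExtAffineWeyl n}
    (hg : ∀ β, rootVal β (ptAct g (rho n)) = rootVal β (rho n)) (h : HDot n) :
    leftOp g ∘ₗ dOp ζ κ h = dOp ζ κ (act g h) ∘ₗ leftOp g := by
  refine wSpace_ext fun w => ?_
  simp only [LinearMap.comp_apply, dOp_single, leftOp_single, dVec, map_sub, map_smul, map_sum,
    act_inv_act]
  congr 1
  refine Finset.sum_bij (fun β _ => rootAct g β)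
    (fun β hβ => (invFin_mul_of_rootVal hg w β).2 hβ) (fun β _ β' _ e => ?_)
    (fun β hβ => ?_) (fun β _ => ?_)
  · have := congrArg (rootAct g⁻¹) e
    simpa [← rootAct_mul, rootAct_one] using this
  · refine ⟨rootAct g⁻¹ β, (invFin_mul_of_rootVal hg w _).1 ?_, ?_⟩ <;>
      simp [← rootAct_mul, rootAct_one, hβ]
  · rw [pair_rootAct, reflR_rootAct]; congr 2; group

/-- The sums over inversions of `w` and `s_α w` correspond under `β ↦ s_α β`, except for the term `β
= α`, which occurs on exactly one side. That term is the scalar in the cross relation. -/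
theorem leftOp_dOp_simple (ζ : Fin n → ℂ) (κ : ℂ) {α : Root n} (hα : rootVal α (rho n) = 1)
    (hαne : α.1 ≠ α.2.1) (h : HDot n) :
    leftOp (reflR α) ∘ₗ dOp ζ κ h =
      dOp ζ κ (act (reflR α) h) ∘ₗ leftOp (reflR α) - pair α h • LinearMap.id := by
  refine wSpace_ext fun w => ?_
  simp only [LinearMap.comp_apply, LinearMap.sub_apply, LinearMap.smul_apply, LinearMap.id_apply,
    dOp_single, leftOp_single, dVec, map_sub, map_smul, map_sum, act_inv_act]
  have hinv : ∀ β, rootAct (reflR α) (rootAct (reflR α) β) = β := fun β => by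
    rw [← rootAct_mul, reflR_mul_self, rootAct_one]
  have hss : reflR α * (reflR α * w) = w := by rw [← mul_assoc, reflR_mul_self, one_mul]
  have hsum : ∑ β ∈ (invFin w).erase α, pair β h • Finsupp.single (reflR α * (reflR β * w)) (1 : ℂ)
      = ∑ β ∈ (invFin (reflR α * w)).erase α, pair β (act (reflR α) h) •
        Finsupp.single (reflR β * (reflR α * w)) (1 : ℂ) := by
    refine Finset.sum_bij (fun β _ => rootAct (reflR α) β) (fun β hβ => ?_)
      (fun β _ β' _ e => ?_) (fun β hβ => ?_) (fun β _ => ?_)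
    · rw [Finset.mem_erase] at hβ
      have := rootAct_mem_invFin hα hαne hβ.1 hβ.2
      exact Finset.mem_erase.2 ⟨this.2, this.1⟩
    · rw [← hinv β, e, hinv]
    · rw [Finset.mem_erase] at hβ
      have := rootAct_mem_invFin hα hαne hβ.1 hβ.2
      rw [hss] at this
      exact ⟨_, Finset.mem_erase.2 ⟨this.2, this.1⟩, hinv β⟩
    · rw [pair_rootAct, reflR_rootAct]; congr 2; group
  have hpair : pair α (act (reflR α) h) = -pair α h := by
    simp [pair, rootPair, act_def]
  have hiff := simple_mem_invFin_iff hα hαne w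
  by_cases hmem : α ∈ invFin w
  · have hmem' : α ∉ invFin (reflR α * w) := fun h => hiff.1 h hmem
    rw [← Finset.add_sum_erase _ _ hmem, hsum, Finset.erase_eq_of_notMem hmem', hss]
    abel
  · have hmem' : α ∈ invFin (reflR α * w) := hiff.2 hmem
    rw [← Finset.add_sum_erase _ _ hmem', ← hsum, Finset.erase_eq_of_notMem hmem, hss, hpair]
    simp only [neg_smul]
    abel

theorem leftOp_mul (g g' : ExtAffineWeyl n) : leftOp (g * g') = leftOp g ∘ₗ leftOp g' :=
  wSpace_ext fun w => by simp [mul_assoc]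

theorem dOp_one (ζ : Fin n → ℂ) (κ : ℂ) (h : HDot n) :
    dOp ζ κ h (Finsupp.single 1 1) = weightFun ζ κ h • Finsupp.single 1 1 := by
  simp [dVec, act_one, invFin_one]

/-- The set of `w` such that a property holds for `w` is everything if it holds for `1` and is
stable under left multiplication by generators. -/
theorem weyl_induction {P : ExtAffineWeyl n → Prop} (h1 : P 1)
    (hs : ∀ i j : Fin n, (j : ℕ) = i + 1 → ∀ w, P w → P (reflR (i, j, 0) * w))
    (hpi : ∀ w, P w ↔ P (piElt n * w)) (w : ExtAffineWeyl n) : P w := by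
  let S : Subgroup (ExtAffineWeyl n) :=
    { carrier := {g | ∀ w, P w ↔ P (g * w)}
      one_mem' := fun w => by rw [one_mul]
      mul_mem' := fun {a b} ha hb w => by rw [hb w, ha (b * w), mul_assoc]
      inv_mem' := fun {a} ha w => by rw [ha (a⁻¹ * w), mul_inv_cancel_left] }
  have hS : S = ⊤ := by
    refine weyl_closure S (fun i j hij w => ?_) hpi
    have e : perm (Equiv.swap i j) = reflR (i, j, 0) := by
      refine weyl_ext (fun a => ?_) (fun a => ?_) <;> simp [shift_reflR]
    rw [e]
    refine ⟨hs i j hij w, fun h => ?_⟩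
    have := hs i j hij _ h
    rwa [← mul_assoc, reflR_mul_self, one_mul] at this
  have : (1 : ExtAffineWeyl n) ∈ S := S.one_mem
  have hw : w ∈ S := by rw [hS]; trivial
  simpa using (hw 1).1 h1

theorem isSimple_finite {i j : Fin n} (hij : (j : ℕ) = i + 1) : IsSimpleAffineRoot i j 0 :=
  Or.inl ⟨hij, rfl⟩

/-- `h - s_α(h) = ⟨α | h⟩ α^∨`. -/
theorem sub_act_reflR (α : Root n) :
    ∃ a : HDot n, ∀ h : HDot n, act (reflR α) h = h - pair α h • a := by
  obtain ⟨i, j, k⟩ := α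
  by_cases hij : i = j
  · subst hij
    refine ⟨0, fun h => ?_⟩
    ext a
    · simp [act_def]
    · simp [act_def, shift_reflR]
  refine ⟨(Pi.single i 1 - Pi.single j 1, k), fun h => ?_⟩
  ext a
  · simp only [act_def, right_reflR, Equiv.swap_inv, pair, rootPair, Prod.fst_sub, Pi.sub_apply,
      Prod.smul_fst, Pi.smul_apply, Pi.single_apply, smul_eq_mul]
    by_cases h1 : a = i
    · subst h1; simp [hij]
    · by_cases h2 : a = j
      · subst h2; simp [h1]
      · simp [h1, h2, Equiv.swap_apply_of_ne_of_ne]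
  · simp only [act_def, right_reflR, Equiv.swap_inv, pair, rootPair, Prod.snd_sub,
      Prod.smul_snd, smul_eq_mul, shift_reflR]
    congr 1
    rw [Finset.sum_eq_add i j hij]
    · simp [hij, Ne.symm hij]; ring
    · intro c _ hc; simp [hc.1, hc.2]
    · simp
    · simp

theorem dOp_neg (ζ : Fin n → ℂ) (κ : ℂ) (h : HDot n) : dOp ζ κ (-h) = -dOp ζ κ h := by
  have := dOp_add ζ κ (-h) h
  rw [neg_add_cancel] at this
  have h0 := dOp_smul ζ κ 0 h
  rw [zero_smul, zero_smul] at h0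
  refine LinearMap.ext fun x => ?_
  have hx := LinearMap.congr_fun (this.symm.trans h0) x
  rw [LinearMap.add_apply] at hx
  exact eq_neg_of_add_eq_zero_left hx

/-- On the basis vector of `1` the operators are scalars; the cross relations propagate
commutativity from `w` to `s_i w` and `π w`. -/
theorem dOp_comm (ζ : Fin n → ℂ) (κ : ℂ) (h h' : HDot n) :
    dOp ζ κ h ∘ₗ dOp ζ κ h' = dOp ζ κ h' ∘ₗ dOp ζ κ h := by
  suffices H : ∀ w : ExtAffineWeyl n, ∀ h h' : HDot n,
      dOp ζ κ h (dOp ζ κ h' (Finsupp.single w 1)) = dOp ζ κ h' (dOp ζ κ h (Finsupp.single w 1)) from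
    wSpace_ext fun w => H w h h'
  refine weyl_induction ?_ ?_ ?_
  · intro h h'
    simp only [dOp_one, map_smul, smul_smul]
    rw [mul_comm]
  · intro i j hij w hw h h'
    obtain ⟨hα, hne⟩ := (isSimple_finite hij).rootVal_eq
    set α : Root n := (i, j, 0)
    have hcr : ∀ h x, dOp ζ κ h (leftOp (reflR α) x) =
        leftOp (reflR α) (dOp ζ κ (act (reflR α) h) x) - pair α h • x := by
      intro h x
      have := LinearMap.congr_fun (leftOp_dOp_simple ζ κ hα hne (act (reflR α) h)) x
      have hpair : pair α (act (reflR α) h) = -pair α h := by simp [pair, rootPair, act_def]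
      simp only [LinearMap.comp_apply, LinearMap.sub_apply, LinearMap.smul_apply,
        LinearMap.id_apply, ← act_mul, reflR_mul_self, act_one, hpair] at this
      rw [this]; simp
    -- Moving both operators past `s_α` leaves correction terms. As `s_α(h)` differs from `h` by `⟨α
    -- | h⟩` times a fixed vector, they are symmetric in `h` and `h'`.
    obtain ⟨a, ha⟩ := sub_act_reflR α
    have e : (Finsupp.single (reflR α * w) 1 : WSpace n) =
        leftOp (reflR α) (Finsupp.single w 1) := by simp
    simp only [e, hcr, map_sub, map_smul]
    rw [hw (act (reflR α) h)]
    simp only [ha h, ha h', sub_eq_add_neg, dOp_add, dOp_neg, dOp_smul, LinearMap.add_apply,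
      LinearMap.neg_apply, LinearMap.smul_apply]
    module
  · intro w
    have hcr := fun h x => LinearMap.congr_fun
      (leftOp_dOp_of_rootVal ζ κ (g := piElt n) piElt_rootVal h) x
    simp only [LinearMap.comp_apply] at hcr
    have e : (Finsupp.single (piElt n * w) 1 : WSpace n) =
        leftOp (piElt n) (Finsupp.single w 1) := by simp
    have hinj : Function.Injective (leftOp (piElt n)) := by
      refine Finsupp.mapDomain_injective fun a b hab => ?_
      simpa using hab
    constructor
    · intro H h h'
      obtain ⟨h, rfl⟩ : ∃ g, h = act (piElt n) g :=
        ⟨act (piElt n)⁻¹ h, by rw [← act_mul, mul_inv_cancel, act_one]⟩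
      obtain ⟨h', rfl⟩ : ∃ g, h' = act (piElt n) g :=
        ⟨act (piElt n)⁻¹ h', by rw [← act_mul, mul_inv_cancel, act_one]⟩
      rw [e, ← hcr, ← hcr, ← hcr, ← hcr, H]
    · intro H h h'
      apply hinj
      have := H (act (piElt n) h) (act (piElt n) h')
      rwa [e, ← hcr, ← hcr, ← hcr, ← hcr] at this

/-- The representation of the degenerate double affine Hecke algebra on the module induced from a
character of `HDot n`. -/
def indRep (ζ : Fin n → ℂ) (κ : ℂ) : DDAHA n →ₐ[ℂ] Module.End ℂ (WSpace n) :=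
  RingQuot.liftAlgHom ℂ ⟨FreeAlgebra.lift ℂ (Sum.elim leftOp (dOp ζ κ)), by
    intro x y hxy
    induction hxy with
    | w_one => simpa [preW] using wSpace_ext (n := n) fun w => by simp
    | w_mul v w => simp [preW, leftOp_mul, Module.End.mul_eq_comp]
    | h_add h h' => simp [preH, dOp_add]
    | h_smul a h => simp [preH, dOp_smul]
    | h_comm h h' => simpa [preH, Module.End.mul_eq_comp] using dOp_comm ζ κ h h'
    | cross i j k hs h =>
      obtain ⟨hα, hne⟩ := hs.rootVal_eq
      have := leftOp_dOp_simple ζ κ hα hne h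
      have e : reflR (i, j, k) = refl i j k := rfl
      rw [e] at this
      simp only [preW, preH, map_sub, map_mul, FreeAlgebra.lift_ι_apply, Sum.elim_inl, Sum.elim_inr,
        AlgHom.commutes, Module.End.mul_eq_comp, this, Module.algebraMap_end_eq_smul_id]
      refine LinearMap.ext fun x => ?_
      simp only [LinearMap.sub_apply, LinearMap.smul_apply, LinearMap.id_apply, pair, neg_smul]
      abel
    | cross_pi h =>
      simpa [preW, preH, Module.End.mul_eq_comp] using
        leftOp_dOp_of_rootVal ζ κ (g := piElt n) piElt_rootVal h⟩

@[simp] theorem indRep_ofW (ζ : Fin n → ℂ) (κ : ℂ) (w : ExtAffineWeyl n) :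
    indRep ζ κ (ofW w) = leftOp w := by
  unfold indRep ofW
  erw [RingQuot.liftAlgHom_mkAlgHom_apply]
  simp [preW]

@[simp] theorem indRep_ofH (ζ : Fin n → ℂ) (κ : ℂ) (h : HDot n) :
    indRep ζ κ (ofH h) = dOp ζ κ h := by
  unfold indRep ofH
  erw [RingQuot.liftAlgHom_mkAlgHom_apply]
  simp [preH]

/-! ### Relations in the algebra -/

theorem ofW_one : (ofW 1 : DDAHA n) = 1 := by
  have := RingQuot.mkAlgHom_rel ℂ (Rel.w_one (n := n))
  rw [map_one] at this
  exact this

theorem ofW_mul (v w : ExtAffineWeyl n) : (ofW (v * w) : DDAHA n) = ofW v * ofW w := by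
  have := RingQuot.mkAlgHom_rel ℂ (Rel.w_mul v w)
  rw [map_mul] at this
  exact this

theorem ofH_comm (h h' : HDot n) : (ofH h * ofH h' : DDAHA n) = ofH h' * ofH h := by
  have := RingQuot.mkAlgHom_rel ℂ (Rel.h_comm h h')
  rw [map_mul, map_mul] at this
  exact this

theorem ofW_cross {i j : Fin n} {k : ℤ} (hs : IsSimpleAffineRoot i j k) (h : HDot n) :
    (ofW (reflR (i, j, k)) * ofH h : DDAHA n) =
      ofH (act (reflR (i, j, k)) h) * ofW (reflR (i, j, k)) -
        algebraMap ℂ (DDAHA n) (pair (i, j, k) h) := by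
  have := RingQuot.mkAlgHom_rel ℂ (Rel.cross i j k hs h)
  rw [map_sub, map_mul, map_mul, AlgHom.commutes, map_neg] at this
  rw [sub_eq_add_neg]
  exact sub_eq_iff_eq_add'.1 this

theorem ofW_cross_pi (h : HDot n) :
    (ofW (piElt n) * ofH h : DDAHA n) = ofH (act (piElt n) h) * ofW (piElt n) := by
  have := RingQuot.mkAlgHom_rel ℂ (Rel.cross_pi h)
  rw [map_mul, map_mul] at this
  exact this

theorem dDAHA_induction {P : DDAHA n → Prop} (hW : ∀ w, P (ofW w)) (hH : ∀ h, P (ofH h))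
    (hC : ∀ a, P (algebraMap ℂ _ a)) (hadd : ∀ a b, P a → P b → P (a + b))
    (hmul : ∀ a b, P a → P b → P (a * b)) (x : DDAHA n) : P x := by
  obtain ⟨y, rfl⟩ := RingQuot.mkAlgHom_surjective ℂ (Rel n) x
  induction y using FreeAlgebra.induction with
  | grade0 a => rw [AlgHom.commutes]; exact hC a
  | grade1 g =>
    cases g with
    | inl w => exact hW w
    | inr h => exact hH h
  | mul a b ha hb => rw [map_mul]; exact hmul _ _ ha hb
  | add a b ha hb => rw [map_add]; exact hadd _ _ ha hb

/-! ### Modules generated by a weight vector -/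

section Modules

set_option linter.unusedSectionVars false

variable {Q : Type*} [AddCommGroup Q] [Module ℂ Q] [Module (DDAHA n) Q] [IsScalarTower ℂ (DDAHA n) Q]

instance : SMulCommClass ℂ (DDAHA n) Q := IsScalarTower.to_smulCommClass

/-- The map `w ↦ w v` from the induced module. -/
def orbitMap (v : Q) : WSpace n →ₗ[ℂ] Q := Finsupp.linearCombination ℂ fun w => ofW w • v

@[simp] theorem orbitMap_single (v : Q) (w : ExtAffineWeyl n) :
    orbitMap v (Finsupp.single w 1) = ofW w • v := by
  simp [orbitMap]

theorem orbitMap_leftOp (v : Q) (g : ExtAffineWeyl n) (x : WSpace n) :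
    orbitMap v (leftOp g x) = ofW g • orbitMap v x := by
  induction x using Finsupp.induction_linear with
  | zero => simp
  | add x y hx hy => simp only [map_add, hx, hy, smul_add]
  | single w a =>
    rw [leftOp_single]
    simp only [orbitMap, Finsupp.linearCombination_single, ofW_mul, mul_smul]
    rw [smul_comm]

/-- The formula for `h · w` follows from the cross relations and the weight of `v` alone, so it
holds in any module; the induction is the one used for `dOp_comm`. -/
theorem orbitMap_dOp {ζ : Fin n → ℂ} {κ : ℂ} {v : Q}
    (hv : ∀ h : HDot n, ofH h • v = weightFun ζ κ h • v) (h : HDot n) (x : WSpace n) :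
    orbitMap v (dOp ζ κ h x) = ofH h • orbitMap v x := by
  suffices H : ∀ w : ExtAffineWeyl n, ∀ h : HDot n,
      orbitMap v (dOp ζ κ h (Finsupp.single w 1)) = ofH h • orbitMap v (Finsupp.single w 1) by
    have : orbitMap v ∘ₗ dOp ζ κ h =
        ((Algebra.lsmul ℂ ℂ Q (ofH h)) : Q →ₗ[ℂ] Q) ∘ₗ orbitMap v :=
      wSpace_ext fun w => H w h
    exact LinearMap.congr_fun this x
  refine weyl_induction ?_ ?_ ?_
  · intro h
    rw [dOp_one, map_smul, orbitMap_single, ofW_one, one_smul, hv]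
  · intro i j hij w hw h
    have hs := isSimple_finite hij
    obtain ⟨hα, hne⟩ := hs.rootVal_eq
    have e : (Finsupp.single (reflR (i, j, 0) * w) 1 : WSpace n) =
        leftOp (reflR (i, j, 0)) (Finsupp.single w 1) := by simp
    obtain ⟨h, rfl⟩ : ∃ g, h = act (reflR (i, j, 0)) g :=
      ⟨act (reflR (i, j, 0)) h, by rw [← act_mul, reflR_mul_self, act_one]⟩
    have h1 := LinearMap.congr_fun (leftOp_dOp_simple ζ κ hα hne h) (Finsupp.single w 1)
    simp only [LinearMap.comp_apply, LinearMap.sub_apply, LinearMap.smul_apply,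
        LinearMap.id_apply] at h1
    rw [e, sub_eq_iff_eq_add.1 h1.symm, map_add, orbitMap_leftOp, hw, map_smul, orbitMap_leftOp,
      smul_smul, smul_smul, ofW_cross hs, sub_smul, algebraMap_smul, sub_add_cancel]
  · intro w
    have hcr := fun h x => LinearMap.congr_fun
      (leftOp_dOp_of_rootVal ζ κ (g := piElt n) piElt_rootVal h) x
    simp only [LinearMap.comp_apply] at hcr
    have e : (Finsupp.single (piElt n * w) 1 : WSpace n) =
        leftOp (piElt n) (Finsupp.single w 1) := by simp
    constructor
    · intro H h
      obtain ⟨h, rfl⟩ : ∃ g, h = act (piElt n) g :=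
        ⟨act (piElt n)⁻¹ h, by rw [← act_mul, mul_inv_cancel, act_one]⟩
      rw [e, ← hcr, orbitMap_leftOp, H, orbitMap_leftOp, smul_smul, smul_smul, ofW_cross_pi]
    · intro H h
      have := H (act (piElt n) h)
      rw [e, ← hcr, orbitMap_leftOp, orbitMap_leftOp, smul_smul, ← ofW_cross_pi, mul_smul] at this
      have h2 := congrArg (fun x => ofW (piElt n)⁻¹ • x) this
      simpa only [smul_smul, ← mul_assoc, ← ofW_mul, inv_mul_cancel, ofW_one, one_smul, one_mul]
        using h2

/-- A weight vector generates the span of its orbit under the group: the polynomial part adds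
nothing. -/
theorem smul_mem_range_orbitMap {ζ : Fin n → ℂ} {κ : ℂ} {v : Q}
    (hv : ∀ h : HDot n, ofH h • v = weightFun ζ κ h • v) (a : DDAHA n) :
    ∀ y ∈ LinearMap.range (orbitMap (n := n) v), a • y ∈ LinearMap.range (orbitMap (n := n) v) := by
  induction a using dDAHA_induction with
  | hW w => rintro _ ⟨y, rfl⟩; exact ⟨_, orbitMap_leftOp v w y⟩
  | hH h => rintro _ ⟨y, rfl⟩; exact ⟨_, orbitMap_dOp hv h y⟩
  | hC a => rintro y hy; rw [algebraMap_smul]; exact Submodule.smul_mem _ a hy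
  | hadd a b ha hb => rintro y hy; rw [add_smul]; exact Submodule.add_mem _ (ha y hy) (hb y hy)
  | hmul a b ha hb => rintro y hy; rw [mul_smul]; exact ha _ (hb y hy)

theorem mem_range_orbitMap (v : Q) : v ∈ LinearMap.range (orbitMap (n := n) v) :=
  ⟨Finsupp.single 1 1, by simp [ofW_one]⟩

end Modules

end

/-! ### Nonvanishing of the induced module, by an invariant functional. -/

section

variable {n : ℕ}

/-! ### The induced module is not zero -/

/-- The sum of the coordinates. -/
def augment (n : ℕ) : WSpace n →ₗ[ℂ] ℂ := Finsupp.linearCombination ℂ fun _ => 1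

theorem augment_leftOp (g : ExtAffineWeyl n) (x : WSpace n) :
    augment n (leftOp g x) = augment n x := by
  have : augment n ∘ₗ leftOp g = augment n := wSpace_ext fun w => by simp [augment]
  exact LinearMap.congr_fun this x

theorem weightFun_act_swap {ζ : Fin n → ℂ} (κ : ℂ) {i j : Fin n} (hij : (j : ℕ) = i + 1)
    (hζ : ζ j = ζ i + 1) (h : HDot n) :
    weightFun ζ κ (act (reflR (i, j, 0)) h) = weightFun ζ κ h + pair (i, j, 0) h := by
  have hne : i ≠ j := fun h => by subst h; omega
  simp only [weightFun, act_def, right_reflR, Equiv.swap_inv, shift_reflR, pair, rootPair]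
  have e : ∀ a, ζ a * h.1 (Equiv.swap i j a) = ζ a * h.1 a + ((if a = i then
      ζ i * (h.1 j - h.1 i) else 0) + (if a = j then ζ j * (h.1 i - h.1 j) else 0)) := by
    intro a
    by_cases h1 : a = i
    · subst h1; simp [hne]; ring
    · by_cases h2 : a = j
      · subst h2; simp [h1]; ring
      · simp [h1, h2, Equiv.swap_apply_of_ne_of_ne]
  simp only [e, Finset.sum_add_distrib, Finset.sum_ite_eq', Finset.mem_univ, if_true, hζ]
  simp
  ring

/-- Because `ζ_j = ζ_i + 1`, the vector `s - 1` is itself a weight vector, of weight `sζ`. So it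
generates the span of the vectors `w(s - 1)`, and each of these has coordinate sum 0. -/
theorem augment_indRep_swap {ζ : Fin n → ℂ} (κ : ℂ) {i j : Fin n} (hij : (j : ℕ) = i + 1)
    (hζ : ζ j = ζ i + 1) (a : DDAHA n) :
    augment n (indRep ζ κ a (Finsupp.single (reflR (i, j, 0)) 1 - Finsupp.single 1 1)) = 0 := by
  let _ : Module (DDAHA n) (WSpace n) := Module.compHom _ (indRep ζ κ).toRingHom
  have hsm : ∀ (a : DDAHA n) (x : WSpace n), a • x = indRep ζ κ a x := fun _ _ => rfl
  have : IsScalarTower ℂ (DDAHA n) (WSpace n) := ⟨fun c a x => by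
    rw [hsm, hsm, map_smul, LinearMap.smul_apply]⟩
  set s := reflR (i, j, 0) with hs
  set x : WSpace n := Finsupp.single s 1 - Finsupp.single 1 1 with hx
  obtain ⟨hα, hne⟩ := (isSimple_finite hij).rootVal_eq
  have hw : ∀ h : HDot n, ofH h • x =
      weightFun (fun a => ζ (Equiv.swap i j a)) κ h • x := by
    intro h
    obtain ⟨h, rfl⟩ : ∃ g, h = act s g := ⟨act s h, by rw [← act_mul, reflR_mul_self, act_one]⟩
    have h1 := LinearMap.congr_fun (leftOp_dOp_simple ζ κ hα hne h) (Finsupp.single 1 1)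
    simp only [LinearMap.comp_apply, LinearMap.sub_apply, LinearMap.smul_apply,
        LinearMap.id_apply, dOp_one, map_smul, leftOp_single, mul_one] at h1
    have h2 : weightFun (fun a => ζ (Equiv.swap i j a)) κ (act s h) = weightFun ζ κ h := by
      simp only [weightFun, act_def, right_reflR, Equiv.swap_inv, hs, shift_reflR]
      rw [Equiv.sum_comp (Equiv.swap i j) fun a => ζ a * h.1 a]
      simp
    rw [hsm, indRep_ofH, hx, map_sub, dOp_one, weightFun_act_swap κ hij hζ,
      sub_eq_iff_eq_add.1 h1.symm, h2]
    module
  obtain ⟨y, hy⟩ := smul_mem_range_orbitMap hw a x (mem_range_orbitMap x)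
  rw [← hsm, ← hy]
  suffices H : augment n ∘ₗ orbitMap x = 0 from LinearMap.congr_fun H y
  refine wSpace_ext fun w => ?_
  rw [LinearMap.comp_apply, orbitMap_single, hsm, indRep_ofW, augment_leftOp]
  simp [hx, augment]

theorem perm_swap_eq (i j : Fin n) : perm (Equiv.swap i j) = reflR (i, j, 0) := by
  refine weyl_ext (fun a => ?_) (fun a => ?_) <;> simp [shift_reflR]

theorem zeta_eq_weightFun (κ : ℤ) {p : ℕ} (l m : Fin p → ℤ) (h : HDot n) :
    zeta κ l m h = weightFun (fun j => (zetaCoord l m j : ℂ)) κ h := rfl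

/-- The coordinate sum of `a · 1` in the explicit representation, corrected by nothing, is a
functional of `a` that kills the left ideal but is 1 at `a = 1`. No basis of the induced module is
needed. -/
theorem one_notMem_indIdeal (κ : ℤ) {p : ℕ} (l m : Fin p → ℤ)
    (hz : ∀ a b : Fin n, (b : ℕ) = a + 1 →
      (∀ k : ℕ, 1 ≤ k → k < p → ((b : ℕ) : ℤ) ≠ partialSum l m k) →
      zetaCoord l m b = zetaCoord l m a + 1) : (1 : DDAHA n) ∉ indIdeal n κ l m := by
  set ζ : Fin n → ℂ := fun j => (zetaCoord l m j : ℂ)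
  set φ : DDAHA n → ℂ := fun a => augment n (indRep ζ κ a (Finsupp.single 1 1)) with hφ
  have hφadd : ∀ a b, φ (a + b) = φ a + φ b := fun a b => by simp [hφ]
  have hφsub : ∀ a b, φ (a - b) = φ a - φ b := fun a b => by simp [hφ]
  suffices H : ∀ x ∈ indIdeal n κ l m, ∀ a, φ (a * x) = 0 by
    intro h1
    have := H 1 h1 1
    simp [hφ, augment] at this
  intro x hx
  induction hx using Submodule.span_induction with
  | zero => intro a; simp [hφ]
  | add x y _ _ hx hy => intro a; rw [mul_add, hφadd, hx, hy, add_zero]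
  | smul c x _ hx => intro a; rw [smul_eq_mul, ← mul_assoc, hx]
  | mem x hx =>
    rcases hx with ⟨w, hw, rfl⟩ | ⟨h, rfl⟩
    · suffices H : ∀ a, φ (a * ofW (perm w)) = φ a by
        intro a; rw [mul_sub, hφsub, H, mul_one, sub_self]
      induction hw using Subgroup.closure_induction with
      | mem x hx =>
        obtain ⟨i, j, hij, hk, rfl⟩ := hx
        intro a
        have hζ : ζ j = ζ i + 1 := by simp only [ζ]; rw [hz i j hij hk]; push_cast; rfl
        have := augment_indRep_swap (κ : ℂ) hij hζ a
        rw [map_sub, map_sub, sub_eq_zero] at this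
        simp only [hφ, map_mul, perm_swap_eq, indRep_ofW]
        rw [← this]
        simp
      | one =>
        intro a
        have : (perm 1 : ExtAffineWeyl n) = 1 := map_one _
        rw [this, ofW_one, mul_one]
      | mul x y _ _ hx hy => intro a; rw [perm_mul, ofW_mul, ← mul_assoc, hy, hx]
      | inv x _ hx =>
        intro a
        have : (perm x⁻¹ * perm x : ExtAffineWeyl n) = 1 := by rw [← perm_mul]; simp; rfl
        rw [← hx (a * ofW (perm x⁻¹)), mul_assoc, ← ofW_mul, this, ofW_one, mul_one]
    · intro a
      rw [mul_sub, hφsub, ← Algebra.commutes, ← Algebra.smul_def]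
      simp only [hφ, map_mul, map_smul, Module.End.mul_apply, LinearMap.smul_apply, indRep_ofH,
        dOp_one, zeta_eq_weightFun]
      exact sub_self _

end

/-! ### Counting generalized weights along a triangular family. -/

section

/-! ### Generalized weight spaces and triangular families -/

section Triangular

variable {V ι I : Type*} [AddCommGroup V] [Module ℂ V]

/-- The simultaneous generalized eigenspace of a family of operators. -/
def genWeight (x : ι → Module.End ℂ V) (a : ι → ℂ) : Submodule ℂ V :=
  ⨅ i, (x i).maxGenEigenspace (a i)

theorem mem_genWeight {x : ι → Module.End ℂ V} {a : ι → ℂ} {v : V} :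
    v ∈ genWeight x a ↔ ∀ i, ∃ k, ((x i - a i • (1 : Module.End ℂ V)) ^ k) v = 0 := by
  simp [genWeight, Submodule.mem_iInf, Module.End.mem_maxGenEigenspace]

/-- Modulo the stable subspace `U`, the operator acts on `v` as the scalar `b`. -/
theorem pow_sub_smul_mem {x : Module.End ℂ V} {U : Submodule ℂ V} (hU : ∀ y ∈ U, x y ∈ U)
    {v : V} {b : ℂ} (hv : x v - b • v ∈ U) (a : ℂ) (k : ℕ) :
    ((x - a • (1 : Module.End ℂ V)) ^ k) v - (b - a) ^ k • v ∈ U := by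
  induction k with
  | zero => simp
  | succ k ih =>
    have hU' : ∀ y ∈ U, (x - a • (1 : Module.End ℂ V)) y ∈ U := fun y hy => by
      simpa using U.sub_mem (hU y hy) (U.smul_mem a hy)
    have h1 := hU' _ ih
    rw [map_sub, map_smul] at h1
    have h2 := U.smul_mem ((b - a) ^ k) hv
    have h3 := U.add_mem h1 h2
    rw [pow_succ', Module.End.mul_apply]
    convert h3 using 1
    simp only [LinearMap.sub_apply, LinearMap.smul_apply, Module.End.one_apply]
    rw [pow_succ]
    module

theorem finrank_le_add_one {U W : Submodule ℂ V} [FiniteDimensional ℂ W] {v : V}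
    (h : W ≤ ℂ ∙ v ⊔ U) : Module.finrank ℂ W ≤ Module.finrank ℂ (W ⊓ U : Submodule ℂ V) + 1 := by
  set f := U.mkQ.domRestrict W
  have h1 := f.finrank_range_add_finrank_ker
  have h2 : Module.finrank ℂ f.range ≤ 1 := by
    have hle : f.range ≤ ℂ ∙ U.mkQ v := by
      rintro _ ⟨⟨w, hw⟩, rfl⟩
      obtain ⟨y, hy, z, hz, e⟩ := Submodule.mem_sup.1 (h hw)
      obtain ⟨c, rfl⟩ := Submodule.mem_span_singleton.1 hy
      refine Submodule.mem_span_singleton.2 ⟨c, ?_⟩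
      simp only [f, LinearMap.domRestrict_apply, ← e, map_add, map_smul]
      rw [(Submodule.Quotient.mk_eq_zero U).2 hz |> fun h => (h : U.mkQ z = 0), add_zero]
    exact (Submodule.finrank_mono hle).trans ((finrank_span_le_card _).trans (by
      rw [Set.toFinset_card]; exact (Set.card_singleton _).le))
  have h3 : Module.finrank ℂ f.ker ≤ Module.finrank ℂ (W ⊓ U : Submodule ℂ V) := by
    let g : f.ker →ₗ[ℂ] (W ⊓ U : Submodule ℂ V) :=
      LinearMap.codRestrict _ (W.subtype ∘ₗ f.ker.subtype) fun y => ⟨y.1.2, by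
        have h : U.mkQ (y.1 : V) = 0 := y.2
        exact (Submodule.Quotient.mk_eq_zero U).1 h⟩
    have : FiniteDimensional ℂ (W ⊓ U : Submodule ℂ V) :=
      Submodule.finiteDimensional_of_le inf_le_left
    refine LinearMap.finrank_le_finrank_of_injective (f := g) fun y z hyz => ?_
    have := congrArg Subtype.val hyz
    exact Subtype.ext (Subtype.ext this)
  omega

/-- A generalized weight space in the span of a triangular family has at most the dimension read
off from the diagonal. -/
theorem finrank_genWeight_inf_span_le (x : ι → Module.End ℂ V) (a : ι → ℂ) (u : I → V)
    (b : I → ι → ℂ) (r : I → ℤ) (S : Finset I) :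
    (∀ w ∈ S, ∀ j, x j (u w) - b w j • u w ∈ Submodule.span ℂ (u '' {w' | w' ∈ S ∧ r w' < r w})) →
    Module.finrank ℂ (genWeight x a ⊓ Submodule.span ℂ (u '' S) : Submodule ℂ V) ≤
      Set.ncard {w | w ∈ S ∧ b w = a} := by
  classical
  induction S using Finset.induction_on_max_value r with
  | empty =>
    intro _
    rw [Finset.coe_empty, Set.image_empty, Submodule.span_empty, inf_bot_eq]
    simp
  | insert w S hw hmax ih =>
    intro hS
    have hS' : ∀ w' ∈ S, ∀ j, x j (u w') - b w' j • u w' ∈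
        Submodule.span ℂ (u '' {w'' | w'' ∈ S ∧ r w'' < r w'}) := by
      intro w' hw' j
      refine Submodule.span_mono (Set.image_mono ?_) (hS w' (Finset.mem_insert_of_mem hw') j)
      rintro w'' ⟨h1, h2⟩
      refine ⟨(Finset.mem_insert.1 h1).resolve_left ?_, h2⟩
      rintro rfl
      exact absurd (hmax w' hw') (not_le.2 h2)
    have hst : ∀ j, ∀ y ∈ Submodule.span ℂ (u '' (S : Set I)), x j y ∈
        Submodule.span ℂ (u '' (S : Set I)) := by
      intro j y hy
      induction hy using Submodule.span_induction with
      | zero => simp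
      | add y z _ _ hy hz => rw [map_add]; exact Submodule.add_mem _ hy hz
      | smul c y _ hy => rw [map_smul]; exact Submodule.smul_mem _ c hy
      | mem y hy =>
        obtain ⟨w', hw', rfl⟩ := hy
        have := Submodule.span_mono (Set.image_mono fun _ h => h.1) (hS' w' hw' j)
        have h2 := Submodule.add_mem _ this
          (Submodule.smul_mem _ (b w' j) (Submodule.subset_span (Set.mem_image_of_mem u hw')))
        simpa using h2
    have hw0 : ∀ j, x j (u w) - b w j • u w ∈ Submodule.span ℂ (u '' (S : Set I)) := by
      intro j
      refine Submodule.span_mono (Set.image_mono ?_) (hS w (Finset.mem_insert_self _ _) j)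
      rintro w'' ⟨h1, h2⟩
      exact (Finset.mem_insert.1 h1).resolve_left fun h => by subst h; omega
    have hins : Submodule.span ℂ (u '' ((insert w S : Finset I) : Set I)) =
        ℂ ∙ u w ⊔ Submodule.span ℂ (u '' (S : Set I)) := by
      rw [Finset.coe_insert, Set.image_insert_eq, Submodule.span_insert]
    have hfin : ∀ T : Finset I, FiniteDimensional ℂ (Submodule.span ℂ (u '' (T : Set I))) :=
      fun T => FiniteDimensional.span_of_finite ℂ (T.finite_toSet.image u)
    have := hfin S
    have := hfin (insert w S)
    have hfd : FiniteDimensional ℂ (genWeight x a ⊓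
        Submodule.span ℂ (u '' ((insert w S : Finset I) : Set I)) : Submodule ℂ V) :=
      Submodule.finiteDimensional_of_le inf_le_right
    have ih' := ih hS'
    -- The member `w` of highest rank is removed. If its diagonal weight is `a`, both sides grow by
    -- at most, respectively exactly, one.
    by_cases hb : b w = a
    · have h1 := finrank_le_add_one (W := genWeight x a ⊓
        Submodule.span ℂ (u '' ((insert w S : Finset I) : Set I))) (v := u w)
        (U := Submodule.span ℂ (u '' (S : Set I))) (inf_le_right.trans hins.le)
      have h2 : genWeight x a ⊓ Submodule.span ℂ (u '' ((insert w S : Finset I) : Set I)) ⊓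
          Submodule.span ℂ (u '' (S : Set I)) ≤
          genWeight x a ⊓ Submodule.span ℂ (u '' (S : Set I)) :=
        le_inf (inf_le_left.trans inf_le_left) inf_le_right
      have : FiniteDimensional ℂ (genWeight x a ⊓ Submodule.span ℂ (u '' (S : Set I)) :
        Submodule ℂ V) := Submodule.finiteDimensional_of_le inf_le_right
      have h3 := Submodule.finrank_mono h2
      have h4 : {w' | w' ∈ insert w S ∧ b w' = a} = insert w {w' | w' ∈ S ∧ b w' = a} := by
        ext w'
        simp only [Finset.mem_insert, Set.mem_ofPred_eq, Set.mem_insert_iff]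
        constructor
        · rintro ⟨rfl | h, h'⟩
          · exact Or.inl rfl
          · exact Or.inr ⟨h, h'⟩
        · rintro (rfl | ⟨h, h'⟩)
          · exact ⟨Or.inl rfl, hb⟩
          · exact ⟨Or.inr h, h'⟩
      rw [h4, Set.ncard_insert_of_notMem (fun h => hw h.1)
        (S.finite_toSet.subset fun _ h => h.1)]
      omega
    -- Otherwise some operator separates `b w` from `a`: a power of `x j - a j` kills the vector but
    -- multiplies its `u w` part, modulo the remaining span, by a nonzero scalar. So that part
    -- already lies in the remaining span.
    · obtain ⟨j, hj⟩ := Function.ne_iff.1 hb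
      have h2 : genWeight x a ⊓ Submodule.span ℂ (u '' ((insert w S : Finset I) : Set I)) ≤
          genWeight x a ⊓ Submodule.span ℂ (u '' (S : Set I)) := by
        rintro y ⟨hy1, hy2⟩
        refine ⟨hy1, ?_⟩
        obtain ⟨k, hk⟩ := mem_genWeight.1 hy1 j
        rw [hins] at hy2
        obtain ⟨t, ht, z, hz, rfl⟩ := Submodule.mem_sup.1 hy2
        obtain ⟨c, rfl⟩ := Submodule.mem_span_singleton.1 ht
        have h5 := pow_sub_smul_mem (hst j) (hw0 j) (a j) k
        have h6 := pow_sub_smul_mem (hst j) (v := z) (b := 0) (by simpa using hst j z hz) (a j) k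
        have h7 : ((x j - a j • (1 : Module.End ℂ V)) ^ k) z ∈ Submodule.span ℂ (u '' (S : Set I)) := by
          have := Submodule.add_mem _ h6 (Submodule.smul_mem _ ((0 - a j) ^ k) hz)
          simpa using this
        rw [map_add, map_smul] at hk
        have h8 : c • (b w j - a j) ^ k • u w ∈ Submodule.span ℂ (u '' (S : Set I)) := by
          have := Submodule.add_mem _ (Submodule.smul_mem _ c h5) h7
          have e : c • (((x j - a j • (1 : Module.End ℂ V)) ^ k) (u w) - (b w j - a j) ^ k • u w) +
              ((x j - a j • (1 : Module.End ℂ V)) ^ k) z = -(c • (b w j - a j) ^ k • u w) := by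
            rw [smul_sub, sub_add_eq_add_sub, hk, zero_sub]
          rw [e] at this
          simpa using Submodule.neg_mem _ this
        refine Submodule.add_mem _ ?_ hz
        have hne : (b w j - a j) ^ k ≠ 0 := pow_ne_zero _ (sub_ne_zero.2 hj)
        have := Submodule.smul_mem _ ((b w j - a j) ^ k)⁻¹ h8
        rwa [smul_comm c, smul_smul, inv_mul_cancel₀ hne, one_smul] at this
      have : FiniteDimensional ℂ (genWeight x a ⊓ Submodule.span ℂ (u '' (S : Set I)) :
        Submodule ℂ V) := Submodule.finiteDimensional_of_le inf_le_right
      refine (Submodule.finrank_mono h2).trans (ih'.trans (Set.ncard_le_ncard ?_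
        ((insert w S).finite_toSet.subset fun _ h => h.1)))
      rintro w' ⟨h, h'⟩
      exact ⟨Finset.mem_insert_of_mem h, h'⟩

end Triangular

end

/-! ### Upper bounds for weight spaces of cyclic modules. -/

section

variable {n : ℕ}

/-! ### Weight spaces of cyclic modules -/

/-- The position of the letter `j` in the infinite word attached to `w`. -/
def pos (w : ExtAffineWeyl n) (j : Fin n) : ℤ := (w.right j : ℕ) + n * shift w (w.right j)

/-- The letters joined to their predecessor occur in increasing order. -/
def IsIncr (J : Fin n → Prop) (w : ExtAffineWeyl n) : Prop :=
  ∀ i j : Fin n, (j : ℕ) = i + 1 → J j → pos w i < pos w j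

/-- The weight `wζ` at level `κ`. -/
def wtAct (κ : ℤ) (w : ExtAffineWeyl n) (ζ : Fin n → ℤ) (i : Fin n) : ℤ :=
  ζ (w.right⁻¹ i) + κ * shift w i

theorem mul_reflR (w : ExtAffineWeyl n) (β : Root n) :
    w * reflR β = reflR (rootAct w β) * w := by
  rw [reflR_rootAct]; group

/-- Right multiplication by `s_i` is left multiplication by the reflection in `wα_i`, whose value at
`ρ` is the difference of positions. Exchanging neighbours in the wrong order therefore brings `w`
closer to the identity. -/
theorem dist2_mul_swap (w : ExtAffineWeyl n) {i j : Fin n} (hij : (j : ℕ) = i + 1) :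
    dist2 (w * reflR (i, j, 0)) = dist2 w + 2 * (pos w j - pos w i) := by
  obtain ⟨hα, hne⟩ := (isSimple_finite hij).rootVal_eq
  have hne' : (rootAct w (i, j, 0)).1 ≠ (rootAct w (i, j, 0)).2.1 := by
    simpa [rootAct] using hne
  rw [mul_reflR, dist2_reflR_mul hne', rootVal_rootAct, hα]
  simp only [rootVal, rootAct, rho, pos]
  ring

/-- Each coordinate of `wρ` determines a residue and a quotient modulo `n`, hence the permutation
and the translation. -/
theorem ptAct_rho_injective : Function.Injective fun w : ExtAffineWeyl n => ptAct w (rho n) := by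
  intro w w' h
  have key : ∀ i, w.right⁻¹ i = w'.right⁻¹ i ∧ shift w i = shift w' i := by
    intro i
    have h1 := congrFun h i
    simp only [ptAct, rho] at h1
    have ha := (w.right⁻¹ i).2
    have hb := (w'.right⁻¹ i).2
    have h2 : (n : ℤ) * (shift w i - shift w' i) = (w.right⁻¹ i : ℕ) - (w'.right⁻¹ i : ℕ) := by
      linarith
    have h3 : shift w i - shift w' i = 0 := by
      have h4 : (n : ℤ) * (shift w i - shift w' i) < n * 1 := by omega
      have h5 : (n : ℤ) * (-1) < n * (shift w i - shift w' i) := by omega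
      have hn : (0 : ℤ) ≤ n := by omega
      have := lt_of_mul_lt_mul_left h4 hn
      have := lt_of_mul_lt_mul_left h5 hn
      omega
    rw [h3] at h2
    refine ⟨Fin.ext ?_, by omega⟩
    omega
  refine weyl_ext (fun i => (key i).2) (fun i => ?_)
  have : w.right⁻¹ = w'.right⁻¹ := Equiv.ext fun i => (key i).1
  rw [inv_injective this]

theorem dist2_sublevel_finite (R : ℤ) : {w : ExtAffineWeyl n | dist2 w ≤ R}.Finite := by
  refine Set.Finite.of_finite_image ?_ (ptAct_rho_injective (n := n)).injOn
  refine (Set.Finite.pi' (t := fun i => Set.Icc (rho n i - R) (rho n i + R))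
    fun i => Set.finite_Icc _ _).subset ?_
  rintro _ ⟨w, hw, rfl⟩ i
  have h1 : (ptAct w (rho n) i - rho n i) ^ 2 ≤ dist2 w :=
    Finset.single_le_sum (f := fun i => (ptAct w (rho n) i - rho n i) ^ 2)
      (fun i _ => sq_nonneg _) (Finset.mem_univ i)
  have h2 : dist2 w ≤ R := hw
  have h3 : |ptAct w (rho n) i - rho n i| ≤ (ptAct w (rho n) i - rho n i) ^ 2 := by
    rw [← sq_abs]
    rcases (abs_nonneg (ptAct w (rho n) i - rho n i)).eq_or_lt with h | h
    · rw [← h]; norm_num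
    · nlinarith
  have h4 := abs_le.1 (h3.trans (h1.trans h2))
  simp only [Set.mem_Icc]
  omega

section Modules

set_option linter.unusedSectionVars false

variable {Q : Type*} [AddCommGroup Q] [Module ℂ Q] [Module (DDAHA n) Q] [IsScalarTower ℂ (DDAHA n) Q]

/-- The basis vector `ε_i^∨`. -/
def epsV (i : Fin n) : HDot n := (Pi.single i 1, 0)

/-- The operator by which an element of the algebra acts on a module. -/
def opOf (Q : Type*) [AddCommGroup Q] [Module ℂ Q] [Module (DDAHA n) Q]
    [IsScalarTower ℂ (DDAHA n) Q] : DDAHA n →ₐ[ℂ] Module.End ℂ Q := Algebra.lsmul ℂ ℂ Q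

@[simp] theorem opOf_apply (a : DDAHA n) (x : Q) : opOf Q a x = a • x := rfl

/-- The operator `ε_i^∨`. -/
def xOp (Q : Type*) [AddCommGroup Q] [Module ℂ Q] [Module (DDAHA n) Q]
    [IsScalarTower ℂ (DDAHA n) Q] (i : Fin n) : Module.End ℂ Q := opOf Q (ofH (epsV i))

/-- The generalized weight space of an integral weight. -/
def wtSpace (Q : Type*) [AddCommGroup Q] [Module ℂ Q] [Module (DDAHA n) Q]
    [IsScalarTower ℂ (DDAHA n) Q] (a : Fin n → ℤ) : Submodule ℂ Q :=
  genWeight (xOp (n := n) Q) fun i => (a i : ℂ)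

theorem weightFun_act_inv (ζ : Fin n → ℤ) (κ : ℤ) (w : ExtAffineWeyl n) (i : Fin n) :
    weightFun (fun j => (ζ j : ℂ)) κ (act w⁻¹ (epsV i)) = wtAct κ w ζ i := by
  simp only [weightFun, act_def, epsV, SemidirectProduct.inv_right, inv_inv, shift_inv, wtAct,
    Pi.single_apply]
  have e : ∀ j, (w.right j = i) ↔ j = w.right⁻¹ i := fun j => by
    rw [Equiv.Perm.eq_inv_iff_eq]
  simp only [e, mul_ite, mul_one, mul_zero, Finset.sum_ite_eq', Finset.mem_univ, if_true]
  have e2 : w.right (w.right⁻¹ i) = i := w.right.apply_symm_apply i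
  rw [e2]
  push_cast
  ring

variable {ζ : Fin n → ℤ} {κ : ℤ} {v : Q} {J : Fin n → Prop}

/-- If joined neighbours occur in the wrong order, replace `w` by `ws`, which does not change `w v`
since `s v = v` and lowers `dist2`. The process ends at a `w` that is increasing. -/
theorem orbit_mem_span (hJ : ∀ i j : Fin n, (j : ℕ) = i + 1 → J j → ofW (reflR (i, j, 0)) • v = v)
    (w : ExtAffineWeyl n) : ofW w • v ∈ Submodule.span ℂ
      ((fun w : ExtAffineWeyl n => ofW w • v) '' {w' | IsIncr J w' ∧ dist2 w' ≤ dist2 w}) := by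
  induction h : (dist2 w).toNat using Nat.strong_induction_on generalizing w with
  | _ m ih =>
    by_cases hw : IsIncr J w
    · exact Submodule.subset_span ⟨w, ⟨hw, le_rfl⟩, rfl⟩
    · simp only [IsIncr, not_forall] at hw
      obtain ⟨i, j, hij, hJj, hlt⟩ := hw
      have hne : pos w i ≠ pos w j := by
        intro he
        have h1 := dist2_mul_swap w hij
        obtain ⟨hα, hne⟩ := (isSimple_finite hij).rootVal_eq
        have hne' : (rootAct w (i, j, 0)).1 ≠ (rootAct w (i, j, 0)).2.1 := by
          simpa [rootAct] using hne
        have h2 := rootVal_rho_ne_zero hne' 1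
        apply h2
        rw [ptAct_one]
        simp only [rootVal, rootAct, rho]
        simp only [pos] at he
        linarith
      have h1 := dist2_mul_swap w hij
      have h2 := dist2_nonneg (w * reflR (i, j, 0))
      have h3 : dist2 (w * reflR (i, j, 0)) < dist2 w := by omega
      have h4 := ih _ (by omega) (w * reflR (i, j, 0)) rfl
      rw [ofW_mul, mul_smul, hJ i j hij hJj] at h4
      refine Submodule.span_mono (Set.image_mono ?_) h4
      rintro w' ⟨ha, hb⟩
      exact ⟨ha, by omega⟩

/-- The off-diagonal terms are `s_β w v` with `β` an inversion of `w`, hence strictly closer to the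
identity, and rewriting them in increasing elements does not raise `dist2`. -/
theorem xOp_orbit (hv : ∀ h : HDot n, ofH h • v = weightFun (fun j => (ζ j : ℂ)) κ h • v)
    (hJ : ∀ i j : Fin n, (j : ℕ) = i + 1 → J j → ofW (reflR (i, j, 0)) • v = v)
    (w : ExtAffineWeyl n) (i : Fin n) :
    xOp Q i (ofW w • v) - (wtAct κ w ζ i : ℂ) • (ofW w • v) ∈ Submodule.span ℂ
      ((fun w : ExtAffineWeyl n => ofW w • v) '' {w' | IsIncr J w' ∧ dist2 w' < dist2 w}) := by
  have h1 := orbitMap_dOp hv (epsV i) (Finsupp.single w 1)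
  rw [dOp_single, dVec, weightFun_act_inv, map_sub, map_smul, orbitMap_single, map_sum] at h1
  have h2 : xOp Q i (ofW w • v) = ofH (epsV i) • ofW w • v := rfl
  rw [h2, ← h1, sub_right_comm, sub_self, zero_sub]
  refine Submodule.neg_mem _ (Submodule.sum_mem _ fun β hβ => ?_)
  rw [map_smul, orbitMap_single]
  refine Submodule.smul_mem _ _ (Submodule.span_mono (Set.image_mono ?_)
    (orbit_mem_span hJ (reflR β * w)))
  rintro w' ⟨ha, hb⟩
  exact ⟨ha, hb.trans_lt (dist2_reflR_mul_lt hβ)⟩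

/-- The weight spaces of a module generated by an invariant weight vector. -/
theorem rank_wtSpace_le (hv : ∀ h : HDot n, ofH h • v = weightFun (fun j => (ζ j : ℂ)) κ h • v)
    (hJ : ∀ i j : Fin n, (j : ℕ) = i + 1 → J j → ofW (reflR (i, j, 0)) • v = v)
    (hgen : ∀ x : Q, ∃ a : DDAHA n, a • v = x) (a : Fin n → ℤ) (T : Finset (ExtAffineWeyl n))
    (hT : ∀ w, IsIncr J w → wtAct κ w ζ = a → w ∈ T) :
    Module.rank ℂ (wtSpace Q a) ≤ T.card := by
  set u : ExtAffineWeyl n → Q := fun w => ofW w • v with hu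
  have hspan : ∀ x : Q, ∃ R : ℤ, x ∈ Submodule.span ℂ (u '' {w | IsIncr J w ∧ dist2 w ≤ R}) := by
    intro x
    obtain ⟨a, rfl⟩ := hgen x
    obtain ⟨y, hy⟩ := smul_mem_range_orbitMap hv a v (mem_range_orbitMap v)
    refine ⟨∑ w ∈ y.support, dist2 w, ?_⟩
    rw [← hy, orbitMap, Finsupp.linearCombination_apply]
    refine Submodule.sum_mem _ fun w hw => Submodule.smul_mem _ _
      (Submodule.span_mono (Set.image_mono ?_) (orbit_mem_span hJ w))
    rintro w' ⟨h1, h2⟩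
    exact ⟨h1, h2.trans (Finset.single_le_sum (fun w _ => dist2_nonneg w) hw)⟩
  choose R hR using hspan
  -- It suffices to bound finite independent sets. Such a set lies in the span of finitely many `w
  -- v`, those with `dist2 w` bounded, where the triangular count applies.
  refine rank_le fun s hs => ?_
  obtain ⟨R0, hR0⟩ := Finset.exists_le (s.image fun x : wtSpace Q a => R (x : Q))
  classical
  set S := (dist2_sublevel_finite (n := n) R0).toFinset.filter (IsIncr J) with hS
  have hmem : ∀ w, w ∈ S ↔ IsIncr J w ∧ dist2 w ≤ R0 := fun w => by simp [hS, and_comm]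
  have key := finrank_genWeight_inf_span_le (xOp Q) (fun i => (a i : ℂ)) u
    (fun w i => (wtAct κ w ζ i : ℂ)) dist2 S (fun w hw j => by
      refine Submodule.span_mono (Set.image_mono ?_) (xOp_orbit hv hJ w j)
      rintro w' ⟨h1, h2⟩
      exact ⟨(hmem w').2 ⟨h1, h2.le.trans ((hmem w).1 hw).2⟩, h2⟩)
  have hle : Set.ncard {w | w ∈ S ∧ (fun i => (wtAct κ w ζ i : ℂ)) = fun i => (a i : ℂ)} ≤
      T.card := by
    rw [← Set.ncard_coe_finset T]
    refine Set.ncard_le_ncard ?_ T.finite_toSet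
    rintro w ⟨h1, h2⟩
    refine hT w ((hmem w).1 h1).1 (funext fun i => ?_)
    exact_mod_cast congrFun h2 i
  have hfd : FiniteDimensional ℂ (Submodule.span ℂ (u '' (S : Set _))) :=
    FiniteDimensional.span_of_finite ℂ (S.finite_toSet.image u)
  have hfd' : FiniteDimensional ℂ (genWeight (xOp (n := n) Q) (fun i => (a i : ℂ)) ⊓
      Submodule.span ℂ (u '' (S : Set _)) : Submodule ℂ Q) :=
    Submodule.finiteDimensional_of_le inf_le_right
  have hs' : LinearIndependent ℂ fun x : s => ((x : wtSpace Q a) : Q) :=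
    hs.map' (wtSpace Q a).subtype (Submodule.ker_subtype _)
  have hcard := finrank_span_eq_card hs'
  have hsub : Submodule.span ℂ (Set.range fun x : s => ((x : wtSpace Q a) : Q)) ≤
      genWeight (xOp (n := n) Q) (fun i => (a i : ℂ)) ⊓ Submodule.span ℂ (u '' (S : Set _)) := by
    rw [Submodule.span_le]
    rintro _ ⟨x, rfl⟩
    refine ⟨x.1.2, Submodule.span_mono (Set.image_mono ?_) (hR (x.1 : Q))⟩
    rintro w ⟨h1, h2⟩
    exact (hmem w).2 ⟨h1, h2.trans (hR0 _ (Finset.mem_image_of_mem _ x.2))⟩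
  have h3 := Submodule.finrank_mono hsub
  rw [hcard, Fintype.card_coe] at h3
  exact h3.trans (key.trans hle)

end Modules

end

/-! ### Which group elements carry the weight `ζ` to a weight bounded below by `b`. -/

section

variable {n : ℕ}

/-! ### Data attached to a sequence of segments -/

/-- The weight `ζ` is a concatenation of segments with weakly decreasing starting values `b`, where
`J j` says that `j` is joined to its predecessor, and the starting values vary by less than `κ`. -/
structure IsSegmented (κ : ℤ) (ζ b : Fin n → ℤ) (J : Fin n → Prop) : Prop where
  anti : Antitone b
  start : ∀ j, ¬J j → ζ j = b j
  first : ∀ j : Fin n, (j : ℕ) = 0 → ¬J j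
  join : ∀ i j : Fin n, (j : ℕ) = i + 1 → J j → ζ j = ζ i + 1 ∧ b j = b i
  gap : ∀ i j, b i < b j + κ

/-- Induction along each segment, starting at its first position. -/
theorem fin_pred_induction {P : Fin n → Prop} (J : Fin n → Prop)
    (h0 : ∀ j : Fin n, (j : ℕ) = 0 → ¬J j) (hs : ∀ j, ¬J j → P j)
    (hj : ∀ i j : Fin n, (j : ℕ) = i + 1 → J j → P i → P j) (j : Fin n) : P j := by
  obtain ⟨j, hjn⟩ := j
  induction j with
  | zero => exact hs _ (h0 _ rfl)
  | succ j ih =>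
    by_cases h : J ⟨j + 1, hjn⟩
    · exact hj ⟨j, by omega⟩ _ rfl h (ih _)
    · exact hs _ h

variable {κ : ℤ} {ζ b : Fin n → ℤ} {J : Fin n → Prop}

theorem IsSegmented.le (h : IsSegmented κ ζ b J) (j : Fin n) : b j ≤ ζ j := by
  refine fin_pred_induction J h.first (fun j hj => (h.start j hj).ge) (fun i j hij hj hi => ?_) j
  have := h.join i j hij hj
  omega

/-- At the start `j` of a segment, `b_j + κ · shift = a(wj) ≥ b(wj) > b_j - κ`, so the shift is
nonnegative; increasing positions pass this on along the segment. Equality of the sums of `a` and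
`ζ` makes all shifts 0, so `w` is a permutation. -/
theorem IsSegmented.admissible (h : IsSegmented κ ζ b J) (hκ : 0 < κ) {a : Fin n → ℤ}
    (ha : ∀ i, b i ≤ a i) (hsum : ∑ i, a i = ∑ i, ζ i) {w : ExtAffineWeyl n} (hw : IsIncr J w)
    (hwa : wtAct κ w ζ = a) :
    (∀ i, shift w i = 0) ∧ (∀ j, b (w.right j) = b j) ∧ ∀ j, a (w.right j) = ζ j := by
  have hval : ∀ j, a (w.right j) = ζ j + κ * shift w (w.right j) := fun j => by
    rw [← hwa, wtAct, perm_inv_apply_self]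
  have hnn : ∀ j, 0 ≤ shift w (w.right j) := by
    refine fin_pred_induction J h.first (fun j hj => ?_) (fun i j hij hj hi => ?_)
    · by_contra hc
      have h1 := hval j
      rw [h.start j hj] at h1
      have h2 := ha (w.right j)
      have h3 := h.gap j (w.right j)
      have : κ * shift w (w.right j) ≤ κ * (-1) := mul_le_mul_of_nonneg_left (by omega) hκ.le
      omega
    · have h1 := hw i j hij hj
      simp only [pos] at h1
      have h2 : 0 ≤ (n : ℤ) * shift w (w.right i) := mul_nonneg (by omega) hi
      have h3 := (w.right j).2
      by_contra hc
      have : (n : ℤ) * shift w (w.right j) ≤ n * (-1) :=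
        mul_le_mul_of_nonneg_left (by omega) (by omega)
      omega
  have hs0 : ∀ i, shift w i = 0 := by
    have h1 : ∑ j, shift w (w.right j) = 0 := by
      have h2 : ∑ j, a (w.right j) = ∑ j, (ζ j + κ * shift w (w.right j)) :=
        Finset.sum_congr rfl fun j _ => hval j
      rw [Equiv.sum_comp w.right a, hsum, Finset.sum_add_distrib, ← Finset.mul_sum] at h2
      have h3 : κ * ∑ j, shift w (w.right j) = 0 := by linarith
      exact (mul_eq_zero.1 h3).resolve_left hκ.ne'
    intro i
    obtain ⟨j, rfl⟩ := w.right.surjective i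
    exact (Finset.sum_eq_zero_iff_of_nonneg fun j _ => hnn j).1 h1 j (Finset.mem_univ j)
  have hval' : ∀ j, a (w.right j) = ζ j := fun j => by rw [hval, hs0]; ring
  refine ⟨hs0, ?_, hval'⟩
  -- The same induction: at a start, `b(wj) ≤ a(wj) = ζ_j = b_j`; along a segment `w` increases and
  -- `b` decreases. Summing over all `j` then turns the inequalities into equalities.
  have hle : ∀ j, b (w.right j) ≤ b j := by
    refine fin_pred_induction J h.first (fun j hj => ?_) (fun i j hij hj hi => ?_)
    · rw [← h.start j hj, ← hval' j]; exact ha _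
    · have h1 := hw i j hij hj
      simp only [pos, hs0] at h1
      have h2 : w.right i ≤ w.right j := by
        rw [Fin.le_def]; omega
      exact (h.anti h2).trans (hi.trans (h.join i j hij hj).2.ge)
  have h1 : ∑ j, b (w.right j) = ∑ j, b j := Equiv.sum_comp w.right b
  intro j
  exact (Finset.sum_eq_sum_iff_of_le fun j _ => hle j).1 h1 j (Finset.mem_univ j)

section Modules

set_option linter.unusedSectionVars false

variable {Q : Type*} [AddCommGroup Q] [Module ℂ Q] [Module (DDAHA n) Q] [IsScalarTower ℂ (DDAHA n) Q]

/-- `Q` is generated by a vector `v` of weight `ζ` and level `κ` that is fixed by the simple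
reflections exchanging joined neighbours. -/
structure IsGenBy (κ : ℤ) (ζ : Fin n → ℤ) (J : Fin n → Prop) (v : Q) : Prop where
  wt : ∀ h : HDot n, ofH h • v = weightFun (fun j => (ζ j : ℂ)) κ h • v
  inv : ∀ i j : Fin n, (j : ℕ) = i + 1 → J j → ofW (reflR (i, j, 0)) • v = v
  gen : ∀ x : Q, ∃ a : DDAHA n, a • v = x

variable {v : Q}

/-- If an admissible `w` places `j` at the first position of a group, then `j` starts a segment,
because a joined predecessor would be placed earlier in the same group. The value there would be
`ζ_j = b_j`. -/
theorem IsGenBy.wtSpace_eq_bot (hg : IsGenBy κ ζ J v) (h : IsSegmented κ ζ b J) (hκ : 0 < κ)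
    {a : Fin n → ℤ} (ha : ∀ i, b i ≤ a i) (hsum : ∑ i, a i = ∑ i, ζ i) {i : Fin n}
    (hi : ∀ i' < i, b i' ≠ b i) (hai : a i ≠ b i) : wtSpace Q a = ⊥ := by
  rw [← Submodule.rank_eq_zero]
  refine le_antisymm ?_ bot_le
  have := rank_wtSpace_le hg.wt hg.inv hg.gen a ∅ (fun w hw hwa => ?_)
  · simpa using this
  · exfalso
    obtain ⟨h1, h2, h3⟩ := h.admissible hκ ha hsum hw hwa
    obtain ⟨j, rfl⟩ := w.right.surjective i
    by_cases hj : J j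
    · obtain ⟨k, hk⟩ : ∃ k : Fin n, (j : ℕ) = k + 1 := by
        have : (j : ℕ) ≠ 0 := fun h0 => h.first j h0 hj
        exact ⟨⟨j - 1, by omega⟩, by simp only; omega⟩
      have h4 := hw k j hk hj
      simp only [pos, h1] at h4
      have h5 : w.right k < w.right j := by rw [Fin.lt_def]; omega
      apply hi _ h5
      rw [h2, h2, (h.join k j hk hj).2]
    · exact hai (by rw [h3, h2, h.start j hj])

-- An admissible `w` is a permutation carrying `(b, a)` to `(b, ζ)`. Such permutations form a coset
-- of the stabilizer of `(b, a)`, or there are none.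
open Nat in
theorem IsGenBy.rank_le (hg : IsGenBy κ ζ J v) (h : IsSegmented κ ζ b J) (hκ : 0 < κ)
    {a : Fin n → ℤ} (ha : ∀ i, b i ≤ a i) (hsum : ∑ i, a i = ∑ i, ζ i) :
    Module.rank ℂ (wtSpace Q a) ≤
      (∏ y ∈ Finset.univ.image fun i => (b i, a i),
        (Fintype.card {i // (b i, a i) = y})! : ℕ) := by
  classical
  set F : Fin n → ℤ × ℤ := fun i => (b i, a i) with hF
  set T : Finset (Equiv.Perm (Fin n)) :=
    Finset.univ.filter fun σ => ∀ j, F (σ j) = (b j, ζ j) with hT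
  have h1 := rank_wtSpace_le hg.wt hg.inv hg.gen a (T.image perm) (fun w hw hwa => by
    obtain ⟨h1, h2, h3⟩ := h.admissible hκ ha hsum hw hwa
    refine Finset.mem_image.2 ⟨w.right, ?_, ?_⟩
    · simp [hT, hF, h2, h3]
    · exact weyl_ext (fun i => by simp [h1]) (fun i => rfl))
  refine h1.trans ?_
  have h2 : (T.image perm).card ≤ T.card := Finset.card_image_le
  have h3 : T.card ≤ ∏ y ∈ Finset.univ.image F, (Fintype.card {i // F i = y})! := by
    have h4 : Fintype.card {g : Equiv.Perm (Fin n) // F ∘ g = F} =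
        ∏ y ∈ Finset.univ.image F, (Fintype.card {i // F i = y})! := by
      exact DomMulAct.stabilizer_card' F
    rw [← h4]
    rcases T.eq_empty_or_nonempty with h0 | ⟨σ0, hσ0⟩
    · simp [h0]
    · rw [Fintype.card_subtype]
      refine Finset.card_le_card_of_injOn (fun σ => σ * σ0⁻¹) (fun σ hσ => ?_)
        (fun σ _ τ _ e => mul_right_cancel e)
      simp only [hT, Finset.coe_filter, Finset.mem_univ, true_and, Set.mem_ofPred_eq,
        Finset.mem_filter] at hσ hσ0 ⊢
      funext i
      obtain ⟨j, rfl⟩ := σ0.surjective i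
      rw [Function.comp_apply, Equiv.Perm.mul_apply, perm_inv_apply_self, hσ, hσ0]
  exact_mod_cast h2.trans h3

end Modules

end

/-! ### Rank one and rank two relations between weight multiplicities. -/

section

/-! ### Local relations between dimensions of weight spaces -/

section Local

set_option linter.unusedSectionVars false

variable {V ι : Type*} [AddCommGroup V] [Module ℂ V]

theorem mapsTo_genWeight {x : ι → Module.End ℂ V} (hx : ∀ i j, Commute (x i) (x j)) (a : ι → ℂ)
    (i : ι) : Set.MapsTo (x i) (genWeight x a) (genWeight x a) := by
  intro v hv
  simp only [genWeight, SetLike.mem_coe, Submodule.mem_iInf] at hv ⊢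
  exact fun j => Module.End.mapsTo_maxGenEigenspace_of_comm (hx j i) _ (hv j)

theorem iSupIndep_genWeight {x : ι → Module.End ℂ V} (hx : ∀ i j, Commute (x i) (x j)) :
    iSupIndep fun a : ι → ℂ => genWeight x a :=
  Module.End.independent_iInf_maxGenEigenspace_of_forall_mapsTo x fun i j φ =>
    Module.End.mapsTo_maxGenEigenspace_of_comm (hx j i) φ

theorem trace_restrict_genWeight {x : ι → Module.End ℂ V} (hx : ∀ i j, Commute (x i) (x j))
    (a : ι → ℂ) [FiniteDimensional ℂ (genWeight x a)] (i : ι) :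
    LinearMap.trace ℂ _ ((x i).restrict (mapsTo_genWeight hx a i)) =
      a i * Module.finrank ℂ (genWeight x a) := by
  set f := (x i).restrict (mapsTo_genWeight hx a i)
  have hnil : IsNilpotent (f - a i • (1 : Module.End ℂ (genWeight x a))) := by
    rw [Module.End.isNilpotent_iff_of_finite]
    rintro ⟨v, hv⟩
    obtain ⟨k, hk⟩ := mem_genWeight.1 hv i
    refine ⟨k, Subtype.ext ?_⟩
    have : ∀ (k : ℕ) (w : genWeight x a), (((f - a i • (1 : Module.End ℂ (genWeight x a))) ^ k) w :
        V) = ((x i - a i • (1 : Module.End ℂ V)) ^ k) w := by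
      intro k
      induction k with
      | zero => intro w; rfl
      | succ k ih => intro w; rw [pow_succ, pow_succ, Module.End.mul_apply, ih]; rfl
    exact (this k ⟨v, hv⟩).trans hk
  have h1 := (LinearMap.isNilpotent_trace_of_isNilpotent hnil).eq_zero
  rw [map_sub, map_smul, LinearMap.trace_one, sub_eq_zero] at h1
  exact h1

theorem trace_restrict_biSup {x : ι → Module.End ℂ V} (hx : ∀ i j, Commute (x i) (x j))
    {τ : Type*} [Fintype τ] {a : τ → ι → ℂ} (ha : Function.Injective a)
    [∀ t, FiniteDimensional ℂ (genWeight x (a t))] {E : Submodule ℂ V}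
    (hE : E = ⨆ t ∈ Finset.univ, genWeight x (a t)) (i : ι) (hiE : Set.MapsTo (x i) E E) :
    LinearMap.trace ℂ E ((x i).restrict hiE) =
      ∑ t, a t i * Module.finrank ℂ (genWeight x (a t)) := by
  have h1 : iSupIndep fun t : (Finset.univ : Finset τ) => genWeight x (a t) :=
    (iSupIndep_genWeight hx).comp (ha.comp Subtype.val_injective)
  rw [LinearMap.trace_eq_sum_trace_restrict_of_eq_biSup Finset.univ h1
    (fun t => mapsTo_genWeight hx (a t) i) E hE hiE]
  exact Finset.sum_congr rfl fun t _ => trace_restrict_genWeight hx (a t) i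

/-- An involution `s` satisfying the cross relations with the operators `x i` and `x j`. -/
structure IsCross (x : ι → Module.End ℂ V) (i j : ι) (s : Module.End ℂ V) : Prop where
  ne : i ≠ j
  sq : s * s = 1
  left : s * x i = x j * s - 1
  right : s * x j = x i * s + 1
  other : ∀ l, l ≠ i → l ≠ j → s * x l = x l * s

variable [DecidableEq ι] {x : ι → Module.End ℂ V} {i j : ι} {s : Module.End ℂ V}

/-- Modulo the weight space, `x_i - a_i` and `x_j - a_j` are exchanged when moved past `s`, because
the constant in the cross relation maps `u` into that space. So a high power sends `s u` into the
weight space, and a further power kills it. -/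
theorem IsCross.mem_of_eq (h : IsCross x i j s) (hx : ∀ i j, Commute (x i) (x j)) {a : ι → ℂ}
    (ha : a i = a j) {u : V} (hu : u ∈ genWeight x a) : s u ∈ genWeight x a := by
  have key : ∀ (i j : ι) (c : ℂ), s * x j = x i * s + c • (1 : Module.End ℂ V) → a i = a j →
      ∃ k, ((x i - a i • (1 : Module.End ℂ V)) ^ k) (s u) = 0 := by
    intro i j c hc ha
    have h1 : ∀ N : ℕ, ((x i - a i • (1 : Module.End ℂ V)) ^ N) (s u) -
        s (((x j - a j • (1 : Module.End ℂ V)) ^ N) u) ∈ genWeight x a := by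
      intro N
      induction N with
      | zero => simp
      | succ N ih =>
        have hst : ∀ l, ∀ w ∈ genWeight x a, (x l - a l • (1 : Module.End ℂ V)) w ∈
            genWeight x a := fun l w hw => by
          simpa using Submodule.sub_mem _ (mapsTo_genWeight hx a l hw)
            (Submodule.smul_mem _ (a l) hw)
        have hpow : ∀ N : ℕ, ((x j - a j • (1 : Module.End ℂ V)) ^ N) u ∈ genWeight x a := by
          intro N
          induction N with
          | zero => simpa using hu
          | succ N ih => rw [pow_succ', Module.End.mul_apply]; exact hst j _ ih
        have h2 := hst i _ ih
        have h3 := Submodule.smul_mem _ c (hpow N)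
        set w := ((x j - a j • (1 : Module.End ℂ V)) ^ N) u
        have h4 := LinearMap.congr_fun hc w
        simp only [Module.End.mul_apply, LinearMap.add_apply, LinearMap.smul_apply,
          Module.End.one_apply] at h4
        convert Submodule.sub_mem _ h2 h3 using 1
        rw [pow_succ', pow_succ', Module.End.mul_apply, Module.End.mul_apply]
        simp only [LinearMap.sub_apply, map_sub, LinearMap.smul_apply, Module.End.one_apply,
          map_smul, w, ha] at h4 ⊢
        rw [h4]
        abel
    obtain ⟨N, hN⟩ := mem_genWeight.1 hu j
    have h2 := h1 N
    rw [hN, map_zero, sub_zero] at h2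
    obtain ⟨M, hM⟩ := mem_genWeight.1 h2 i
    exact ⟨M + N, by rw [pow_add, Module.End.mul_apply, hM]⟩
  refine mem_genWeight.2 fun l => ?_
  by_cases hli : l = i
  · subst hli
    exact key l j 1 (by rw [h.right, one_smul]) ha
  by_cases hlj : l = j
  · subst hlj
    exact key l i (-1) (by rw [h.left, neg_one_smul, sub_eq_add_neg]) ha.symm
  obtain ⟨k, hk⟩ := mem_genWeight.1 hu l
  refine ⟨k, ?_⟩
  have hc : Commute s (x l - a l • (1 : Module.End ℂ V)) :=
    Commute.sub_right (h.other l hli hlj) ((Commute.one_right s).smul_right _)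
  have := LinearMap.congr_fun (hc.pow_right k).eq u
  simp only [Module.End.mul_apply] at this
  rw [← this, hk, map_zero]

/-- On `u` the operators `x_i - (a_j + e)` and `x_j - a_j` have the same powers, so `u` would also
be a generalized eigenvector of `x_i` for `a_j + e ≠ a_i`. -/
theorem eq_zero_of_sub_apply_eq (hx : ∀ i j, Commute (x i) (x j)) {a : ι → ℂ} {u : V}
    (hu : u ∈ genWeight x a) {e : ℂ} (he : a i - a j ≠ e) (h : x i u - x j u = e • u) : u = 0 := by
  have h1 : ∀ k : ℕ, ((x i - (a j + e) • (1 : Module.End ℂ V)) ^ k) u =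
      ((x j - a j • (1 : Module.End ℂ V)) ^ k) u := by
    intro k
    induction k with
    | zero => rfl
    | succ k ih =>
      have hc : Commute (x i - (a j + e) • (1 : Module.End ℂ V))
          ((x j - a j • (1 : Module.End ℂ V)) ^ k) :=
        ((hx i j).sub_left ((Commute.one_left _).smul_left _)).sub_right
          (((Commute.one_right _).smul_right _)) |>.pow_right k
      rw [pow_succ', Module.End.mul_apply, ih, ← Module.End.mul_apply, hc.eq, Module.End.mul_apply,
        pow_succ, Module.End.mul_apply]
      congr 1
      have : x i u = x j u + e • u := by rw [← h]; abel
      simp only [LinearMap.sub_apply, LinearMap.smul_apply, Module.End.one_apply, this]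
      module
  obtain ⟨k, hk⟩ := mem_genWeight.1 hu j
  rw [← h1] at hk
  have h2 : u ∈ (x i).maxGenEigenspace (a j + e) :=
    Module.End.mem_maxGenEigenspace _ _ _ |>.2 ⟨k, hk⟩
  have h3 : u ∈ (x i).maxGenEigenspace (a i) := by
    have := hu
    simp only [genWeight, Submodule.mem_iInf] at this
    exact this i
  have h4 := Module.End.disjoint_genEigenspace (x i) (μ₁ := a i) (μ₂ := a j + e)
    (fun h => he (by rw [h]; ring)) ⊤ ⊤
  exact (Submodule.disjoint_def.1 h4) u h3 h2

/-- The standard intertwiner `s(x_i - x_j) + 1` exchanges `x_i` with `x_j` and commutes with the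
other operators. -/
theorem IsCross.intertwine (h : IsCross x i j s) (hx : ∀ i j, Commute (x i) (x j)) {a : ι → ℂ}
    {u : V} (hu : u ∈ genWeight x a) :
    (s * (x i - x j) + 1) u ∈ genWeight x (a ∘ Equiv.swap i j) := by
  set z := s * (x i - x j) + 1 with hz
  have hyc : ∀ l, (x i - x j) * x l = x l * (x i - x j) := fun l =>
    ((hx i l).sub_left (hx j l)).eq
  have h1 : z * x i = x j * z := by
    rw [hz, add_mul, mul_assoc, hyc, ← mul_assoc, h.left, mul_add, ← mul_assoc, sub_mul]
    noncomm_ring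
  have h2 : z * x j = x i * z := by
    rw [hz, add_mul, mul_assoc, hyc, ← mul_assoc, h.right, mul_add, ← mul_assoc, add_mul]
    noncomm_ring
  have h3 : ∀ l, z * x l = x (Equiv.swap i j l) * z := by
    intro l
    by_cases hli : l = i
    · subst hli; simpa using h1
    by_cases hlj : l = j
    · subst hlj; simpa using h2
    rw [Equiv.swap_apply_of_ne_of_ne hli hlj, hz, add_mul, mul_assoc, hyc, ← mul_assoc,
      h.other l hli hlj, mul_add, ← mul_assoc, one_mul, mul_one]
  have h4 : ∀ l (k : ℕ), z * (x l - a l • (1 : Module.End ℂ V)) ^ k =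
      (x (Equiv.swap i j l) - a l • (1 : Module.End ℂ V)) ^ k * z := by
    intro l k
    induction k with
    | zero => simp
    | succ k ih =>
      rw [pow_succ, ← mul_assoc, ih, mul_assoc, mul_sub, h3, pow_succ, mul_assoc, sub_mul]
      simp
  refine mem_genWeight.2 fun l => ?_
  obtain ⟨k, hk⟩ := mem_genWeight.1 hu (Equiv.swap i j l)
  refine ⟨k, ?_⟩
  have := LinearMap.congr_fun (h4 (Equiv.swap i j l) k) u
  rw [Module.End.mul_apply, hk, map_zero, Equiv.swap_apply_self, Module.End.mul_apply] at this
  exact this.symm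

/-- For `a_i ≠ a_j` the operator `x_i - x_j` is invertible on the weight space, so `s` can be
recovered from the intertwiner. -/
theorem IsCross.mem_sup (h : IsCross x i j s) (hx : ∀ i j, Commute (x i) (x j)) {a : ι → ℂ}
    [FiniteDimensional ℂ (genWeight x a)] {u : V} (hu : u ∈ genWeight x a) :
    s u ∈ genWeight x a ⊔ genWeight x (a ∘ Equiv.swap i j) := by
  by_cases ha : a i = a j
  · exact Submodule.mem_sup_left (h.mem_of_eq hx ha hu)
  have hm : Set.MapsTo (x i - x j) (genWeight x a) (genWeight x a) := fun w hw =>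
    Submodule.sub_mem _ (mapsTo_genWeight hx a i hw) (mapsTo_genWeight hx a j hw)
  have hinj : Function.Injective ((x i - x j).restrict hm) := by
    rw [← LinearMap.ker_eq_bot, LinearMap.ker_eq_bot']
    rintro ⟨w, hw⟩ h0
    refine Subtype.ext (eq_zero_of_sub_apply_eq hx hw (e := 0) (sub_ne_zero.2 ha) ?_)
    rw [zero_smul]
    exact congrArg Subtype.val h0
  obtain ⟨⟨w, hw⟩, hwu⟩ := (LinearMap.injective_iff_surjective.1 hinj) ⟨u, hu⟩
  have hwu' : (x i - x j) w = u := congrArg Subtype.val hwu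
  have h1 := h.intertwine hx hw
  rw [LinearMap.add_apply, Module.End.mul_apply, hwu', Module.End.one_apply] at h1
  have h2 := Submodule.sub_mem _ (Submodule.mem_sup_right (S := genWeight x a) h1)
    (Submodule.mem_sup_left hw)
  simpa using h2

/-- The intertwiner has square `1 - (x_i - x_j)²`, which is injective on the weight space when `a_i
- a_j ≠ ±1`. -/
theorem IsCross.finrank_le (h : IsCross x i j s) (hx : ∀ i j, Commute (x i) (x j)) {a : ι → ℂ}
    [FiniteDimensional ℂ (genWeight x (a ∘ Equiv.swap i j))]
    (h1 : a i - a j ≠ 1) (h2 : a i - a j ≠ -1) :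
    Module.finrank ℂ (genWeight x a) ≤ Module.finrank ℂ (genWeight x (a ∘ Equiv.swap i j)) := by
  refine LinearMap.finrank_le_finrank_of_injective
    (f := (s * (x i - x j) + 1).restrict fun u hu => h.intertwine hx hu) ?_
  rw [← LinearMap.ker_eq_bot, LinearMap.ker_eq_bot']
  rintro ⟨u, hu⟩ h0
  have h0' : (s * (x i - x j) + 1) u = 0 := congrArg Subtype.val h0
  have hy : s * (x i - x j) = -((x i - x j) * s) - (1 + 1) := by
    rw [mul_sub, h.left, h.right]; noncomm_ring
  have hsq : (s * (x i - x j) + 1) * (s * (x i - x j) + 1) =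
      1 - (x i - x j) * (x i - x j) := by
    have e : s * (x i - x j) * (s * (x i - x j)) =
        -((x i - x j) * (x i - x j)) - (s * (x i - x j) + s * (x i - x j)) := by
      nth_rewrite 1 [hy]
      rw [sub_mul, add_mul, one_mul, neg_mul, mul_assoc, ← mul_assoc s s, h.sq, one_mul]
    rw [add_mul, mul_add, e]
    noncomm_ring
  have h3 : u - (x i - x j) ((x i - x j) u) = 0 := by
    have := LinearMap.congr_fun hsq u
    rw [Module.End.mul_apply, h0', map_zero] at this
    simpa using this.symm
  set w := u + (x i - x j) u with hw
  have hwm : w ∈ genWeight x a := Submodule.add_mem _ hu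
    (Submodule.sub_mem _ (mapsTo_genWeight hx a i hu) (mapsTo_genWeight hx a j hu))
  have hw0 : w = 0 := by
    refine eq_zero_of_sub_apply_eq hx hwm h1 ?_
    rw [← LinearMap.sub_apply, one_smul, hw, map_add, ← sub_eq_zero.1 h3, add_comm]
  refine Subtype.ext (eq_zero_of_sub_apply_eq hx hu h2 ?_)
  rw [← LinearMap.sub_apply, neg_one_smul]
  exact eq_neg_of_add_eq_zero_right hw0

theorem IsCross.symm (h : IsCross x i j s) (hx : ∀ i j, Commute (x i) (x j)) {a : ι → ℂ}
    [FiniteDimensional ℂ (genWeight x a)] [FiniteDimensional ℂ (genWeight x (a ∘ Equiv.swap i j))]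
    (h1 : a i - a j ≠ 1) (h2 : a i - a j ≠ -1) :
    Module.finrank ℂ (genWeight x (a ∘ Equiv.swap i j)) = Module.finrank ℂ (genWeight x a) := by
  refine le_antisymm ?_ (h.finrank_le hx h1 h2)
  have e : (a ∘ Equiv.swap i j) ∘ Equiv.swap i j = a := by
    funext l; simp
  have : FiniteDimensional ℂ (genWeight x ((a ∘ Equiv.swap i j) ∘ Equiv.swap i j)) := by
    rw [e]; infer_instance
  have := h.finrank_le hx (a := a ∘ Equiv.swap i j)
    (by simp; exact fun h => h2 (by rw [← h]; ring)) (by simp; exact fun h => h1 (by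
      rw [← neg_sub, h, neg_neg]))
  rwa [e] at this

/-- The relations give `(y₁ - y₂) + s(y₁ - y₂)s = -2s`, and conjugation by the involution `s`
preserves the trace. -/
theorem trace_of_cross {F : Type*} [AddCommGroup F] [Module ℂ F] {s y₁ y₂ : Module.End ℂ F}
    (hs : s * s = 1) (h1 : s * y₁ = y₂ * s - 1) (h2 : s * y₂ = y₁ * s + 1) :
    LinearMap.trace ℂ F s = LinearMap.trace ℂ F y₂ - LinearMap.trace ℂ F y₁ := by
  have h3 : (y₁ - y₂) + s * (y₁ - y₂) * s = -(2 : ℂ) • s := by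
    rw [mul_sub, h1, h2, sub_mul, sub_mul, mul_assoc, hs, add_mul, mul_assoc, hs]
    rw [neg_smul, two_smul]
    noncomm_ring
  have h4 := congrArg (LinearMap.trace ℂ F) h3
  have h5 : LinearMap.trace ℂ F (s * (y₁ - y₂) * s) = LinearMap.trace ℂ F (y₁ - y₂) := by
    rw [LinearMap.trace_mul_comm, ← mul_assoc, hs, one_mul]
  rw [map_add, h5, map_smul, map_sub, smul_eq_mul] at h4
  linear_combination (1 / 2) * h4

/-- The relation on dimensions of weight spaces that reflects the Serre relation. -/
theorem finrank_serre {k : ι} {s' : Module.End ℂ V} (h : IsCross x i j s) (h' : IsCross x j k s')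
    (hik : i ≠ k) (hbraid : s * s' * s = s' * s * s') (hx : ∀ i j, Commute (x i) (x j))
    {a : ι → ℂ} (hij : a i = a j) (hjk : a j ≠ a k)
    [FiniteDimensional ℂ (genWeight x a)] [FiniteDimensional ℂ (genWeight x (a ∘ Equiv.swap j k))]
    [FiniteDimensional ℂ (genWeight x (a ∘ Equiv.swap j k ∘ Equiv.swap i j))] :
    Module.finrank ℂ (genWeight x a) +
      Module.finrank ℂ (genWeight x (a ∘ Equiv.swap j k ∘ Equiv.swap i j)) =
      2 * Module.finrank ℂ (genWeight x (a ∘ Equiv.swap j k)) := by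
  have hne := h.ne
  have hne' := h'.ne
  set b := a ∘ Equiv.swap j k with hb
  set c := a ∘ Equiv.swap j k ∘ Equiv.swap i j with hc
  have bi : b i = a i := by simp [hb, Equiv.swap_apply_of_ne_of_ne hne hik]
  have bj : b j = a k := by simp [hb]
  have bk : b k = a j := by simp [hb]
  have ci : c i = a k := by simp [hc]
  have cj : c j = a i := by simp [hc, Equiv.swap_apply_of_ne_of_ne hne hik]
  have ck : c k = a j := by simp [hc, Equiv.swap_apply_of_ne_of_ne hik.symm hne'.symm]
  let t : Fin 3 → ι → ℂ := ![a, b, c]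
  have hfd : ∀ m, FiniteDimensional ℂ (genWeight x (t m)) := by
    intro m
    fin_cases m <;> (simp only [t]; assumption)
  have ht : Function.Injective t := by
    have hab : a ≠ b := fun e => hjk (by rw [← bj, ← e])
    have hac : a ≠ c := fun e => hjk (by rw [← ci, ← e, hij])
    have hbc : b ≠ c := fun e => hjk (by rw [← hij, ← bi, e, ci])
    intro m m'
    fin_cases m <;> fin_cases m' <;> simp [t, hab, hac, hbc, hab.symm, hac.symm, hbc.symm]
  -- For `a = (α, α, γ)` the three arrangements of these values span a space stable under both `s`
  -- and `s'`.
  set E : Submodule ℂ V := ⨆ m ∈ Finset.univ, genWeight x (t m) with hE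
  have hEa : ∀ m, genWeight x (t m) ≤ E := fun m =>
    le_iSup₂_of_le (f := fun m _ => genWeight x (t m)) m (Finset.mem_univ m) le_rfl
  have hstab : ∀ f : Module.End ℂ V, (∀ m, ∀ u ∈ genWeight x (t m), f u ∈ E) →
      Set.MapsTo f E E := by
    intro f hf
    have : E ≤ E.comap f := iSup₂_le fun m _ => hf m
    exact this
  have hxE : ∀ l, Set.MapsTo (x l) E E := fun l =>
    hstab _ fun m _ hu => hEa m (mapsTo_genWeight hx (t m) l hu)
  have hsE : Set.MapsTo s E E := by
    refine hstab s fun m u hu => ?_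
    have hh := h.mem_sup hx hu
    fin_cases m
    · exact hEa 0 (h.mem_of_eq hx hij hu)
    · exact (sup_le (hEa 1) (hEa 2)) hh
    · have e : c ∘ Equiv.swap i j = b := by funext l; simp [hb, hc]
      change s u ∈ genWeight x c ⊔ genWeight x (c ∘ Equiv.swap i j) at hh
      rw [e] at hh
      exact (sup_le (hEa 2) (hEa 1)) hh
  have hsE' : Set.MapsTo s' E E := by
    refine hstab s' fun m u hu => ?_
    have hh := h'.mem_sup hx hu
    fin_cases m
    · exact (sup_le (hEa 0) (hEa 1)) hh
    · have e : b ∘ Equiv.swap j k = a := by funext l; simp [hb]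
      change s' u ∈ genWeight x b ⊔ genWeight x (b ∘ Equiv.swap j k) at hh
      rw [e] at hh
      exact (sup_le (hEa 1) (hEa 0)) hh
    · exact hEa 2 (h'.mem_of_eq hx (show c j = c k by rw [cj, ck, hij]) hu)
  set S := s.restrict hsE
  set S' := s'.restrict hsE'
  let Y := fun l => (x l).restrict (hxE l)
  have htr1 : LinearMap.trace ℂ E S = LinearMap.trace ℂ E (Y j) - LinearMap.trace ℂ E (Y i) :=
    trace_of_cross (LinearMap.ext fun u => Subtype.ext (LinearMap.congr_fun h.sq u))
      (LinearMap.ext fun u => Subtype.ext (LinearMap.congr_fun h.left u))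
      (LinearMap.ext fun u => Subtype.ext (LinearMap.congr_fun h.right u))
  have hS'2 : S' * S' = 1 := LinearMap.ext fun u => Subtype.ext (LinearMap.congr_fun h'.sq u)
  have hS2 : S * S = 1 := LinearMap.ext fun u => Subtype.ext (LinearMap.congr_fun h.sq u)
  have htr2 : LinearMap.trace ℂ E S' = LinearMap.trace ℂ E (Y k) - LinearMap.trace ℂ E (Y j) :=
    trace_of_cross hS'2
      (LinearMap.ext fun u => Subtype.ext (LinearMap.congr_fun h'.left u))
      (LinearMap.ext fun u => Subtype.ext (LinearMap.congr_fun h'.right u))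
  have hbr : S * S' * S = S' * S * S' :=
    LinearMap.ext fun u => Subtype.ext (LinearMap.congr_fun hbraid u)
  -- The braid relation makes the two involutions conjugate. Writing both traces through those of
  -- the `x` operators gives `(α - γ)(dim a + dim c - 2 dim b) = 0`.
  have htr3 : LinearMap.trace ℂ E S = LinearMap.trace ℂ E S' := by
    have h1 : LinearMap.trace ℂ E (S * S' * S) = LinearMap.trace ℂ E S' := by
      rw [LinearMap.trace_mul_comm, ← mul_assoc, hS2, one_mul]
    have h2 : LinearMap.trace ℂ E (S' * S * S') = LinearMap.trace ℂ E S := by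
      rw [LinearMap.trace_mul_comm, ← mul_assoc, hS'2, one_mul]
    rw [← h1, hbr, h2]
  have htrx := fun l => trace_restrict_biSup hx ht hE l (hxE l)
  rw [htr1, htr2, htrx, htrx, htrx] at htr3
  simp only [Fin.sum_univ_three] at htr3
  change (a j * _ + b j * _ + c j * _) - (a i * _ + b i * _ + c i * _) =
    (a k * _ + b k * _ + c k * _) - (a j * _ + b j * _ + c j * _) at htr3
  rw [bi, bj, bk, ci, cj, ck, hij] at htr3
  change (a j * (Module.finrank ℂ (genWeight x a) : ℂ) + a k * (Module.finrank ℂ (genWeight x b) : ℂ)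
    + a j * (Module.finrank ℂ (genWeight x c) : ℂ)) - (a j * (Module.finrank ℂ (genWeight x a) : ℂ)
    + a j * (Module.finrank ℂ (genWeight x b) : ℂ) + a k * (Module.finrank ℂ (genWeight x c) : ℂ)) =
    (a k * (Module.finrank ℂ (genWeight x a) : ℂ) + a j * (Module.finrank ℂ (genWeight x b) : ℂ)
    + a j * (Module.finrank ℂ (genWeight x c) : ℂ)) - (a j * (Module.finrank ℂ (genWeight x a) : ℂ)
    + a k * (Module.finrank ℂ (genWeight x b) : ℂ) + a j * (Module.finrank ℂ (genWeight x c) : ℂ))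
    at htr3
  have hfin : (a j - a k) * ((Module.finrank ℂ (genWeight x a) : ℂ) +
      (Module.finrank ℂ (genWeight x c) : ℂ) - 2 * (Module.finrank ℂ (genWeight x b) : ℂ)) = 0 := by
    linear_combination htr3
  have := sub_eq_zero.1 ((mul_eq_zero.1 hfin).resolve_left (sub_ne_zero.2 hjk))
  exact_mod_cast this

end Local

end

/-! ### Rigidity of functions on words subject to the Serre relations. -/

section

/-! ### Functions on words satisfying Serre relations -/

/-- A function on words in `0, 1, 2, …` that satisfies the Serre relations and vanishes on the words
whose last letter is not `0`. -/
structure IsSerre (g : List ℕ → ℤ) : Prop where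
  comm : ∀ p i j q, i + 2 ≤ j → g (p ++ i :: j :: q) = g (p ++ j :: i :: q)
  serre : ∀ p i j q, j = i + 1 ∨ i = j + 1 →
    g (p ++ i :: i :: j :: q) + g (p ++ j :: i :: i :: q) = 2 * g (p ++ i :: j :: i :: q)
  last : ∀ p i, i ≠ 0 → g (p ++ [i]) = 0

/-- Fixing a prefix preserves the axioms, which lets the induction on length be applied to tails. -/
theorem IsSerre.cons {g : List ℕ → ℤ} (hg : IsSerre g) (r : ℕ) : IsSerre fun v => g (r :: v) :=
  ⟨fun p => hg.comm (r :: p), fun p => hg.serre (r :: p), fun p => hg.last (r :: p)⟩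

theorem IsSerre.comm' {g : List ℕ → ℤ} (hg : IsSerre g) (i j : ℕ) (q : List ℕ)
    (h : i + 2 ≤ j ∨ j + 2 ≤ i) : g (i :: j :: q) = g (j :: i :: q) := by
  rcases h with h | h
  · exact hg.comm [] i j q h
  · exact (hg.comm [] j i q h).symm

/-- The multiplicity with which a letter can be added to a word. -/
def letterMult (i : ℕ) (v : List ℕ) : ℤ :=
  if i = 0 then 1 else (v.count (i - 1) : ℤ) - v.count i

/-- The product of the multiplicities of the letters of a word, read from the right. -/
def wordMult : List ℕ → ℤ
  | [] => 1
  | i :: v => wordMult v * letterMult i v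

/-- The letters of the word occur with weakly decreasing multiplicities. -/
def IsPart (v : List ℕ) : Prop := ∀ l, v.count (l + 1) ≤ v.count l

theorem count_cons' (a l : ℕ) (v : List ℕ) :
    (a :: v).count l = v.count l + if a = l then 1 else 0 := by
  rw [List.count_cons]; simp

theorem IsPart.perm {v w : List ℕ} (h : IsPart v) (hvw : v.Perm w) : IsPart w := fun l => by
  rw [← hvw.count_eq, ← hvw.count_eq]; exact h l

theorem letterMult_perm {v w : List ℕ} (h : v.Perm w) (i : ℕ) : letterMult i v = letterMult i w := by
  simp only [letterMult, h.count_eq]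

theorem isPart_of_wordMult_ne {v : List ℕ} (h : wordMult v ≠ 0) : IsPart v := by
  induction v with
  | nil => intro l; simp
  | cons i v ih =>
    simp only [wordMult, mul_ne_zero_iff] at h
    have hv := ih h.1
    have hm := h.2
    intro l
    have h1 := hv l
    rw [count_cons', count_cons']
    simp only [letterMult] at hm
    rcases Nat.eq_zero_or_pos i with h0 | h0
    · subst h0
      rw [if_neg (by omega)]
      omega
    · rw [if_neg (by omega)] at hm
      by_cases hl : i = l + 1
      · subst hl
        simp at hm ⊢
        omega
      · rw [if_neg hl]; omega

theorem letterMult_ne {i : ℕ} {v : List ℕ} (h : IsPart (i :: v)) : letterMult i v ≠ 0 := by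
  rcases Nat.eq_zero_or_pos i with h0 | h0
  · subst h0; simp [letterMult]
  · have h1 := h (i - 1)
    rw [Nat.sub_add_cancel h0, count_cons', count_cons', if_pos rfl, if_neg (by omega)] at h1
    rw [letterMult, if_neg (by omega)]
    omega

theorem wordMult_cons_ne {i : ℕ} {v : List ℕ} (h : IsPart (i :: v)) (hv : wordMult v ≠ 0) :
    wordMult (i :: v) ≠ 0 := mul_ne_zero hv (letterMult_ne h)

theorem IsPart.erase_max {v : List ℕ} (h : IsPart v) {r : ℕ} {x : List ℕ} (hv : v.Perm (r :: x))
    (hmax : ∀ l ∈ v, l ≤ r) : IsPart x := by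
  intro l
  have h1 := h l
  rw [hv.count_eq, hv.count_eq, count_cons', count_cons'] at h1
  by_cases hl : r = l
  · have : (r :: x).count (l + 1) = 0 := by
      rw [← hv.count_eq]
      exact List.count_eq_zero.2 fun hmem => by have := hmax _ hmem; omega
    rw [count_cons'] at this
    omega
  · rw [if_neg hl] at h1; omega

theorem exists_max {v : List ℕ} (hv : v ≠ []) :
    ∃ r x, v.Perm (r :: x) ∧ ∀ l ∈ v, l ≤ r := by
  obtain ⟨r, hr⟩ : ∃ r : ℕ, v.maximum = (r : WithBot ℕ) := by
    have := List.maximum_ne_bot_of_ne_nil hv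
    exact ⟨_, (WithBot.coe_unbot _ this).symm⟩
  exact ⟨r, v.erase r, List.perm_cons_erase (List.maximum_mem hr),
    fun l hl => List.le_maximum_of_mem hl hr⟩

/-- Put a largest letter in front and recurse: removing it keeps the counts weakly decreasing. -/
theorem exists_wordMult_ne {v : List ℕ} (h : IsPart v) : ∃ w, v.Perm w ∧ wordMult w ≠ 0 := by
  induction hm : v.length generalizing v with
  | zero => exact ⟨[], by rw [List.length_eq_zero_iff.1 hm], by simp [wordMult]⟩
  | succ m ih =>
    obtain ⟨r, x, hx, hmax⟩ := exists_max (v := v) (by rintro rfl; simp at hm)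
    have hlen := hx.length_eq
    rw [List.length_cons, hm] at hlen
    obtain ⟨w, hw, hw0⟩ := ih (h.erase_max hx hmax) (by omega)
    have hp := hx.trans (hw.cons r)
    exact ⟨r :: w, hp, wordMult_cons_ne (h.perm hp) hw0⟩

theorem exists_perm_cons_cons {v : List ℕ} {a b : ℕ} (hab : a ≠ b) (ha : 0 < v.count a)
    (hb : 0 < v.count b) : ∃ x, v.Perm (a :: b :: x) := by
  have h1 := List.perm_cons_erase (List.count_pos_iff.1 ha)
  rw [h1.count_eq, count_cons', if_neg hab, add_zero] at hb
  exact ⟨_, h1.trans ((List.perm_cons_erase (List.count_pos_iff.1 hb)).cons a)⟩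

/-- The statement proved by induction on the length of the word. -/
def SerreRigid (v : List ℕ) : Prop :=
  ∀ g, IsSerre g → (¬IsPart v → g v = 0) ∧
    ∀ v', v.Perm v' → wordMult v' * g v = wordMult v * g v'

theorem SerreRigid.eq_zero {v : List ℕ} (h : SerreRigid v) (hv : wordMult v = 0) {g : List ℕ → ℤ}
    (hg : IsSerre g) : g v = 0 := by
  by_cases hp : IsPart v
  · obtain ⟨w, hw, hw0⟩ := exists_wordMult_ne hp
    have := (h g hg).2 w hw
    rw [hv, zero_mul] at this
    exact (mul_eq_zero.1 this).resolve_left hw0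
  · exact (h g hg).1 hp

/-- The nontrivial case has `w` with decreasing counts and as many letters `i - 1` as `i`. Then `w`
may be rearranged conveniently, after which one relation moves `i` into a shorter tail whose counts
are not decreasing. -/
theorem serreRigid_notPart {m : ℕ} (ih : ∀ v : List ℕ, v.length ≤ m → SerreRigid v) {i : ℕ}
    {w : List ℕ} (hw : w.length = m) {g : List ℕ → ℤ} (hg : IsSerre g) (hp : ¬IsPart (i :: w)) :
    g (i :: w) = 0 := by
  by_cases hpw : IsPart w
  swap
  · exact (ih w hw.le _ (hg.cons i)).1 hpw
  have hi : 1 ≤ i ∧ w.count (i - 1) = w.count i := by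
    by_contra hc
    apply hp
    intro l
    have h1 := hpw l
    have h2 := hpw (i - 1)
    rw [count_cons', count_cons']
    by_cases hl : i = l + 1
    · subst hl
      simp only [Nat.add_sub_cancel] at hc h2
      rw [if_pos rfl, if_neg (by omega)]
      omega
    · rw [if_neg hl]; omega
  obtain ⟨hi1, hc⟩ := hi
  -- By induction `g (i :: ·)` is proportional to `wordMult` on rearrangements of `w`, so vanishing
  -- at one `w1` with nonzero multiplicity suffices.
  have suff : ∀ w1, w.Perm w1 → wordMult w1 ≠ 0 → g (i :: w1) = 0 → g (i :: w) = 0 := by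
    intro w1 h1 h2 h3
    have := (ih w hw.le _ (hg.cons i)).2 w1 h1
    rw [h3, mul_zero] at this
    exact (mul_eq_zero.1 this).resolve_left h2
  by_cases hnil : w = []
  · subst hnil; exact hg.last [] i (by omega)
  obtain ⟨r, x, hx, hmax⟩ := exists_max hnil
  have hrw : 0 < w.count r := by rw [hx.count_eq, count_cons', if_pos rfl]; omega
  have hbig : ∀ l, r < l → w.count l = 0 := fun l hl =>
    List.count_eq_zero.2 fun hmem => by have := hmax _ hmem; omega
  -- The largest letter `r` of `w` commutes with `i`: move it to the front.
  by_cases hfar : r + 2 ≤ i ∨ i + 2 ≤ r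
  · obtain ⟨x', hx', hx0⟩ := exists_wordMult_ne (hpw.erase_max hx hmax)
    have hp1 := hx.trans (hx'.cons r)
    refine suff _ hp1 (wordMult_cons_ne (hpw.perm hp1) hx0) ?_
    rw [hg.comm' i r x' hfar.symm]
    have hlen := hp1.length_eq
    refine (ih (i :: x') (by simp at hlen ⊢; omega) _ (hg.cons r)).1 fun h => ?_
    have h1 := h (i - 1)
    rw [hp1.count_eq, hp1.count_eq, count_cons', count_cons', if_neg (by omega),
      if_neg (by omega)] at hc
    rw [Nat.sub_add_cancel hi1, count_cons', count_cons', if_pos rfl, if_neg (by omega)] at h1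
    omega
  have hr1 : r ≠ i - 1 := fun h => by
    have := hbig i (by omega)
    rw [← h] at hc
    omega
  have hci : 0 < w.count i := by
    have h1 := hpw i
    have : r = i ∨ r = i + 1 := by omega
    rcases this with rfl | rfl <;> omega
  -- Rearrange `w` as `i, i-1, x`. In the Serre relation for `i, i, i-1` both outer terms contain
  -- the tail `i :: x'`, where `i` is too frequent.
  by_cases hB : w.count (i + 1) < w.count i
  · obtain ⟨x, hx⟩ := exists_perm_cons_cons (v := w) (a := i) (b := i - 1) (by omega) hci (by omega)
    have hcount : ∀ l, w.count l = x.count l + (if i - 1 = l then 1 else 0) +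
        if i = l then 1 else 0 := fun l => by rw [hx.count_eq, count_cons', count_cons']
    have hpx : IsPart x := by
      intro l
      have h1 := hpw l
      by_cases h2 : l = i - 1
      · subst h2
        rw [Nat.sub_add_cancel hi1] at h1 ⊢
        have h3 := hcount i
        have h4 := hcount (i - 1)
        rw [if_neg (by omega), if_pos rfl] at h3
        rw [if_pos rfl, if_neg (by omega)] at h4
        omega
      by_cases h2 : l = i
      · subst h2
        have h3 := hcount l
        have h4 := hcount (l + 1)
        rw [if_neg (by omega), if_pos rfl] at h3
        rw [if_neg (by omega), if_neg (by omega)] at h4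
        omega
      · have h3 := hcount l
        have h4 := hcount (l + 1)
        rw [if_neg (by omega), if_neg (by omega)] at h3
        omega
    obtain ⟨x', hx', hx0⟩ := exists_wordMult_ne hpx
    have hp1 := hx.trans ((hx'.cons (i - 1)).cons i)
    have hcount' : ∀ l, w.count l = x'.count l + (if i - 1 = l then 1 else 0) +
        if i = l then 1 else 0 := fun l => by rw [hp1.count_eq, count_cons', count_cons']
    have e1 := hcount' i
    have e2 := hcount' (i - 1)
    rw [if_neg (by omega), if_pos rfl] at e1
    rw [if_pos rfl, if_neg (by omega)] at e2
    have hp2 : IsPart ((i - 1) :: x') := by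
      intro l
      have h1 := hpw l
      have h2 := (hpx.perm hx') l
      rw [count_cons', count_cons']
      by_cases h3 : i - 1 = l + 1
      · have h4 := hcount' l
        have h5 := hcount' (l + 1)
        rw [if_neg (by omega), if_neg (by omega)] at h4
        rw [if_pos h3, if_neg (by omega)] at h5
        rw [if_pos h3, if_neg (by omega)]
        omega
      · rw [if_neg h3]; omega
    have hlen := hp1.length_eq
    have hz : ∀ g, IsSerre g → g (i :: x') = 0 := fun g hg => by
      refine (ih (i :: x') (by simp at hlen ⊢; omega) g hg).1 fun h => ?_
      have h1 := h (i - 1)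
      rw [Nat.sub_add_cancel hi1, count_cons', count_cons', if_pos rfl, if_neg (by omega)] at h1
      omega
    refine suff _ hp1 (wordMult_cons_ne (hpw.perm hp1) (wordMult_cons_ne hp2 hx0)) ?_
    have hs := hg.serre [] i (i - 1) x' (Or.inr (by omega))
    have z1 := hz _ ((hg.cons (i - 1)).cons i)
    have z2 := hz _ ((hg.cons i).cons (i - 1))
    simp only [List.nil_append] at hs
    rw [z1, z2] at hs
    linarith
  -- Now `i+1` and `i` are equally frequent and `w` is rearranged as `i+1, i, x`. The outer terms of
  -- the Serre relation have tails `i, i, x'` with too many `i`, and `i+1, x'` with too many `i+1`.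
  · have hr : r = i + 1 := by
      by_contra h
      have := hbig (i + 1) (by omega)
      omega
    subst hr
    have hcj : w.count (i + 1) = w.count i := le_antisymm (hpw i) (by omega)
    obtain ⟨x, hx⟩ := exists_perm_cons_cons (v := w) (a := i + 1) (b := i) (by omega) hrw hci
    have hcount : ∀ l, w.count l = x.count l + (if i = l then 1 else 0) +
        if i + 1 = l then 1 else 0 := fun l => by rw [hx.count_eq, count_cons', count_cons']
    have hpx : IsPart x := by
      intro l
      have h1 := hpw l
      have h3 := hcount l
      have h4 := hcount (l + 1)
      by_cases h2 : l = i
      · subst h2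
        rw [if_pos rfl, if_neg (by omega)] at h3
        rw [if_neg (by omega), if_pos rfl] at h4
        omega
      by_cases h5 : l = i + 1
      · subst h5
        have := hbig (i + 1 + 1) (by omega)
        omega
      · rw [if_neg (by omega), if_neg (by omega)] at h3
        omega
    obtain ⟨x', hx', hx0⟩ := exists_wordMult_ne hpx
    have hp1 := hx.trans ((hx'.cons i).cons (i + 1))
    have hcount' : ∀ l, w.count l = x'.count l + (if i = l then 1 else 0) +
        if i + 1 = l then 1 else 0 := fun l => by rw [hp1.count_eq, count_cons', count_cons']
    have e1 := hcount' i
    have e2 := hcount' (i + 1)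
    have e3 := hcount' (i - 1)
    rw [if_pos rfl, if_neg (by omega)] at e1
    rw [if_neg (by omega), if_pos rfl] at e2
    rw [if_neg (by omega), if_neg (by omega)] at e3
    have hp2 : IsPart (i :: x') := by
      intro l
      have h2 := (hpx.perm hx') l
      rw [count_cons', count_cons']
      by_cases h3 : i = l + 1
      · subst h3
        simp only [Nat.add_sub_cancel] at hc e3
        rw [if_pos rfl, if_neg (by omega)]
        omega
      · rw [if_neg h3]; omega
    have hlen := hp1.length_eq
    have z1 : g ((i + 1) :: i :: i :: x') = 0 := by
      refine (ih (i :: i :: x') (by simp at hlen ⊢; omega) _ (hg.cons (i + 1))).1 fun h => ?_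
      have h1 := h (i - 1)
      rw [Nat.sub_add_cancel hi1, count_cons', count_cons', count_cons', count_cons', if_pos rfl,
        if_neg (by omega)] at h1
      omega
    have z2 : g (i :: i :: (i + 1) :: x') = 0 := by
      refine (ih ((i + 1) :: x') (by simp at hlen ⊢; omega) _ ((hg.cons i).cons i)).1 fun h => ?_
      have h1 := h i
      rw [count_cons', count_cons', if_pos rfl, if_neg (by omega)] at h1
      omega
    refine suff _ hp1 (wordMult_cons_ne (hpw.perm hp1) (wordMult_cons_ne hp2 hx0)) ?_
    have hs := hg.serre [] i (i + 1) x' (Or.inl rfl)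
    simp only [List.nil_append] at hs
    rw [z1, z2] at hs
    linarith

theorem letterMult_cons_of_ne {i a : ℕ} (v : List ℕ) (h1 : a ≠ i) (h2 : a + 1 ≠ i) :
    letterMult i (a :: v) = letterMult i v := by
  rcases Nat.eq_zero_or_pos i with h0 | h0
  · subst h0; simp [letterMult]
  · simp only [letterMult, count_cons']
    rw [if_neg (by omega), if_neg (by omega), if_neg (by omega), if_neg (by omega)]
    simp

theorem letterMult_succ_cons (i : ℕ) (v : List ℕ) :
    letterMult (i + 1) (i :: v) = letterMult (i + 1) v + 1 := by
  simp [letterMult]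
  ring

/-- Both tails are compared, by induction, with `j :: x'` and `i :: x'`; the commutation relation
connects `i, j, x'` with `j, i, x'`. -/
theorem serreRigid_far {m : ℕ} (ih : ∀ v : List ℕ, v.length ≤ m → SerreRigid v) {i j : ℕ}
    {w w' : List ℕ} (hw : w.length = m) (hij : i + 2 ≤ j) (hp : (i :: w).Perm (j :: w'))
    (hpw : IsPart w) (hpw' : IsPart w') {g : List ℕ → ℤ} (hg : IsSerre g) :
    wordMult (j :: w') * g (i :: w) = wordMult (i :: w) * g (j :: w') := by
  have hcj : 0 < w.count j := by
    have := hp.count_eq j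
    rw [count_cons', count_cons', if_pos rfl, if_neg (by omega)] at this
    omega
  have h1 := List.perm_cons_erase (List.count_pos_iff.1 hcj)
  set x := w.erase j
  have h2 : w'.Perm (i :: x) := by
    have := hp.symm.trans ((h1.cons i).trans (List.Perm.swap _ _ _))
    exact (List.perm_cons _).1 this
  have hpx : IsPart x := by
    intro l
    have e1 := hpw l
    have e2 := hpw' l
    rw [h1.count_eq, h1.count_eq, count_cons', count_cons'] at e1
    rw [h2.count_eq, h2.count_eq, count_cons', count_cons'] at e2
    split_ifs at e1 e2 <;> omega
  obtain ⟨x', hx', hx0⟩ := exists_wordMult_ne hpx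
  have k1 := h1.trans (hx'.cons j)
  have k2 := h2.trans (hx'.cons i)
  have hlen := hp.length_eq
  simp only [List.length_cons] at hlen
  have a1 := (ih w hw.le _ (hg.cons i)).2 _ k1
  have a2 := (ih w' (by omega) _ (hg.cons j)).2 _ k2
  have a3 := hg.comm' i j x' (Or.inl hij)
  simp only [wordMult] at a1 a2 ⊢
  rw [letterMult_perm k1 i, letterMult_perm k2 j, letterMult_cons_of_ne _ (by omega) (by omega),
    letterMult_cons_of_ne _ (by omega) (by omega)]
  rw [← a3] at a2
  apply mul_left_cancel₀ hx0
  linear_combination wordMult w' * a1 - wordMult w * a2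

/-- Remove `i, i, i+1` from the word, leaving `x'`. Three instances of the induction hypothesis
express the terms of the Serre relation on `x'` through the two values to be compared. -/
theorem serreRigid_near {m : ℕ} (ih : ∀ v : List ℕ, v.length ≤ m → SerreRigid v) {i : ℕ}
    {w w' : List ℕ} (hw : w.length = m) (hp : (i :: w).Perm ((i + 1) :: w'))
    (hpv : IsPart (i :: w)) (hpw : IsPart w) (hpw' : IsPart w') {g : List ℕ → ℤ} (hg : IsSerre g) :
    wordMult ((i + 1) :: w') * g (i :: w) = wordMult (i :: w) * g ((i + 1) :: w') := by
  have hcv := hp.count_eq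
  simp only [count_cons'] at hcv
  have hcj : 0 < w.count (i + 1) := by
    have := hcv (i + 1)
    rw [if_pos rfl, if_neg (by omega)] at this
    omega
  have hci : 0 < w.count i := by have := hpw i; omega
  obtain ⟨x, hx⟩ := exists_perm_cons_cons (v := w) (a := i + 1) (b := i) (by omega) hcj hci
  have h2 : w'.Perm (i :: i :: x) := by
    have := hp.symm.trans ((hx.cons i).trans (List.Perm.swap _ _ _))
    exact (List.perm_cons _).1 this
  have hcw := hx.count_eq
  have hcw' := h2.count_eq
  simp only [count_cons'] at hcw hcw'
  have hpix : IsPart (i :: x) := by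
    intro l
    have e1 := hpw l
    have e2 := hpw' l
    have e3 := hpv l
    rw [hcw, hcw] at e1
    rw [hcw', hcw'] at e2
    simp only [count_cons', hcw] at e3 ⊢
    split_ifs at e1 e2 e3 ⊢ <;> omega
  have hpx : IsPart x := by
    intro l
    have e1 := hpw l
    have e2 := hpw' l
    have e4 := hpix l
    rw [hcw, hcw] at e1
    rw [hcw', hcw'] at e2
    simp only [count_cons'] at e4
    split_ifs at e1 e2 e4 <;> omega
  obtain ⟨x', hx', hx0⟩ := exists_wordMult_ne hpx
  have k1 := hx.trans ((hx'.cons i).cons (i + 1))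
  have k1' := k1.trans (List.Perm.swap _ _ _)
  have k2 := h2.trans ((hx'.cons i).cons i)
  have hlen := hp.length_eq
  simp only [List.length_cons] at hlen
  have a1 := (ih w hw.le _ (hg.cons i)).2 _ k1
  have a2 := (ih w hw.le _ (hg.cons i)).2 _ k1'
  have a3 := (ih w' (by omega) _ (hg.cons (i + 1))).2 _ k2
  have hs := hg.serre [] i (i + 1) x' (Or.inl rfl)
  simp only [List.nil_append] at hs
  have hix := wordMult_cons_ne (hpix.perm (hx'.cons i)) hx0
  simp only [wordMult] at a1 a2 a3 hix ⊢
  rw [letterMult_perm k1 i, letterMult_perm k2 (i + 1), letterMult_succ_cons,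
    letterMult_succ_cons, letterMult_cons_of_ne _ (by omega) (by omega)]
  rw [letterMult_succ_cons] at a1
  rw [letterMult_cons_of_ne _ (by omega) (by omega)] at a2
  apply mul_left_cancel₀ hix
  linear_combination wordMult w' * (2 * a1 - a2) - wordMult w * a3 - wordMult w * wordMult w' * hs

/-- In the polynomial model the letter 0 multiplies by `x_0`, and the letter `i > 0` acts as `x_i
∂/∂x_{i-1}`. A content determines at most one monomial, with exponents the successive differences of
counts, and `wordMult` is its coefficient. The proof stays with words and compares first letters:
equal, adjacent, or far apart. -/
theorem serreRigid (v : List ℕ) : SerreRigid v := by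
  induction hm : v.length using Nat.strong_induction_on generalizing v with
  | _ m ih =>
    intro g hg
    rcases v with _ | ⟨i, w⟩
    · refine ⟨fun h => absurd (fun l => by simp) h, fun v' hv' => ?_⟩
      rw [List.nil_perm.1 hv']
    simp only [List.length_cons] at hm
    have ih' : ∀ v : List ℕ, v.length ≤ w.length → SerreRigid v := fun v hv =>
      ih v.length (by omega) v rfl
    have hpart := fun i {w' : List ℕ} (h : w'.length = w.length) =>
      serreRigid_notPart (i := i) ih' h hg
    refine ⟨hpart i rfl, fun v' hv' => ?_⟩
    rcases v' with _ | ⟨j, w'⟩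
    · exact absurd hv'.length_eq (by simp)
    have hlen := hv'.length_eq
    simp only [List.length_cons, Nat.add_right_cancel_iff] at hlen
    by_cases hp : IsPart (i :: w)
    swap
    · rw [hpart i rfl hp, hpart j hlen.symm fun h => hp (h.perm hv'.symm), mul_zero, mul_zero]
    have hp' := hp.perm hv'
    by_cases hij : i = j
    · subst hij
      have hww := (List.perm_cons i).1 hv'
      have := (ih' w le_rfl _ (hg.cons i)).2 _ hww
      simp only [wordMult, letterMult_perm hww]
      linear_combination letterMult i w' * this
    by_cases hw0 : wordMult w = 0
    · have := (ih' w le_rfl).eq_zero hw0 (hg.cons i)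
      simp only [wordMult, hw0, this]
      ring
    by_cases hw0' : wordMult w' = 0
    · have := (ih' w' hlen.ge).eq_zero hw0' (hg.cons j)
      simp only [wordMult, hw0', this]
      ring
    have hpw := isPart_of_wordMult_ne hw0
    have hpw' := isPart_of_wordMult_ne hw0'
    rw [hlen] at ih'
    rcases lt_or_gt_of_ne hij with h | h
    · by_cases h1 : j = i + 1
      · subst h1
        exact serreRigid_near ih' hlen hv' hp hpw hpw' hg
      · exact serreRigid_far ih' hlen (by omega) hv' hpw hpw' hg
    · by_cases h1 : i = j + 1
      · subst h1
        exact (serreRigid_near ih' rfl hv'.symm hp' hpw' hpw hg).symm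
      · exact (serreRigid_far ih' rfl (by omega) hv'.symm hpw' hpw hg).symm

theorem wordMult_ne_of_sorted {v : List ℕ} (h : IsPart v) (hs : v.Pairwise (· ≥ ·)) :
    wordMult v ≠ 0 := by
  induction v with
  | nil => simp [wordMult]
  | cons i v ih =>
    rw [List.pairwise_cons] at hs
    refine wordMult_cons_ne h (ih (h.erase_max (List.Perm.refl _) fun l hl => ?_) hs.2)
    rcases List.mem_cons.1 hl with rfl | hl
    · exact le_rfl
    · exact hs.1 l hl

/-- If a function satisfying the Serre relations does not vanish at some rearrangement of a
decreasing word then it does not vanish at the decreasing word. -/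
theorem IsSerre.ne_zero_of_sorted {g : List ℕ → ℤ} (hg : IsSerre g) {v w : List ℕ} (hv : g v ≠ 0)
    (hvw : v.Perm w) (hs : w.Pairwise (· ≥ ·)) : g w ≠ 0 := by
  have h1 := serreRigid v g hg
  have hp : IsPart v := by by_contra h; exact hv (h1.1 h)
  have h2 := h1.2 w hvw
  intro h0
  rw [h0, mul_zero] at h2
  exact mul_ne_zero (wordMult_ne_of_sorted (hp.perm hvw) hs) hv h2

end

/-! ### Kato's lower bound, by iterating nilpotent operators. -/

section

/-! ### Lower bounds for dimensions of weight spaces -/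

open Nat in
theorem prod_card_le_eq_factorial {α : Type*} [LinearOrder α] (s : Finset α) :
    ∏ i ∈ s, (s.filter (· ≤ i)).card = (s.card)! := by
  induction s using Finset.induction_on_max with
  | empty => simp
  | insert a s ha ih =>
    have hnot : a ∉ s := fun h => lt_irrefl a (ha a h)
    rw [Finset.prod_insert hnot, Finset.card_insert_of_notMem hnot, Nat.factorial_succ, ← ih]
    congr 1
    · rw [Finset.filter_true_of_mem, Finset.card_insert_of_notMem hnot]
      intro x hx
      rcases Finset.mem_insert.1 hx with rfl | hx
      · exact le_rfl
      · exact (ha x hx).le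
    · refine Finset.prod_congr rfl fun i hi => ?_
      rw [Finset.filter_insert, if_neg (not_le.2 (ha i hi))]

-- Rewrites the product of factorials position by position, the form in which the induction of
-- `IsKato.prod_le_finrank` produces it.
open Nat in
theorem prod_rank_eq {α β : Type*} [LinearOrder α] [Fintype α] [DecidableEq β] (F : α → β) :
    ∏ i, (Finset.univ.filter fun i' => i' ≤ i ∧ F i' = F i).card =
      ∏ y ∈ Finset.univ.image F, (Fintype.card {i // F i = y})! := by
  rw [← Finset.prod_fiberwise_of_maps_to (g := F) (t := Finset.univ.image F)
    (fun i _ => Finset.mem_image_of_mem F (Finset.mem_univ i))]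
  refine Finset.prod_congr rfl fun y _ => ?_
  rw [Fintype.card_subtype, ← prod_card_le_eq_factorial]
  refine Finset.prod_congr rfl fun i hi => ?_
  rw [Finset.mem_filter] at hi
  congr 1
  ext i'
  simp [hi.2, and_comm]

section Kato

variable {V β : Type*} [AddCommGroup V] [Module ℂ V] {n : ℕ}

/-- A subspace that is stable under commuting operators `y i`, acting locally nilpotently, and under
the operators `s i j` for neighbours `i, j < m` with `F i = F j`. -/
structure IsKato (y : Fin n → Module.End ℂ V) (s : Fin n → Fin n → Module.End ℂ V) (F : Fin n → β)
    (m : ℕ) (U : Submodule ℂ V) : Prop where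
  y_mem : ∀ i, ∀ u ∈ U, y i u ∈ U
  nil : ∀ i, ∀ u ∈ U, ∃ k, (y i ^ k) u = 0
  s_mem : ∀ i j : Fin n, (j : ℕ) = i + 1 → F i = F j → (j : ℕ) < m → ∀ u ∈ U, s i j u ∈ U

variable {y : Fin n → Module.End ℂ V} {s : Fin n → Fin n → Module.End ℂ V} {F : Fin n → β}

theorem pow_mem_of_mem {f : Module.End ℂ V} {U : Submodule ℂ V} (hf : ∀ u ∈ U, f u ∈ U) (k : ℕ)
    {u : V} (hu : u ∈ U) : (f ^ k) u ∈ U := by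
  induction k with
  | zero => exact hu
  | succ k ih => rw [pow_succ', Module.End.mul_apply]; exact hf _ ih

theorem exists_ker_ne_zero {f : Module.End ℂ V} {U : Submodule ℂ V} (hf : ∀ u ∈ U, f u ∈ U)
    (hnil : ∀ u ∈ U, ∃ k, (f ^ k) u = 0) (hU : U ≠ ⊥) : U ⊓ LinearMap.ker f ≠ ⊥ := by
  obtain ⟨u, hu, hu0⟩ := Submodule.exists_mem_ne_zero_of_ne_bot hU
  classical
  have hex := hnil u hu
  have h1 := Nat.find_spec hex
  have h2 : Nat.find hex ≠ 0 := fun h => hu0 (by rw [h] at h1; exact h1)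
  obtain ⟨k, hk⟩ := Nat.exists_eq_succ_of_ne_zero h2
  rw [hk, Nat.succ_eq_add_one, pow_succ', Module.End.mul_apply] at h1
  have h3 : (f ^ k) u ≠ 0 := Nat.find_min hex (by omega)
  intro hbot
  apply h3
  rw [← Submodule.mem_bot ℂ, ← hbot]
  exact ⟨pow_mem_of_mem hf k hu, h1⟩

theorem exists_common_ker (hy : ∀ i j, Commute (y i) (y j)) {U : Submodule ℂ V}
    (hmem : ∀ i, ∀ u ∈ U, y i u ∈ U) (hnil : ∀ i, ∀ u ∈ U, ∃ k, (y i ^ k) u = 0) (hU : U ≠ ⊥) :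
    ∃ u ∈ U, u ≠ 0 ∧ ∀ i, y i u = 0 := by
  suffices H : ∀ T : Finset (Fin n), U ⊓ T.inf (fun i => LinearMap.ker (y i)) ≠ ⊥ by
    obtain ⟨u, hu, hu0⟩ := Submodule.exists_mem_ne_zero_of_ne_bot (H Finset.univ)
    refine ⟨u, hu.1, hu0, fun i => ?_⟩
    exact (Finset.inf_le (f := fun i => LinearMap.ker (y i)) (Finset.mem_univ i)) hu.2
  intro T
  induction T using Finset.induction_on with
  | empty => simpa using hU
  | insert i T _ ih =>
    have hst : ∀ u ∈ U ⊓ T.inf (fun i => LinearMap.ker (y i)),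
        y i u ∈ U ⊓ T.inf (fun i => LinearMap.ker (y i)) := by
      rintro u ⟨h1, h2⟩
      refine ⟨hmem i u h1, ?_⟩
      simp only [SetLike.mem_coe, Submodule.mem_finsetInf, LinearMap.mem_ker] at h2 ⊢
      intro j hj
      rw [← Module.End.mul_apply, (hy j i).eq, Module.End.mul_apply, h2 j hj, map_zero]
    have := exists_ker_ne_zero hst (fun u hu => hnil i u hu.1) ih
    rwa [inf_assoc, inf_comm (T.inf _), ← Finset.inf_insert (f := fun i => LinearMap.ker (y i))]
      at this

/-- Each passage of `y_j` through `t` turns it into `y_i` plus a constant; only the first constant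
term survives because `y_j z = 0`. -/
theorem pow_apply_cross (hy : ∀ i j, Commute (y i) (y j)) {i j : Fin n} {t : Module.End ℂ V}
    (hc : t * y i = y j * t - 1) {z : V} (hz : y j z = 0) (a : ℕ) :
    (y j ^ (a + 1)) (t z) = t ((y i ^ (a + 1)) z) + (y i ^ a) z := by
  have hc' : ∀ z, y j (t z) = t (y i z) + z := fun z => by
    have := LinearMap.congr_fun hc z
    simp only [Module.End.mul_apply, LinearMap.sub_apply, Module.End.one_apply] at this
    rw [this]; abel
  induction a with
  | zero => simpa using hc' z
  | succ a ih =>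
    have h0 : y j ((y i ^ a) z) = 0 := by
      have := LinearMap.congr_fun ((hy j i).pow_right a).eq z
      simp only [Module.End.mul_apply] at this
      rw [this, hz, map_zero]
    rw [pow_succ', Module.End.mul_apply, ih, map_add, h0, add_zero, hc', ← Module.End.mul_apply (y i),
      ← pow_succ']

/-- Take `z = s ⋯ s x` along the run starting at `p`. By `pow_apply_cross` each new transposition
raises by one the power of the last operator that still does not kill the vector. -/
theorem IsKato.exists_pow_eq {m : ℕ} {U : Submodule ℂ V} (hy : ∀ i j, Commute (y i) (y j))
    (hs : ∀ i j : Fin n, (j : ℕ) = i + 1 → F i = F j → IsCross y i j (s i j))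
    (h : IsKato y s F m U) {x : V} (hx : x ∈ U) (hx0 : ∀ i, y i x = 0) (p : Fin n) (q : ℕ)
    (hq : (p : ℕ) + q < n) (hm : (p : ℕ) + q < m)
    (hF : ∀ i : Fin n, p ≤ i → (i : ℕ) ≤ p + q → F i = F p) :
    ∃ z ∈ U, (y ⟨p + q, hq⟩ ^ q) z = x ∧ (y ⟨p + q, hq⟩ ^ (q + 1)) z = 0 ∧
      ∀ i : Fin n, (p : ℕ) + q < i → y i z = 0 := by
  induction q with
  | zero => exact ⟨x, hx, rfl, by simpa using hx0 _, fun i _ => hx0 i⟩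
  | succ q ih =>
    obtain ⟨z, hz, h1, h2, h3⟩ := ih (by omega) (by omega) fun i hi hi' => hF i hi (by omega)
    set i : Fin n := ⟨p + q, by omega⟩
    set j : Fin n := ⟨p + (q + 1), hq⟩
    have hij : (j : ℕ) = i + 1 := rfl
    have hFij : F i = F j := by
      rw [hF i (Fin.le_def.2 (by simp [i])) (by simp [i]),
        hF j (Fin.le_def.2 (by simp [j])) (by simp [j])]
    have hcr := hs i j hij hFij
    have hz0 : y j z = 0 := h3 j (by simp only [j]; omega)
    refine ⟨s i j z, h.s_mem i j hij hFij (by simp only [j]; omega) z hz, ?_, ?_, ?_⟩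
    · rw [pow_apply_cross hy hcr.left hz0, h1, h2, map_zero, zero_add]
    · rw [pow_apply_cross hy hcr.left hz0, h2, pow_succ', Module.End.mul_apply, h2, map_zero,
        map_zero, zero_add]
    · intro l hl
      have := LinearMap.congr_fun (hcr.other l (fun e => by subst e; simp [i] at hl)
        (fun e => by subst e; simp [j] at hl)) z
      simp only [Module.End.mul_apply] at this
      rw [← this, h3 l (by omega), map_zero]

variable [DecidableEq β]

/-- The number of predecessors with the same value of `F`. -/
def runRank (F : Fin n → β) (i : Fin n) : ℕ :=
  (Finset.univ.filter fun i' => i' ≤ i ∧ F i' = F i).card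

theorem finrank_map_add_le {U : Submodule ℂ V} [FiniteDimensional ℂ U] (f : Module.End ℂ V) :
    Module.finrank ℂ (U.map f) + Module.finrank ℂ (U ⊓ LinearMap.ker f : Submodule ℂ V) ≤
      Module.finrank ℂ U := by
  rw [← (f.domRestrict U).finrank_range_add_finrank_ker, LinearMap.range_domRestrict]
  refine Nat.add_le_add_left ?_ _
  let g : (U ⊓ LinearMap.ker f : Submodule ℂ V) →ₗ[ℂ] LinearMap.ker (f.domRestrict U) :=
    LinearMap.codRestrict _ (Submodule.inclusion inf_le_left) fun u => by
      have := u.2.2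
      simpa using this
  refine LinearMap.finrank_le_finrank_of_injective (f := g) fun u v huv => ?_
  have := congrArg (fun w : LinearMap.ker (f.domRestrict U) => ((w : U) : V)) huv
  exact Subtype.ext this

/-- Let `M` be the last index, the `k`-th of its run. The images `y_M^t U` with `t < k` are nonzero,
hence so are their intersections with `ker y_M`. Each intersection satisfies the hypothesis for `m`,
and their dimensions add up to at most `dim U`, giving the factor `k`. -/
theorem IsKato.prod_le_finrank (hy : ∀ i j, Commute (y i) (y j))
    (hs : ∀ i j : Fin n, (j : ℕ) = i + 1 → F i = F j → IsCross y i j (s i j))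
    (hF : ∀ i j k : Fin n, i ≤ j → j ≤ k → F i = F k → F j = F k) (m : ℕ) (hm : m ≤ n) :
    ∀ U : Submodule ℂ V, FiniteDimensional ℂ U → U ≠ ⊥ → IsKato y s F m U →
      ∏ i ∈ Finset.univ.filter (fun i : Fin n => (i : ℕ) < m), runRank F i ≤
        Module.finrank ℂ U := by
  induction m with
  | zero =>
    intro U hfd hU _
    have : Module.finrank ℂ U ≠ 0 := fun h => hU (Submodule.finrank_eq_zero.1 h)
    simp
    omega
  | succ m ih =>
    intro U hfd hU hK
    have ih := ih (by omega)
    set M : Fin n := ⟨m, by omega⟩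
    have hset : Finset.univ.filter (fun i : Fin n => (i : ℕ) < m + 1) =
        insert M (Finset.univ.filter (fun i : Fin n => (i : ℕ) < m)) := by
      ext i
      simp only [Finset.mem_filter, Finset.mem_univ, true_and, Finset.mem_insert, M, Fin.ext_iff]
      omega
    rw [hset, Finset.prod_insert (by simp [M])]
    set P := ∏ i ∈ Finset.univ.filter (fun i : Fin n => (i : ℕ) < m), runRank F i
    set k := runRank F M
    -- The run through `M` is an interval by convexity of the level sets; `p` is its first index.
    obtain ⟨p, q, hpq, hkq, hFp⟩ : ∃ (p : Fin n) (q : ℕ), (p : ℕ) + q = m ∧ k = q + 1 ∧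
        ∀ i : Fin n, p ≤ i → (i : ℕ) ≤ p + q → F i = F p := by
      set R := Finset.univ.filter fun i' => i' ≤ M ∧ F i' = F M with hR
      have hne : R.Nonempty := ⟨M, by simp [hR]⟩
      have hp := Finset.min'_mem R hne
      set p := R.min' hne
      simp only [hR, Finset.mem_filter, Finset.mem_univ, true_and] at hp
      have hRI : R = Finset.Icc p M := by
        ext i
        simp only [hR, Finset.mem_filter, Finset.mem_univ, true_and, Finset.mem_Icc]
        constructor
        · intro hi
          exact ⟨Finset.min'_le R i (by simp [hR, hi.1, hi.2]), hi.1⟩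
        · intro hi
          exact ⟨hi.2, hF p i M hi.1 hi.2 hp.2⟩
      have hpm : (p : ℕ) ≤ m := hp.1
      refine ⟨p, m - p, by omega, ?_, ?_⟩
      · change R.card = _
        rw [hRI, Fin.card_Icc]
        change m + 1 - (p : ℕ) = _
        omega
      · intro i h1 h2
        rw [hF p i M h1 (Fin.le_def.2 (by simp only [M]; omega)) hp.2, hp.2]
    obtain ⟨x, hxU, hx0, hxk⟩ := exists_common_ker hy hK.y_mem hK.nil hU
    obtain ⟨z, hzU, hz, -, -⟩ := hK.exists_pow_eq hy hs hxU hxk p q (by omega) (by omega) hFp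
    have hM : (⟨p + q, by omega⟩ : Fin n) = M := Fin.ext hpq
    rw [hM] at hz
    have hsub : ∀ t, IsKato y s F m (U.map (y M ^ t)) := by
      intro t
      have hcy : ∀ i u, y i ((y M ^ t) u) = (y M ^ t) (y i u) := fun i u =>
        LinearMap.congr_fun ((hy i M).pow_right t).eq u
      refine ⟨?_, ?_, ?_⟩
      · rintro i _ ⟨u, hu, rfl⟩
        exact ⟨y i u, hK.y_mem i u hu, (hcy i u).symm⟩
      · rintro i _ ⟨u, hu, rfl⟩
        obtain ⟨k, hk⟩ := hK.nil i u hu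
        refine ⟨k, ?_⟩
        have := LinearMap.congr_fun (((hy i M).pow_left k).pow_right t).eq u
        simp only [Module.End.mul_apply] at this
        rw [this, hk, map_zero]
      · rintro i j hij hFij hjm _ ⟨u, hu, rfl⟩
        refine ⟨s i j u, hK.s_mem i j hij hFij (by omega) u hu, ?_⟩
        have hc : Commute (s i j) (y M) := (hs i j hij hFij).other M
          (fun e => by have := congrArg Fin.val e; simp only [M] at this; omega)
          (fun e => by have := congrArg Fin.val e; simp only [M] at this; omega)
        exact (LinearMap.congr_fun (hc.pow_right t).eq u).symm
    have hker : ∀ t, IsKato y s F m (U.map (y M ^ t) ⊓ LinearMap.ker (y M)) := by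
      intro t
      refine ⟨fun i u hu => ⟨(hsub t).y_mem i u hu.1, ?_⟩, fun i u hu => (hsub t).nil i u hu.1,
        fun i j hij hFij hjm u hu => ⟨(hsub t).s_mem i j hij hFij hjm u hu.1, ?_⟩⟩
      · change y M (y i u) = 0
        rw [← Module.End.mul_apply, (hy M i).eq, Module.End.mul_apply,
          show y M u = 0 from hu.2, map_zero]
      · change y M (s i j u) = 0
        have hc : Commute (s i j) (y M) := (hs i j hij hFij).other M
          (fun e => by have := congrArg Fin.val e; simp only [M] at this; omega)
          (fun e => by have := congrArg Fin.val e; simp only [M] at this; omega)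
        rw [← Module.End.mul_apply, ← hc.eq, Module.End.mul_apply,
          show y M u = 0 from hu.2, map_zero]
    -- Descending induction on the exponent `t`: rank–nullity for `y_M` on `y_M^t U` contributes one
    -- copy of `P` at each step.
    have hdim : ∀ d t, d + t = k → d * P ≤ Module.finrank ℂ (U.map (y M ^ t)) := by
      intro d
      induction d with
      | zero => intro t _; simp
      | succ d ihd =>
        intro t ht
        have h1 := ihd (t + 1) (by omega)
        have hne : U.map (y M ^ t) ≠ ⊥ := by
          intro hbot
          have hmem : (y M ^ t) z ∈ U.map (y M ^ t) := ⟨z, hzU, rfl⟩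
          rw [hbot, Submodule.mem_bot] at hmem
          apply hx0
          rw [← hz, show q = d + t by omega, pow_add, Module.End.mul_apply, hmem, map_zero]
        have h2 := exists_ker_ne_zero ((hsub t).y_mem M) ((hsub t).nil M) hne
        have h3 := ih _ (Submodule.finiteDimensional_of_le inf_le_left) h2 (hker t)
        have h4 := finrank_map_add_le (U := U.map (y M ^ t)) (y M)
        have h5 : (U.map (y M ^ t)).map (y M) = U.map (y M ^ (t + 1)) := by
          rw [← Submodule.map_comp, pow_succ']; rfl
        rw [h5] at h4
        calc (d + 1) * P = d * P + P := by ring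
          _ ≤ _ := Nat.add_le_add h1 h3
          _ ≤ _ := h4
    have := hdim k 0 (by omega)
    rw [pow_zero] at this
    have h6 : U.map (1 : Module.End ℂ V) = U := Submodule.map_id U
    rwa [h6] at this

end Kato

end

/-! ### The finite Hecke operators on a module, and the lower bound for sorted weights. -/

section

variable {n : ℕ}

section Modules

set_option linter.unusedSectionVars false

variable {Q : Type*} [AddCommGroup Q] [Module ℂ Q] [Module (DDAHA n) Q] [IsScalarTower ℂ (DDAHA n) Q]

/-! ### The action of the finite part -/

theorem xOp_commute (i j : Fin n) : Commute (xOp Q i) (xOp Q j) := by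
  have := congrArg (opOf Q) (ofH_comm (epsV i) (epsV j))
  rwa [map_mul, map_mul] at this

/-- The operator of a transposition. -/
def sOp (Q : Type*) [AddCommGroup Q] [Module ℂ Q] [Module (DDAHA n) Q]
    [IsScalarTower ℂ (DDAHA n) Q] (i j : Fin n) : Module.End ℂ Q := opOf Q (ofW (reflR (i, j, 0)))

theorem act_refl_epsV (i j l : Fin n) :
    act (reflR (i, j, 0)) (epsV l) = epsV (Equiv.swap i j l) := by
  rw [act_def]
  have e : ∀ m, (if (Equiv.swap i j) m = l then (1 : ℂ) else 0) =
      if m = Equiv.swap i j l then 1 else 0 := fun m => by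
    simp only [Equiv.swap_apply_eq_iff]
  ext m
  · simp [right_reflR, epsV, Pi.single_apply, e]
  · simp [shift_reflR, epsV]

theorem sOp_mul_xOp {i j : Fin n} (hij : (j : ℕ) = i + 1) (l : Fin n) :
    sOp Q i j * xOp Q l = xOp Q (Equiv.swap i j l) * sOp Q i j -
      ((if l = i then 1 else 0) - if l = j then 1 else 0 : ℂ) • (1 : Module.End ℂ Q) := by
  have h := congrArg (opOf Q) (ofW_cross (isSimple_finite hij) (epsV l))
  rw [act_refl_epsV, map_mul, map_sub, map_mul, AlgHom.commutes] at h
  rw [sOp, xOp, h, Algebra.algebraMap_eq_smul_one]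
  congr 2
  simp [pair, rootPair, epsV, Pi.single_apply, eq_comm]

theorem isCross_xOp {i j : Fin n} (hij : (j : ℕ) = i + 1) : IsCross (xOp Q) i j (sOp Q i j) := by
  have hne : i ≠ j := fun h => by rw [h] at hij; omega
  refine ⟨hne, ?_, ?_, ?_, fun l h1 h2 => ?_⟩
  · rw [sOp, ← map_mul, ← ofW_mul, reflR_mul_self, ofW_one, map_one]
  · rw [sOp_mul_xOp hij]; simp [hne]
  · rw [sOp_mul_xOp hij]; simp [hne.symm]
  · rw [sOp_mul_xOp hij, Equiv.swap_apply_of_ne_of_ne h1 h2]; simp [h1, h2]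

theorem sOp_braid {i j k : Fin n} (hij : i ≠ j) (hjk : j ≠ k) (hik : i ≠ k) :
    sOp Q i j * sOp Q j k * sOp Q i j = sOp Q j k * sOp Q i j * sOp Q j k := by
  simp only [sOp, ← map_mul, ← ofW_mul, ← perm_swap_eq, ← perm_mul]
  rw [Equiv.swap_mul_swap_mul_swap hij hik, Equiv.swap_comm i j, Equiv.swap_comm j k,
    Equiv.swap_mul_swap_mul_swap hjk.symm hik.symm, Equiv.swap_comm]

theorem wtSpace_comp (a : Fin n → ℤ) (f : Fin n → Fin n) :
    wtSpace Q (a ∘ f) = genWeight (xOp (n := n) Q) ((fun i => (a i : ℂ)) ∘ f) := rfl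

theorem finrank_wtSpace_swap {i j : Fin n} (hij : (j : ℕ) = i + 1) {a : Fin n → ℤ}
    (hf : FiniteDimensional ℂ (wtSpace Q a))
    (hf' : FiniteDimensional ℂ (wtSpace Q (a ∘ Equiv.swap i j)))
    (h1 : a i - a j ≠ 1) (h2 : a i - a j ≠ -1) :
    Module.finrank ℂ (wtSpace Q (a ∘ Equiv.swap i j)) = Module.finrank ℂ (wtSpace Q a) := by
  rw [wtSpace_comp] at hf' ⊢
  rw [wtSpace] at hf ⊢
  exact (isCross_xOp hij).symm xOp_commute (by exact_mod_cast h1) (by exact_mod_cast h2)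

theorem finrank_wtSpace_serre {i j k : Fin n} (hij : (j : ℕ) = i + 1) (hjk : (k : ℕ) = j + 1)
    {a : Fin n → ℤ} (h1 : a i = a j) (h2 : a j ≠ a k) (hf : FiniteDimensional ℂ (wtSpace Q a))
    (hf' : FiniteDimensional ℂ (wtSpace Q (a ∘ Equiv.swap j k)))
    (hf'' : FiniteDimensional ℂ (wtSpace Q (a ∘ Equiv.swap j k ∘ Equiv.swap i j))) :
    Module.finrank ℂ (wtSpace Q a) +
      Module.finrank ℂ (wtSpace Q (a ∘ Equiv.swap j k ∘ Equiv.swap i j)) =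
      2 * Module.finrank ℂ (wtSpace Q (a ∘ Equiv.swap j k)) := by
  have hne : ∀ {i j : Fin n}, (i : ℕ) < j → i ≠ j := fun h e => by rw [e] at h; omega
  rw [wtSpace_comp] at hf' hf'' ⊢
  rw [wtSpace_comp, wtSpace]
  rw [wtSpace] at hf
  exact finrank_serre (isCross_xOp hij) (isCross_xOp hjk) (hne (by omega))
    (sOp_braid (hne (by omega)) (hne (by omega)) (hne (by omega))) xOp_commute
    (by exact_mod_cast h1) (by exact_mod_cast h2)

variable {κ : ℤ} {ζ b : Fin n → ℤ} {J : Fin n → Prop} {v : Q}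

theorem IsGenBy.finiteDimensional (hg : IsGenBy κ ζ J v) (h : IsSegmented κ ζ b J) (hκ : 0 < κ)
    {a : Fin n → ℤ} (ha : ∀ i, b i ≤ a i) (hsum : ∑ i, a i = ∑ i, ζ i) :
    FiniteDimensional ℂ (wtSpace Q a) :=
  Module.rank_lt_aleph0_iff.1 ((hg.rank_le h hκ ha hsum).trans_lt (Cardinal.natCast_lt_aleph0))

theorem xOp_of_wt (hg : IsGenBy κ ζ J v) (i : Fin n) : xOp Q i v = (ζ i : ℂ) • v := by
  rw [xOp, opOf_apply, hg.wt]
  simp [weightFun, epsV, Pi.single_apply]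

theorem IsGenBy.mem_wtSpace (hg : IsGenBy κ ζ J v) : v ∈ wtSpace Q ζ :=
  mem_genWeight.2 fun i => ⟨1, by simp [xOp_of_wt hg]⟩

-- Apply `IsKato.prod_le_finrank` to the nilpotent operators `x_i - a_i`. Since `b` is antitone and
-- `a` is sorted in each group, the level sets of `(b, a)` are intervals, and inside them the
-- transpositions preserve the weight space.
open Nat in
theorem IsGenBy.le_finrank (hg : IsGenBy κ ζ J v) (h : IsSegmented κ ζ b J) (hκ : 0 < κ)
    {a : Fin n → ℤ} (ha : ∀ i, b i ≤ a i) (hsum : ∑ i, a i = ∑ i, ζ i)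
    (hs : ∀ i j, i ≤ j → b i = b j → a i ≤ a j) (hne : wtSpace Q a ≠ ⊥) :
    ∏ y ∈ Finset.univ.image fun i => (b i, a i), (Fintype.card {i // (b i, a i) = y})! ≤
      Module.finrank ℂ (wtSpace Q a) := by
  have hfd := hg.finiteDimensional h hκ ha hsum
  set F : Fin n → ℤ × ℤ := fun i => (b i, a i) with hF
  set y : Fin n → Module.End ℂ Q := fun i => xOp Q i - (a i : ℂ) • (1 : Module.End ℂ Q) with hy
  have hc : ∀ i j, F i = F j → IsCross (xOp Q) i j (sOp Q i j) → IsCross y i j (sOp Q i j) := by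
    intro i j hij hc
    have e : a i = a j := congrArg Prod.snd hij
    refine ⟨hc.ne, hc.sq, ?_, ?_, fun l h1 h2 => ?_⟩
    · simp only [hy, mul_sub, sub_mul, hc.left, e, mul_smul_comm, smul_mul_assoc, mul_one, one_mul]
      abel
    · simp only [hy, mul_sub, sub_mul, hc.right, e, mul_smul_comm, smul_mul_assoc, mul_one, one_mul]
      abel
    · simp only [hy, mul_sub, sub_mul, hc.other l h1 h2, mul_smul_comm, smul_mul_assoc, mul_one,
        one_mul]
  have key := IsKato.prod_le_finrank (y := y) (s := sOp Q) (F := F)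
    (fun i j => ((xOp_commute i j).sub_right ((Commute.one_right _).smul_right _)).sub_left
      (((Commute.one_left _).smul_left _)))
    (fun i j hij e => hc i j e (isCross_xOp hij)) (fun i j k hij hjk e => ?_) n le_rfl
    (wtSpace Q a) hfd hne ⟨fun i u hu => ?_, fun i u hu => mem_genWeight.1 hu i,
      fun i j hij e _ u hu => ?_⟩
  · rw [← prod_rank_eq F]
    simpa [runRank] using key
  · have e1 : b i = b k := congrArg Prod.fst e
    have e2 : a i = a k := congrArg Prod.snd e
    have h1 := h.anti hij
    have h2 := h.anti hjk
    have e3 : b j = b k := by omega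
    have h3 := hs i j hij (by omega)
    have h4 := hs j k hjk e3
    simp only [hF, Prod.mk.injEq]
    omega
  · exact Submodule.sub_mem _ (mapsTo_genWeight xOp_commute _ i hu) (Submodule.smul_mem _ _ hu)
  · have e2 : a i = a j := congrArg Prod.snd e
    exact (isCross_xOp hij).mem_of_eq xOp_commute (by simp [e2]) hu

end Modules

end

/-! ### Weight multiplicities as functions on words, and sorting a group. -/

section

variable {n : ℕ}

/-! ### Sorting a weight within a group -/

theorem getD_append_of_outside {α : Type*} (p q : List α) {x y : List α} (hxy : x.length = y.length)
    {t : ℕ} (ht : t < p.length ∨ p.length + x.length ≤ t) (d : α) :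
    (p ++ (x ++ q)).getD t d = (p ++ (y ++ q)).getD t d := by
  rcases ht with h | h
  · rw [List.getD_append _ _ _ _ h, List.getD_append _ _ _ _ h]
  · rw [List.getD_append_right _ _ _ _ (by omega), List.getD_append_right _ _ _ _ (by omega),
      List.getD_append_right _ _ _ _ (by omega), List.getD_append_right _ _ _ _ (by omega), hxy]

/-- The weight `a` with its values in the group `b i = β`, which ends at the position `e`, replaced
by those given by a word, read backwards. -/
def wordWt (b : Fin n → ℤ) (β : ℤ) (e : ℕ) (a : Fin n → ℤ) (u : List ℕ) (i : Fin n) : ℤ :=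
  if b i = β then β + (u.getD (e - i) 0 : ℕ) else a i

variable {b a : Fin n → ℤ} {β : ℤ} {q e : ℕ}

theorem le_wordWt (ha : ∀ i, b i ≤ a i) (u : List ℕ) (i : Fin n) : b i ≤ wordWt b β e a u i := by
  rw [wordWt]
  split_ifs with h
  · omega
  · exact ha i

theorem wordWt_append_of_outside (p v : List ℕ) {x y : List ℕ} (hxy : x.length = y.length)
    {i : Fin n} (hi : b i = β → e - i < p.length ∨ p.length + x.length ≤ e - i) :
    wordWt b β e a (p ++ (x ++ v)) i = wordWt b β e a (p ++ (y ++ v)) i := by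
  rw [wordWt, wordWt]
  split_ifs with h
  · rw [getD_append_of_outside p v hxy (hi h)]
  · rfl

theorem wordWt_append_of_inside (p v : List ℕ) (x : List ℕ) {i : Fin n} (hi : b i = β) {t : ℕ}
    (ht : e - i = p.length + t) (htx : t < x.length) :
    wordWt b β e a (p ++ (x ++ v)) i = β + (x.getD t 0 : ℕ) := by
  rw [wordWt, if_pos hi, ht, List.getD_append_right _ _ _ _ (by omega), Nat.add_sub_cancel_left,
    List.getD_append _ _ _ _ htx]

/-- Words are read backwards, so a prefix `p` fills the last positions of the group and the next
letter sits at `j = e - p.length`. -/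
theorem wordWt_swap (hgrp : ∀ i : Fin n, b i = β ↔ q ≤ (i : ℕ) ∧ (i : ℕ) ≤ e) (p v : List ℕ)
    (x y : ℕ) {i j : Fin n} (hij : (j : ℕ) = i + 1) (hi : q ≤ (i : ℕ)) (hj : e = p.length + j) :
    wordWt b β e a (p ++ ([y, x] ++ v)) = wordWt b β e a (p ++ ([x, y] ++ v)) ∘ Equiv.swap i j := by
  have hbi : b i = β := (hgrp i).2 ⟨hi, by omega⟩
  have hbj : b j = β := (hgrp j).2 ⟨by omega, by omega⟩
  funext l
  rw [Function.comp_apply]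
  by_cases hli : l = i
  · subst hli
    rw [Equiv.swap_apply_left, wordWt_append_of_inside p v _ hbi (t := 1) (by omega) (by simp),
      wordWt_append_of_inside p v _ hbj (t := 0) (by omega) (by simp)]
    rfl
  by_cases hlj : l = j
  · subst hlj
    rw [Equiv.swap_apply_right, wordWt_append_of_inside p v _ hbj (t := 0) (by omega) (by simp),
      wordWt_append_of_inside p v _ hbi (t := 1) (by omega) (by simp)]
    rfl
  rw [Equiv.swap_apply_of_ne_of_ne hli hlj]
  refine wordWt_append_of_outside p v (x := [y, x]) (y := [x, y]) rfl fun hl => ?_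
  have h1 := (hgrp l).1 hl
  have h2 : (l : ℕ) ≠ i := fun h => hli (Fin.ext h)
  have h3 : (l : ℕ) ≠ j := fun h => hlj (Fin.ext h)
  simp only [List.length_cons, List.length_nil]
  omega

section Modules

set_option linter.unusedSectionVars false

variable {Q : Type*} [AddCommGroup Q] [Module ℂ Q] [Module (DDAHA n) Q] [IsScalarTower ℂ (DDAHA n) Q]

variable {κ : ℤ} {ζ : Fin n → ℤ} {J : Fin n → Prop} {v : Q}

open Classical in
/-- The dimensions of the weight spaces obtained by changing a weight in one group. -/
def wordDim (Q : Type*) [AddCommGroup Q] [Module ℂ Q] [Module (DDAHA n) Q]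
    [IsScalarTower ℂ (DDAHA n) Q] (ζ b : Fin n → ℤ) (β : ℤ) (q e : ℕ) (a : Fin n → ℤ)
    (u : List ℕ) : ℤ :=
  if u.length = e + 1 - q ∧ ∑ i, wordWt b β e a u i = ∑ i, ζ i then
    Module.finrank ℂ (wtSpace Q (wordWt b β e a u)) else 0

/-- The three axioms are `finrank_wtSpace_swap`, `finrank_wtSpace_serre` and `wtSpace_eq_bot`. The
cutoffs on length and sum in `wordDim` are invariant under rearrangement; they make the weight
spaces in question finite dimensional. -/
theorem IsGenBy.isSerre (hg : IsGenBy κ ζ J v) (h : IsSegmented κ ζ b J) (hκ : 0 < κ)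
    (ha : ∀ i, b i ≤ a i) (hqe : q ≤ e) (hen : e < n)
    (hgrp : ∀ i : Fin n, b i = β ↔ q ≤ (i : ℕ) ∧ (i : ℕ) ≤ e) :
    IsSerre (wordDim Q ζ b β q e a) := by
  have hsum : ∀ (a : Fin n → ℤ) (i j : Fin n), ∑ l, (a ∘ Equiv.swap i j) l = ∑ l, a l :=
    fun a i j => Equiv.sum_comp (Equiv.swap i j) a
  have hfd : ∀ u, ∑ i, wordWt b β e a u i = ∑ i, ζ i →
      FiniteDimensional ℂ (wtSpace Q (wordWt b β e a u)) :=
    fun u => hg.finiteDimensional h hκ (le_wordWt ha u)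
  refine ⟨fun p i j v hij => ?_, fun p i j v hij => ?_, fun p i hi => ?_⟩
  · by_cases hlen : p.length + v.length + 2 = e + 1 - q
    swap
    · rw [wordDim, wordDim, if_neg, if_neg] <;>
      · simp only [List.length_append, List.length_cons]; omega
    set P0 : Fin n := ⟨e - p.length - 1, by omega⟩ with hP0
    set P1 : Fin n := ⟨e - p.length, by omega⟩ with hP1
    have h01 : (P1 : ℕ) = P0 + 1 := by simp only [hP0, hP1]; omega
    have hw := wordWt_swap (a := a) hgrp p v i j h01 (by simp only [hP0]; omega)
      (by simp only [hP1]; omega)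
    simp only [List.cons_append, List.nil_append] at hw
    have hs : ∑ l, wordWt b β e a (p ++ j :: i :: v) l = ∑ l, wordWt b β e a (p ++ i :: j :: v) l := by
      rw [hw, hsum]
    rw [wordDim, wordDim, hs]
    by_cases hc : ∑ l, wordWt b β e a (p ++ i :: j :: v) l = ∑ l, ζ l
    swap
    · rw [if_neg (by tauto), if_neg (by tauto)]
    have hl : ∀ i j : ℕ, (p ++ i :: j :: v).length = e + 1 - q := fun i j => by
      simp only [List.length_append, List.length_cons]; omega
    rw [if_pos ⟨hl _ _, hc⟩, if_pos ⟨hl _ _, hc⟩, hw]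
    have hv0 := wordWt_append_of_inside (a := a) (b := b) (e := e) p v [i, j] (i := P0)
      ((hgrp P0).2 (by simp only [hP0]; omega)) (t := 1) (by simp only [hP0]; omega) (by simp)
    have hv1 := wordWt_append_of_inside (a := a) (b := b) (e := e) p v [i, j] (i := P1)
      ((hgrp P1).2 (by simp only [hP1]; omega)) (t := 0) (by simp only [hP1]; omega) (by simp)
    simp only [List.cons_append, List.nil_append, List.getD_cons_zero, List.getD_cons_succ]
      at hv0 hv1
    rw [finrank_wtSpace_swap h01 (hfd _ hc) (hw ▸ hfd _ (hs.trans hc))]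
    · rw [hv0, hv1]; omega
    · rw [hv0, hv1]; omega
  · by_cases hlen : p.length + v.length + 3 = e + 1 - q
    swap
    · rw [wordDim, wordDim, wordDim, if_neg, if_neg, if_neg]
      · rfl
      all_goals simp only [List.length_append, List.length_cons]; omega
    set P0 : Fin n := ⟨e - p.length - 2, by omega⟩ with hP0
    set P1 : Fin n := ⟨e - p.length - 1, by omega⟩ with hP1
    set P2 : Fin n := ⟨e - p.length, by omega⟩ with hP2
    have h01 : (P1 : ℕ) = P0 + 1 := by simp only [hP0, hP1]; omega
    have h12 : (P2 : ℕ) = P1 + 1 := by simp only [hP1, hP2]; omega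
    have hw1 := wordWt_swap (a := a) hgrp p (i :: v) j i h12 (by simp only [hP1]; omega)
      (by simp only [hP2]; omega)
    have hw2 := wordWt_swap (a := a) hgrp (p ++ [i]) v j i h01 (by simp only [hP0]; omega)
      (by simp only [hP1, List.length_append, List.length_singleton]; omega)
    simp only [List.cons_append, List.nil_append, List.append_assoc] at hw1 hw2
    rw [hw1, Function.comp_assoc] at hw2
    have hs1 : ∑ l, wordWt b β e a (p ++ i :: j :: i :: v) l =
        ∑ l, wordWt b β e a (p ++ j :: i :: i :: v) l := by
      rw [hw1, hsum]
    have hs2 : ∑ l, wordWt b β e a (p ++ i :: i :: j :: v) l =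
        ∑ l, wordWt b β e a (p ++ j :: i :: i :: v) l := by
      rw [hw2, ← Function.comp_assoc, hsum, hsum]
    rw [wordDim, wordDim, wordDim, hs1, hs2]
    by_cases hc : ∑ l, wordWt b β e a (p ++ j :: i :: i :: v) l = ∑ l, ζ l
    swap
    · rw [if_neg (by tauto), if_neg (by tauto), if_neg (by tauto)]; rfl
    have hl : ∀ i j k : ℕ, (p ++ i :: j :: k :: v).length = e + 1 - q := fun i j k => by
      simp only [List.length_append, List.length_cons]; omega
    rw [if_pos ⟨hl _ _ _, hc⟩, if_pos ⟨hl _ _ _, hc⟩, if_pos ⟨hl _ _ _, hc⟩]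
    have hv0 := wordWt_append_of_inside (a := a) (b := b) (e := e) p v [j, i, i] (i := P0)
      ((hgrp P0).2 (by simp only [hP0]; omega)) (t := 2) (by simp only [hP0]; omega) (by simp)
    have hv1 := wordWt_append_of_inside (a := a) (b := b) (e := e) p v [j, i, i] (i := P1)
      ((hgrp P1).2 (by simp only [hP1]; omega)) (t := 1) (by simp only [hP1]; omega) (by simp)
    have hv2 := wordWt_append_of_inside (a := a) (b := b) (e := e) p v [j, i, i] (i := P2)
      ((hgrp P2).2 (by simp only [hP2]; omega)) (t := 0) (by simp only [hP2]; omega) (by simp)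
    simp only [List.cons_append, List.nil_append, List.getD_cons_zero, List.getD_cons_succ]
      at hv0 hv1 hv2
    have key := finrank_wtSpace_serre (Q := Q) h01 h12 (hv0.trans hv1.symm)
      (by rw [hv1, hv2]; omega) (hfd _ hc) (hw1 ▸ hfd _ (hs1.trans hc))
      (hw2 ▸ hfd _ (hs2.trans hc))
    rw [← hw1, ← hw2] at key
    rw [add_comm]
    exact_mod_cast key
  -- The last letter of a word of full length is the value at the first position `q` of the group.
  · rw [wordDim]
    split_ifs with hc
    swap
    · rfl
    have hl := hc.1
    rw [List.length_append, List.length_singleton] at hl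
    set P : Fin n := ⟨q, by omega⟩ with hP
    have hbP : b P = β := (hgrp P).2 (by simp only [hP]; omega)
    have hv := wordWt_append_of_inside (a := a) (b := b) (e := e) p [] [i] (i := P)
      hbP (t := 0) (by simp only [hP]; omega) (by simp)
    rw [List.append_nil, List.getD_cons_zero] at hv
    rw [hg.wtSpace_eq_bot h hκ (le_wordWt ha _) hc.2 (i := P) ?_ ?_]
    · simp
    · intro i' hi' he
      rw [hbP, hgrp] at he
      rw [Fin.lt_def] at hi'
      simp only [hP] at hi'
      omega
    · rw [hv, hbP]; omega

end Modules

theorem exists_group_bounds (hb : Antitone b) {i₀ : Fin n} (hi₀ : b i₀ = β) :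
    ∃ q e : ℕ, q ≤ e ∧ e < n ∧ ∀ i : Fin n, b i = β ↔ q ≤ (i : ℕ) ∧ (i : ℕ) ≤ e := by
  have hne : (Finset.univ.filter fun i => b i = β).Nonempty := ⟨i₀, by simp [hi₀]⟩
  have h1 := Finset.min'_mem _ hne
  have h2 := Finset.max'_mem _ hne
  rw [Finset.mem_filter] at h1 h2
  refine ⟨_, _, Finset.min'_le_max' _ hne, ((Finset.univ.filter fun i => b i = β).max' hne).2,
    fun i => ⟨fun hi => ?_,
      fun ⟨h3, h4⟩ => ?_⟩⟩
  · have hmem : i ∈ Finset.univ.filter fun i => b i = β := by simp [hi]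
    exact ⟨Fin.le_def.1 (Finset.min'_le _ _ hmem), Fin.le_def.1 (Finset.le_max' _ _ hmem)⟩
  have h5 := hb (Fin.le_def.2 h3)
  have h6 := hb (Fin.le_def.2 h4)
  omega

variable {κ : ℤ} {ζ : Fin n → ℤ} {J : Fin n → Prop}

/-- In every nonzero module generated by a vector of the given kind, `a` is a weight, and it has
the same sum as the weight of the generator. -/
def IsUnivWeight (κ : ℤ) (ζ : Fin n → ℤ) (J : Fin n → Prop) (a : Fin n → ℤ) : Prop :=
  ∀ (Q : Type) [AddCommGroup Q] [Module ℂ Q] [Module (DDAHA n) Q] [IsScalarTower ℂ (DDAHA n) Q]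
    (v : Q), IsGenBy κ ζ J v → v ≠ 0 → wtSpace Q a ≠ ⊥ ∧ ∑ i, a i = ∑ i, ζ i

theorem IsSegmented.exists_sort_group (h : IsSegmented κ ζ b J) (hκ : 0 < κ) (β : ℤ)
    (ha : ∀ i, b i ≤ a i) (hu : IsUnivWeight κ ζ J a) :
    ∃ a' : Fin n → ℤ, (∀ i, b i ≤ a' i) ∧ (∀ i, b i ≠ β → a' i = a i) ∧
      (∀ i j, i ≤ j → b i = β → b j = β → a' i ≤ a' j) ∧ IsUnivWeight κ ζ J a' := by
  by_cases hβ : ∃ i, b i = β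
  swap
  · push Not at hβ
    exact ⟨a, ha, fun _ _ => rfl, fun i _ _ hi => absurd hi (hβ i), hu⟩
  obtain ⟨i₀, hi₀⟩ := hβ
  obtain ⟨q, e, hqe, hen, hgrp⟩ := exists_group_bounds h.anti hi₀
  -- The values of `a - β` in the group, from the last position to the first; the default value is
  -- never used since `e < n`.
  set u : List ℕ := (List.range (e + 1 - q)).map fun t =>
    if ht : e - t < n then (a ⟨e - t, ht⟩ - β).toNat else 0 with hu_def
  have hlen : u.length = e + 1 - q := by simp [hu_def]
  have hwu : wordWt b β e a u = a := by
    funext i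
    rw [wordWt]
    split_ifs with hi
    swap
    · rfl
    have h1 := (hgrp i).1 hi
    have h2 : e - (e - i) = (i : ℕ) := by omega
    rw [List.getD_eq_getElem _ _ (by omega)]
    simp only [hu_def, List.getElem_map, List.getElem_range, h2]
    rw [dif_pos i.2]
    have := ha i
    simp only [Fin.eta]
    omega
  set w := u.insertionSort (· ≥ ·) with hw_def
  have hp : u.Perm w := (List.perm_insertionSort _ u).symm
  have hs : w.Pairwise (· ≥ ·) := List.pairwise_insertionSort _ u
  refine ⟨wordWt b β e a w, le_wordWt ha w, fun i hi => by rw [wordWt, if_neg hi],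
    fun i j hij hi hj => ?_, ?_⟩
  · rw [wordWt, wordWt, if_pos hi, if_pos hj]
    have h1 := (hgrp i).1 hi
    have h2 := (hgrp j).1 hj
    have hwl : w.length = e + 1 - q := by rw [← hp.length_eq, hlen]
    rw [List.getD_eq_getElem _ _ (by omega), List.getD_eq_getElem _ _ (by omega)]
    have hij' := Fin.le_def.1 hij
    rcases hij'.eq_or_lt with he | hlt
    · simp only [he]; exact le_rfl
    · have := List.pairwise_iff_getElem.1 hs (e - j) (e - i) (by omega) (by omega) (by omega)
      omega
  · intro Q _ _ _ _ v hg hv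
    obtain ⟨h1, h2⟩ := hu Q v hg hv
    have hS := hg.isSerre h hκ ha hqe hen hgrp
    have hfd := hg.finiteDimensional h hκ ha h2
    have h3 : wordDim Q ζ b β q e a u ≠ 0 := by
      rw [wordDim, hwu, if_pos ⟨hlen, h2⟩]
      exact_mod_cast fun h0 => h1 (Submodule.finrank_eq_zero.1 h0)
    have h4 := hS.ne_zero_of_sorted h3 hp hs
    rw [wordDim] at h4
    split_ifs at h4 with hc
    · refine ⟨fun h0 => h4 ?_, hc.2⟩
      rw [h0]; simp
    · exact absurd rfl h4

/-- The sorted weight occurs in every module generated by a vector of the given kind. -/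
theorem IsSegmented.exists_sorted (h : IsSegmented κ ζ b J) (hκ : 0 < κ) :
    ∃ a : Fin n → ℤ, (∀ i, b i ≤ a i) ∧ (∀ i j, i ≤ j → b i = b j → a i ≤ a j) ∧
      IsUnivWeight κ ζ J a := by
  suffices H : ∀ T : Finset ℤ, ∃ a : Fin n → ℤ, (∀ i, b i ≤ a i) ∧
      (∀ i j, i ≤ j → b i = b j → b i ∈ T → a i ≤ a j) ∧ IsUnivWeight κ ζ J a by
    obtain ⟨a, h1, h2, h3⟩ := H (Finset.univ.image b)
    exact ⟨a, h1, fun i j hij e => h2 i j hij e (Finset.mem_image_of_mem b (Finset.mem_univ i)), h3⟩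
  intro T
  induction T using Finset.induction_on with
  | empty =>
    -- Before any group is sorted, the weight is `ζ` itself, which is the weight of the nonzero
    -- generator.
    refine ⟨ζ, h.le, fun i j _ _ hi => absurd hi (Finset.notMem_empty _), ?_⟩
    intro Q _ _ _ _ v hg hv
    exact ⟨fun h0 => hv ((Submodule.mem_bot ℂ).1 (h0 ▸ hg.mem_wtSpace)), rfl⟩
  | insert β T _ ih =>
    obtain ⟨a, h1, h2, h3⟩ := ih
    obtain ⟨a', h1', h2', h3', h4'⟩ := h.exists_sort_group hκ β h1 h3
    refine ⟨a', h1', fun i j hij e hi => ?_, h4'⟩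
    by_cases hβ : b i = β
    · exact h3' i j hij hβ (e ▸ hβ)
    · rw [h2' i hβ, h2' j (e ▸ hβ)]
      exact h2 i j hij e ((Finset.mem_insert.1 hi).resolve_left hβ)

end

/-! ### Rotation by elements of length zero, and segments coming from the parameters. -/

section

variable {n : ℕ}

/-! ### Rotating the segments -/

theorem weightFun_wtAct (κ : ℤ) (g : ExtAffineWeyl n) (ζ : Fin n → ℤ) (h : HDot n) :
    weightFun (fun j => (wtAct κ g ζ j : ℂ)) κ h =
      weightFun (fun j => (ζ j : ℂ)) κ (act g⁻¹ h) := by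
  simp only [weightFun, act_def, SemidirectProduct.inv_right, inv_inv, shift_inv, wtAct]
  rw [← Equiv.sum_comp g.right]
  simp only [perm_inv_apply_self]
  push_cast
  simp only [add_mul, Finset.sum_add_distrib, mul_sub, neg_mul, Finset.sum_neg_distrib, mul_assoc,
    ← Finset.mul_sum]
  ring

section Modules

set_option linter.unusedSectionVars false

variable {Q : Type*} [AddCommGroup Q] [Module ℂ Q] [Module (DDAHA n) Q] [IsScalarTower ℂ (DDAHA n) Q]

variable {κ : ℤ} {ζ b : Fin n → ℤ} {J J' : Fin n → Prop} {v : Q}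

/-- An element without inversions has no off-diagonal terms, so it carries the weight vector to a
weight vector; being invertible, it keeps it a generator. -/
theorem IsGenBy.ofW_smul (hg : IsGenBy κ ζ J v) (g : ExtAffineWeyl n) (hinv : invFin g = ∅)
    (hJ : ∀ i j : Fin n, (j : ℕ) = i + 1 → J' j → J (g.right⁻¹ j) ∧
      (g.right⁻¹ j : ℕ) = (g.right⁻¹ i : ℕ) + 1 ∧ shift g i = shift g j) :
    IsGenBy κ (wtAct κ g ζ) J' (ofW g • v) := by
  refine ⟨fun h => ?_, fun i j hij hj => ?_, fun x => ?_⟩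
  · have h1 := orbitMap_dOp hg.wt h (Finsupp.single g 1)
    rw [dOp_single, dVec, hinv, Finset.sum_empty, sub_zero, map_smul, orbitMap_single] at h1
    rw [← h1, weightFun_wtAct]
  · obtain ⟨h1, h2, h3⟩ := hJ i j hij hj
    have e : reflR (i, j, 0) * g = g * reflR (g.right⁻¹ i, g.right⁻¹ j, 0) := by
      rw [mul_reflR]
      simp [rootAct, h3]
    rw [← mul_smul, ← ofW_mul, e, ofW_mul, mul_smul, hg.inv _ _ h2 h1]
  · obtain ⟨a, rfl⟩ := hg.gen x
    refine ⟨a * ofW g⁻¹, ?_⟩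
    rw [← mul_smul, mul_assoc, ← ofW_mul, inv_mul_cancel, ofW_one, mul_one]

end Modules

/-- The permutation part of a rotation by `r` places. -/
def rotPerm [NeZero n] (r : Fin n) : Equiv.Perm (Fin n) := Equiv.addRight r

theorem rotPerm_val [NeZero n] (r i : Fin n) :
    (rotPerm r i : ℕ) = if (i : ℕ) + r < n then (i : ℕ) + r else (i : ℕ) + r - n := by
  rw [rotPerm, Equiv.coe_addRight, Fin.val_add]
  split_ifs with h
  · exact Nat.mod_eq_of_lt h
  · rw [Nat.mod_eq_sub_mod (by omega), Nat.mod_eq_of_lt (by omega)]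

/-- The rotation by `r` places, an element of length zero. -/
def rotElt [NeZero n] (r : Fin n) : ExtAffineWeyl n :=
  trans (fun i => if (i : ℕ) + r < n then 0 else -1) * perm (rotPerm r)⁻¹

theorem shift_rotElt [NeZero n] (r i : Fin n) :
    shift (rotElt r) i = if (i : ℕ) + r < n then 0 else -1 := by
  simp [rotElt]

theorem right_inv_rotElt [NeZero n] (r i : Fin n) : (rotElt r).right⁻¹ i = rotPerm r i := by
  simp [rotElt, trans, perm]

theorem invFin_rotElt [NeZero n] (r : Fin n) : invFin (rotElt r) = ∅ := by
  have h : ∀ i, ptAct (rotElt r) (rho n) i = rho n i - r := fun i => by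
    rw [ptAct, right_inv_rotElt, shift_rotElt, rho, rho, rotPerm_val]
    split_ifs with h
    · push_cast; ring
    · rw [Nat.cast_sub (by omega)]; push_cast; ring
  refine Finset.eq_empty_of_forall_notMem fun β hβ => ?_
  rw [mem_invFin] at hβ
  simp only [rootVal, h] at hβ
  omega

variable {κ : ℤ} {ζ b : Fin n → ℤ} {J : Fin n → Prop}

/-- If the starting values of the segments vary by at most `κ`, then they vary by less than `κ`
after a rotation. -/
theorem exists_isSegmented (hn : 0 < n) (hκ : 0 < κ) (anti : Antitone b)
    (start : ∀ j, ¬J j → ζ j = b j) (first : ∀ j : Fin n, (j : ℕ) = 0 → ¬J j)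
    (join : ∀ i j : Fin n, (j : ℕ) = i + 1 → J j → ζ j = ζ i + 1 ∧ b j = b i)
    (gap : ∀ i j, b i ≤ b j + κ) :
    ∃ (g : ExtAffineWeyl n) (b' : Fin n → ℤ) (J' : Fin n → Prop),
      IsSegmented κ (wtAct κ g ζ) b' J' ∧ invFin g = ∅ ∧
        ∀ i j : Fin n, (j : ℕ) = i + 1 → J' j → J (g.right⁻¹ j) ∧
          (g.right⁻¹ j : ℕ) = (g.right⁻¹ i : ℕ) + 1 ∧ shift g i = shift g j := by
  have : NeZero n := ⟨hn.ne'⟩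
  by_cases hs : ∀ i j, b i < b j + κ
  · refine ⟨1, b, J, ?_, invFin_one, fun i j hij hj => ⟨by simpa using hj, by simpa using hij, by
      simp⟩⟩
    have e : wtAct κ 1 ζ = ζ := by funext i; simp [wtAct]
    rw [e]
    exact ⟨anti, start, first, join, hs⟩
  push Not at hs
  obtain ⟨i0, i1, h01⟩ := hs
  have hex : ∃ r : Fin n, b r < b 0 := by
    refine ⟨i1, ?_⟩
    have := anti (Fin.zero_le i0)
    omega
  classical
  -- Some starting values differ by exactly `κ`. Let `r` be the first position below the top value;
  -- the top positions before `r` are moved to the end and lowered by `κ`. What remains is below the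
  -- top and at least the top minus `κ`, so the new values vary by less than `κ`.
  set S := Finset.univ.filter fun r : Fin n => b r < b 0
  have hS : S.Nonempty := by obtain ⟨r, hr⟩ := hex; exact ⟨r, by simp [S, hr]⟩
  set r := S.min' hS with hr_def
  have hr : b r < b 0 := by have := S.min'_mem hS; simpa [S] using this
  have hmin : ∀ i : Fin n, (i : ℕ) < r → b i = b 0 := fun i hi => by
    by_contra hc
    have h1 : i ∈ S := by
      simp only [S, Finset.mem_filter, Finset.mem_univ, true_and]
      exact lt_of_le_of_ne (anti (Fin.zero_le i)) hc
    have h2 := Fin.le_def.1 (S.min'_le i h1)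
    rw [← hr_def] at h2
    omega
  have hrpos : 0 < (r : ℕ) := by
    rcases Nat.eq_zero_or_pos (r : ℕ) with h | h
    · have : r = 0 := Fin.ext h
      rw [this] at hr; omega
    · exact h
  have hwrap : ∀ j : Fin n, ¬(j : ℕ) + r < n → b (rotPerm r j) = b 0 := fun j hj => by
    apply hmin
    rw [rotPerm_val, if_neg hj]
    have := j.2
    omega
  have hnowrap : ∀ j : Fin n, (j : ℕ) + r < n → b (rotPerm r j) < b 0 ∧ b 0 ≤ b (rotPerm r j) + κ :=
    fun j hj => by
      refine ⟨(anti ?_).trans_lt hr, gap _ _⟩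
      rw [Fin.le_def, rotPerm_val, if_pos hj]; omega
  have hJ0 : ∀ j : Fin n, (j : ℕ) + r = n → ¬J (rotPerm r j) := fun j hj => by
    apply first
    rw [rotPerm_val, if_neg (by omega)]; omega
  have key : ∀ i j : Fin n, (j : ℕ) = i + 1 → J (rotPerm r j) →
      (rotPerm r j : ℕ) = (rotPerm r i : ℕ) + 1 ∧ shift (rotElt r) i = shift (rotElt r) j := by
    intro i j hij hj
    have h1 : (j : ℕ) + r ≠ n := fun h => hJ0 j h hj
    rw [rotPerm_val, rotPerm_val, shift_rotElt, shift_rotElt]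
    by_cases h2 : (j : ℕ) + r < n
    · rw [if_pos h2, if_pos (by omega), if_pos h2, if_pos (by omega)]
      exact ⟨by omega, rfl⟩
    · rw [if_neg h2, if_neg (by omega), if_neg h2, if_neg (by omega)]
      exact ⟨by omega, rfl⟩
  refine ⟨rotElt r, wtAct κ (rotElt r) b, fun j => J (rotPerm r j), ⟨?_, ?_, ?_, ?_, ?_⟩,
    invFin_rotElt r, fun i j hij hj => ?_⟩
  · intro i j hij
    have hij' := Fin.le_def.1 hij
    simp only [wtAct, right_inv_rotElt, shift_rotElt]
    by_cases hj : (j : ℕ) + r < n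
    · rw [if_pos hj, if_pos (by omega)]
      have : b (rotPerm r j) ≤ b (rotPerm r i) := anti (by
        rw [Fin.le_def, rotPerm_val, rotPerm_val, if_pos hj, if_pos (by omega)]; omega)
      omega
    · rw [if_neg hj, hwrap j hj]
      by_cases hi : (i : ℕ) + r < n
      · rw [if_pos hi]
        have := (hnowrap i hi).2
        omega
      · rw [if_neg hi, hwrap i hi]
  · intro j hj
    rw [wtAct, wtAct, right_inv_rotElt, start _ hj]
  · intro j hj hJj
    have e1 : (rotPerm r j : ℕ) = r := by rw [rotPerm_val, hj, if_pos (by omega), zero_add]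
    have e2 : rotPerm r j = r := Fin.ext e1
    rw [e2] at hJj
    have h1 := (join ⟨r - 1, by omega⟩ r (by simp only; omega) hJj).2
    rw [hmin ⟨r - 1, by omega⟩ (by simp only; omega)] at h1
    omega
  · intro i j hij hj
    obtain ⟨h1, h2⟩ := key i j hij hj
    obtain ⟨h3, h4⟩ := join _ _ h1 hj
    simp only [wtAct, right_inv_rotElt, h2, h3, h4]
    exact ⟨by ring, trivial⟩
  · intro i j
    simp only [wtAct, right_inv_rotElt, shift_rotElt]
    by_cases hi : (i : ℕ) + r < n
    · by_cases hj : (j : ℕ) + r < n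
      · have := hnowrap i hi
        have := hnowrap j hj
        rw [if_pos hi, if_pos hj]; omega
      · have := hnowrap i hi
        rw [if_pos hi, if_neg hj, hwrap j hj]; omega
    · by_cases hj : (j : ℕ) + r < n
      · have := hnowrap j hj
        rw [if_neg hi, if_pos hj, hwrap i hi]; omega
      · rw [if_neg hi, if_neg hj, hwrap i hi, hwrap j hj]; omega
  · rw [right_inv_rotElt, right_inv_rotElt]
    exact ⟨hj, key i j hij hj⟩

/-! ### The segments of a parameter -/

section Blocks

variable {p : ℕ} {l m : Fin p → ℤ}

theorem partialSum_zero : partialSum l m 0 = 0 := by simp [partialSum]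

theorem partialSum_mono (hlm : (l, m) ∈ Params n p) : Monotone (partialSum l m) := by
  intro a c hac
  refine Finset.sum_le_sum fun j _ => ?_
  split_ifs with h1 h2 h2
  · exact le_rfl
  · omega
  · exact hlm.1 j
  · exact le_rfl

theorem exists_block (hlm : (l, m) ∈ Params n p) (j : Fin n) :
    ∃ i : Fin p, partialSum l m i ≤ (j : ℕ) ∧ ((j : ℕ) : ℤ) < partialSum l m (i + 1) := by
  have htop : partialSum l m p = n := by
    rw [← hlm.2]
    exact Finset.sum_congr rfl fun i _ => if_pos i.2
  have hex : ∃ k, ((j : ℕ) : ℤ) < partialSum l m k := ⟨p, by rw [htop]; exact_mod_cast j.2⟩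
  classical
  have h1 := Nat.find_spec hex
  have h2 : Nat.find hex ≤ p := Nat.find_min' hex (by rw [htop]; exact_mod_cast j.2)
  have h3 : Nat.find hex ≠ 0 := fun h => by
    rw [h, partialSum_zero] at h1; omega
  have h4 := Nat.find_min hex (m := Nat.find hex - 1) (by omega)
  refine ⟨⟨Nat.find hex - 1, by omega⟩, not_lt.1 h4, ?_⟩
  simp only
  rwa [Nat.sub_add_cancel (by omega)]

theorem block_le (hlm : (l, m) ∈ Params n p) {i i' : Fin p} {j j' : ℕ} (hj : j ≤ j')
    (hi : partialSum l m i ≤ j) (hi' : (j' : ℤ) < partialSum l m (i' + 1)) : i ≤ i' := by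
  by_contra hc
  rw [not_le, Fin.lt_def] at hc
  have := partialSum_mono hlm (show (i' : ℕ) + 1 ≤ i by omega)
  omega

theorem zetaCoord_eq (hlm : (l, m) ∈ Params n p) {i : Fin p} {j : Fin n}
    (hi : partialSum l m i ≤ (j : ℕ)) (hi' : ((j : ℕ) : ℤ) < partialSum l m (i + 1)) :
    zetaCoord l m j = m i - (i : ℕ) + (j : ℕ) - partialSum l m i := by
  rw [zetaCoord, Finset.sum_eq_single i, if_pos ⟨hi, hi'⟩]
  · intro i' _ hne
    rw [if_neg]
    rintro ⟨h1, h2⟩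
    exact hne (le_antisymm (block_le hlm le_rfl h1 hi') (block_le hlm le_rfl hi h2))
  · exact fun h => absurd (Finset.mem_univ i) h

/-- The position `j` belongs to the same part as its predecessor. -/
def IsJoined (l m : Fin p → ℤ) (j : Fin n) : Prop :=
  (j : ℕ) ≠ 0 ∧ ∀ k : ℕ, 1 ≤ k → k < p → ((j : ℕ) : ℤ) ≠ partialSum l m k

theorem IsAffineDominant.antitone (hm : IsAffineDominant κ m) :
    Antitone fun i : Fin p => m i - (i : ℕ) := by
  have h : ∀ d : ℕ, ∀ i j : Fin p, (j : ℕ) = i + d → m j - (j : ℕ) ≤ m i - (i : ℕ) := by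
    intro d
    induction d with
    | zero => intro i j hij; rw [show i = j from Fin.ext (by omega)]
    | succ d ih =>
      intro i j hij
      have h1 := hm j
      rw [bracket, if_neg (by omega)] at h1
      have h2 := ih i ⟨j - 1, by omega⟩ (by simp only; omega)
      simp only at h2
      omega
  intro i j hij
  exact h (j - i) i j (by have := Fin.le_def.1 hij; omega)

/-- The extremes of `m_i - i` are at the ends, where this is `[m]_0 ≥ 0`. Equality may occur, which
is why a rotation is needed. -/
theorem IsAffineDominant.gap (hm : IsAffineDominant κ m) (i j : Fin p) :
    m i - (i : ℕ) ≤ m j - (j : ℕ) + κ := by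
  have hp : 0 < p := i.pos
  have h0 := hm ⟨0, hp⟩
  rw [bracket, if_pos rfl] at h0
  have h1 := hm.antitone (show (⟨0, hp⟩ : Fin p) ≤ i from Fin.le_def.2 (Nat.zero_le _))
  have h2 := hm.antitone (show j ≤ ⟨p - 1, by omega⟩ from Fin.le_def.2 (by simp only; omega))
  simp only at h1 h2
  omega

/-- The starting value of the part containing `j`. Empty parts cause no trouble, since only parts
containing a position enter. -/
theorem exists_segments (hlm : (l, m) ∈ Params n p) (hm : IsAffineDominant κ m) :
    ∃ b : Fin n → ℤ, Antitone b ∧ (∀ j, ¬IsJoined l m j → zetaCoord l m j = b j) ∧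
      (∀ i j : Fin n, (j : ℕ) = i + 1 → IsJoined l m j →
        zetaCoord l m j = zetaCoord l m i + 1 ∧ b j = b i) ∧ ∀ i j, b i ≤ b j + κ := by
  choose B hB hB' using exists_block (n := n) hlm
  refine ⟨fun j => m (B j) - (B j : ℕ), fun i j hij => ?_, fun j hj => ?_, fun i j hij hj => ?_,
    fun i j => hm.gap _ _⟩
  · exact hm.antitone (block_le hlm (Fin.le_def.1 hij) (hB i) (hB' j))
  -- A position that is not joined is the first of its part, even when several partial sums coincide
  -- there.
  · have h1 : ((j : ℕ) : ℤ) = partialSum l m (B j) := by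
      by_cases h0 : (j : ℕ) = 0
      · have h2 := partialSum_mono hlm (Nat.zero_le (B j))
        rw [partialSum_zero] at h2
        have h3 := hB j
        omega
      · simp only [IsJoined, not_and, not_forall, not_not] at hj
        obtain ⟨k, hk, hkp, hjk⟩ := hj h0
        have h2 := block_le hlm (i := ⟨k, hkp⟩) le_rfl hjk.ge (hB' j)
        have h3 := partialSum_mono hlm (Fin.le_def.1 h2)
        have h4 := hB j
        simp only at h3
        omega
    rw [zetaCoord_eq hlm (hB j) (hB' j)]
    simp only
    omega
  · have h1 : B j = B i := by
      refine le_antisymm ?_ (block_le hlm (by omega) (hB i) (hB' j))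
      by_contra hc
      rw [not_le, Fin.lt_def] at hc
      have h2 := partialSum_mono hlm (show (B i : ℕ) + 1 ≤ B j by omega)
      have h3 := hB j
      have h4 := hB' i
      exact hj.2 (B j) (by omega) (B j).2 (by omega)
    have h2 := hB i
    have h3 := hB' i
    refine ⟨?_, by simp only [h1]⟩
    rw [zetaCoord_eq hlm (hB j) (hB' j), zetaCoord_eq hlm h2 h3, h1]
    omega

end Blocks

end

/-! ### Comparison of quotients of the induced module. -/

section

variable {n p : ℕ} {κ : ℤ} {l m : Fin p → ℤ}

/-! ### Quotients of the induced modules -/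

section Modules

set_option linter.unusedSectionVars false

variable {Q : Type*} [AddCommGroup Q] [Module ℂ Q] [Module (DDAHA n) Q] [IsScalarTower ℂ (DDAHA n) Q]
  {Q' : Type*} [AddCommGroup Q'] [Module ℂ Q'] [Module (DDAHA n) Q'] [IsScalarTower ℂ (DDAHA n) Q']

theorem map_mem_wtSpace (f : Q →ₗ[DDAHA n] Q') {a : Fin n → ℤ} {x : Q} (hx : x ∈ wtSpace Q a) :
    f x ∈ wtSpace Q' a := by
  refine mem_genWeight.2 fun i => ?_
  obtain ⟨k, hk⟩ := mem_genWeight.1 hx i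
  refine ⟨k, ?_⟩
  have h : ∀ (k : ℕ) (x : Q), ((xOp Q' i - (a i : ℂ) • (1 : Module.End ℂ Q')) ^ k) (f x) =
      f (((xOp Q i - (a i : ℂ) • (1 : Module.End ℂ Q)) ^ k) x) := by
    intro k
    induction k with
    | zero => intro x; rfl
    | succ k ih =>
      intro x
      rw [pow_succ, pow_succ, Module.End.mul_apply, Module.End.mul_apply, ← ih]
      congr 1
      have hs : ∀ (c : ℂ) (y : Q), f (c • y) = c • f y := fun c y => by
        rw [← algebraMap_smul (DDAHA n) c y, map_smul, algebraMap_smul]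
      simp [xOp, hs]
  rw [h, hk, map_zero]

/-- The two weight spaces embed through the coordinate inclusions, which are module maps. -/
theorem finrank_wtSpace_prod_le (a : Fin n → ℤ) [FiniteDimensional ℂ (wtSpace Q a)]
    [FiniteDimensional ℂ (wtSpace Q' a)] (hfd : FiniteDimensional ℂ (wtSpace (Q × Q') a)) :
    Module.finrank ℂ (wtSpace Q a) + Module.finrank ℂ (wtSpace Q' a) ≤
      Module.finrank ℂ (wtSpace (Q × Q') a) := by
  rw [← Module.finrank_prod]
  refine LinearMap.finrank_le_finrank_of_injective
    (f := LinearMap.codRestrict (wtSpace (Q × Q') a)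
      ((wtSpace Q a).subtype.prodMap (wtSpace Q' a).subtype) fun x => ?_) fun x y hxy => ?_
  · have h1 := map_mem_wtSpace (LinearMap.inl (DDAHA n) Q Q') x.1.2
    have h2 := map_mem_wtSpace (LinearMap.inr (DDAHA n) Q Q') x.2.2
    have h3 := Submodule.add_mem _ h1 h2
    simpa using h3
  · have h := congrArg Subtype.val hxy
    simp only [LinearMap.codRestrict_apply, LinearMap.prodMap_apply, Prod.mk.injEq] at h
    exact Prod.ext (Subtype.ext h.1) (Subtype.ext h.2)

theorem isGenBy_of_surjective (f : IndModule n κ l m →ₗ[DDAHA n] Q) (hf : Function.Surjective f) :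
    IsGenBy (n := n) κ (zetaCoord l m) (IsJoined l m) (f (Submodule.Quotient.mk 1)) := by
  have key : ∀ a : DDAHA n, a ∈ indIdeal n κ l m → a • f (Submodule.Quotient.mk 1) = 0 := by
    intro a ha
    rw [← map_smul, ← Submodule.Quotient.mk_smul, smul_eq_mul, mul_one,
      (Submodule.Quotient.mk_eq_zero _).2 ha, map_zero]
  refine ⟨fun h => ?_, fun i j hij hj => ?_, fun x => ?_⟩
  · have h1 := key _ (Submodule.subset_span (Or.inr ⟨h, rfl⟩))
    rw [sub_smul, sub_eq_zero, algebraMap_smul] at h1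
    rw [h1, zeta_eq_weightFun]
  · have h1 := key _ (Submodule.subset_span (Or.inl ⟨Equiv.swap i j,
      Subgroup.subset_closure ⟨i, j, hij, hj.2, rfl⟩, rfl⟩))
    rwa [sub_smul, sub_eq_zero, one_smul, perm_swap_eq] at h1
  · obtain ⟨y, rfl⟩ := hf x
    obtain ⟨a, rfl⟩ := Submodule.Quotient.mk_surjective _ y
    refine ⟨a, ?_⟩
    rw [← map_smul, ← Submodule.Quotient.mk_smul, smul_eq_mul, mul_one]

end Modules

theorem surjective_mkQ_prod {R M : Type*} [Ring R] [AddCommGroup M] [Module R M]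
    {N N' : Submodule R M} (h : N ⊔ N' = ⊤) : Function.Surjective (N.mkQ.prod N'.mkQ) := by
  rintro ⟨x, y⟩
  obtain ⟨x, rfl⟩ := N.mkQ_surjective x
  obtain ⟨y, rfl⟩ := N'.mkQ_surjective y
  obtain ⟨u, hu, u', hu', e⟩ := Submodule.mem_sup.1 (show x - y ∈ N ⊔ N' from h ▸ Submodule.mem_top)
  refine ⟨x - u, Prod.ext ?_ ?_⟩
  · simpa using hu
  · have : x - u = y + u' := by
      rw [eq_sub_iff_add_eq] at e
      rw [← e]; abel
    simpa [this] using hu'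

/-- Two proper submodules of the induced module do not span it. -/
theorem sup_ne_top (hn : 0 < n) (hκ : 0 < κ) (hlm : (l, m) ∈ Params n p)
    (hm : IsAffineDominant κ m) {N N' : Submodule (DDAHA n) (IndModule n κ l m)} (hN : N ≠ ⊤)
    (hN' : N' ≠ ⊤) : N ⊔ N' ≠ ⊤ := by
  intro hsup
  obtain ⟨b, hb, hstart, hjoin, hgap⟩ := exists_segments hlm hm
  obtain ⟨g, b', J', hseg, hinv, hJ⟩ :=
    exists_isSegmented hn hκ hb hstart (fun j hj h => h.1 hj) hjoin hgap
  obtain ⟨a, ha, hs, hu⟩ := hseg.exists_sorted hκ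
  have hgen : ∀ {Q : Type} [AddCommGroup Q] [Module ℂ Q] [Module (DDAHA n) Q]
      [IsScalarTower ℂ (DDAHA n) Q] (f : IndModule n κ l m →ₗ[DDAHA n] Q),
      Function.Surjective f →
      IsGenBy κ (wtAct κ g (zetaCoord l m)) J' (ofW g • f (Submodule.Quotient.mk 1)) :=
    fun f hf => (isGenBy_of_surjective f hf).ofW_smul g hinv hJ
  have hpos : ∀ {N : Submodule (DDAHA n) (IndModule n κ l m)}, N ≠ ⊤ →
      ofW g • N.mkQ (Submodule.Quotient.mk 1) ≠ 0 := by
    intro N hN h0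
    apply hN
    rw [eq_top_iff]
    intro x _
    obtain ⟨c, hc⟩ := (hgen N.mkQ N.mkQ_surjective).gen (N.mkQ x)
    rw [h0, smul_zero] at hc
    exact (Submodule.Quotient.mk_eq_zero N).1 hc.symm
  have h1 := hgen N.mkQ N.mkQ_surjective
  have h2 := hgen N'.mkQ N'.mkQ_surjective
  -- If the submodules span, the product of the two quotients is itself a quotient of the induced
  -- module, so the upper bound for cyclic modules applies to it.
  have h3 := hgen (N.mkQ.prod N'.mkQ) (surjective_mkQ_prod hsup)
  obtain ⟨hne1, hsum⟩ := hu _ _ h1 (hpos hN)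
  obtain ⟨hne2, -⟩ := hu _ _ h2 (hpos hN')
  have k1 := h1.le_finrank hseg hκ ha hsum hs hne1
  have k2 := h2.le_finrank hseg hκ ha hsum hs hne2
  have f1 := h1.finiteDimensional hseg hκ ha hsum
  have f2 := h2.finiteDimensional hseg hκ ha hsum
  have f3 := h3.finiteDimensional hseg hκ ha hsum
  have k3 := Module.finrank_le_of_rank_le (h3.rank_le hseg hκ ha hsum)
  have k4 := finrank_wtSpace_prod_le a f3
  have k5 := (Module.finrank_pos_iff (R := ℂ)).2 ((Submodule.nontrivial_iff_ne_bot).2 hne2)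
  -- With `d` the product of factorials, both factors have dimension at least `d`, the product at
  -- most `d`, and the second dimension is positive.
  omega

end

end DegDAHA

end

theorem mainTheorem2 (n p : ℕ) (hn : 0 < n) (hp : 0 < p) (κ : ℤ) (hκ : 0 < κ)
    (l m : Fin p → ℤ) (hlm : (l, m) ∈ DegDAHA.Params n p)
    (hm : DegDAHA.IsAffineDominant κ m) :
    ∃! N : Submodule (DegDAHA.DDAHA n) (DegDAHA.IndModule n κ l m),
      IsSimpleModule (DegDAHA.DDAHA n) (DegDAHA.IndModule n κ l m ⧸ N) := by
  obtain ⟨b, hb, hstart, hjoin, hgap⟩ := DegDAHA.exists_segments (n := n) hlm hm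
  have h1 := DegDAHA.one_notMem_indIdeal κ l m (n := n) fun i j hij hk =>
    (hjoin i j hij ⟨by omega, hk⟩).1
  have : Nontrivial (DegDAHA.IndModule n κ l m) :=
    ⟨Submodule.Quotient.mk 1, 0, fun h => h1 ((Submodule.Quotient.mk_eq_zero _).1 h)⟩
  -- The induced module is generated by one element and is nonzero, so a maximal proper submodule
  -- exists; two different ones would span, against `sup_ne_top`.
  obtain ⟨N, hN⟩ := IsCoatomic.exists_coatom
    (Submodule (DegDAHA.DDAHA n) (DegDAHA.IndModule n κ l m))
  refine ⟨N, isSimpleModule_iff_isCoatom.2 hN, fun N' hN' => ?_⟩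
  replace hN' := isSimpleModule_iff_isCoatom.1 hN'
  by_contra hne
  exact DegDAHA.sup_ne_top hn hκ hlm hm hN'.1 hN.1 (hN'.codisjoint_of_ne hN hne).eq_top
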